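/- Fix $d\in(0,1)$ and an even smooth function $\varphi:\mathbb{R}\to[0,1]$ supported in $[-8/5,8/5]$ and equal to $1$ on $[-5/4,5/4]$. For $\xi\in\mathbb{R}^2$ let $$\Lambda_e(\xi)=\sqrt{1+d|\xi|^2},\qquad \Lambda_b(\xi)=\sqrt{1+|\xi|^2},\qquad \Lambda_{-e}=-\Lambda_e,\qquad \Lambda_{-b}=-\Lambda_b,$$ and for $\sigma,\mu,\nu\in\{e,b,-e,-b\}$ let $\Phi(\xi,\eta)=\Phi_{\sigma\mu\nu}(\xi,\eta)=\Lambda_\sigma(\xi)-\Lambda_\mu(\xi-\eta)-\Lambda_\nu(\eta)$. Let $(A_n)_{n\ge 0}$ be a sequence of real numbers. Then there is a constant $C>0$, depending only on $d$, $\varphi$ and $(A_n)_{n\geq 0}$, such that the following holds for all $\sigma,\mu,\nu\in\{e,b,-e,-b\}$. Let $m,k\ge 0$ be integers and let $s,\lambda\in\mathbb{R}$ satisfy $$2^m-1\le |s|\le 2^{m+1},\qquad \frac{5m}{6}\le\lambda\le m(1-10^{-4}).$$ Let $a:\mathbb{R}^2\times\mathbb{R}^2\to\mathbb{C}$ be a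 smooth function that is supported in $B(0,2^k)\times B(0,2^k)$ and whose derivatives of order $n$ in $(\xi,\eta)$ are bounded, for every $n\ge 0$, by $$\sup_{\xi,\eta\in\mathbb{R}^2}\big|D^n_{\xi,\eta}a(\xi,\eta)\big|\le A_n\,2^{nm/2}.$$ Then for every $f\in L^2(\mathbb{R}^2)$ the integral $$Tf(\xi):=\int_{\mathbb{R}^2}e^{is\Phi(\xi,\eta)}\,a(\xi,\eta)\,\varphi(2^\lambda\Phi(\xi,\eta))\,f(\eta)\,d\eta$$ converges absolutely for every $\xi\in\mathbb{R}^2$, and $$\|Tf\|_{L^2}\le C\,2^{12k}\,2^{-1.004\lambda}\,\|f\|_{L^2}.$$ -/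

import Mathlib

open MeasureTheory
open scoped ContDiff

noncomputable section

/-- The Euclidean plane `ℝ²`. -/
abbrev Plane : Type := EuclideanSpace ℝ (Fin 2)

/-- The four indices `e`, `b`, `-e`, `-b`. -/
inductive PhaseIndex : Type
  | e
  | b
  | negE
  | negB

/-- The dispersion relations `Λ_e(ξ) = √(1 + d|ξ|²)`, `Λ_b(ξ) = √(1 + |ξ|²)`,
`Λ_{-e} = -Λ_e`, `Λ_{-b} = -Λ_b`. -/
def dispersion (d : ℝ) : PhaseIndex → Plane → ℝ
  | .e, ξ => Real.sqrt (1 + d * ‖ξ‖ ^ 2)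
  | .b, ξ => Real.sqrt (1 + ‖ξ‖ ^ 2)
  | .negE, ξ => -Real.sqrt (1 + d * ‖ξ‖ ^ 2)
  | .negB, ξ => -Real.sqrt (1 + ‖ξ‖ ^ 2)

/-- The phase `Φ_{σμν}(ξ,η) = Λ_σ(ξ) - Λ_μ(ξ-η) - Λ_ν(η)`. -/
def phase (d : ℝ) (σ μ ν : PhaseIndex) (ξ η : Plane) : ℝ :=
  dispersion d σ ξ - dispersion d μ (ξ - η) - dispersion d ν η

/-- The cutoff functions: even smooth `φ : ℝ → [0,1]`, supported in `[-8/5,8/5]`, equal to `1` on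
`[-5/4,5/4]`. -/
structure IsCutoff (φ : ℝ → ℝ) : Prop where
  smooth : ContDiff ℝ ∞ φ
  even : ∀ x, φ (-x) = φ x
  mem_Icc : ∀ x, φ x ∈ Set.Icc (0 : ℝ) 1
  support_subset : Function.support φ ⊆ Set.Icc (-(8 / 5)) (8 / 5)
  eq_one : ∀ x ∈ Set.Icc (-(5 / 4) : ℝ) (5 / 4), φ x = 1

/-- The kernel `e^{isΦ(ξ,η)} a(ξ,η) φ(2^λ Φ(ξ,η))`; the parameter `l` is the exponent `λ`. -/
def fioKernel (d : ℝ) (σ μ ν : PhaseIndex) (φ : ℝ → ℝ) (s l : ℝ) (a : Plane × Plane → ℂ)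
    (ξ η : Plane) : ℂ :=
  Complex.exp (Complex.I * ((s * phase d σ μ ν ξ η : ℝ) : ℂ)) * a (ξ, η) *
    ((φ ((2 : ℝ) ^ l * phase d σ μ ν ξ η) : ℝ) : ℂ)

/-- The operator `Tf(ξ) = ∫ e^{isΦ(ξ,η)} a(ξ,η) φ(2^λ Φ(ξ,η)) f(η) dη`. -/
def fio (d : ℝ) (σ μ ν : PhaseIndex) (φ : ℝ → ℝ) (s l : ℝ) (a : Plane × Plane → ℂ)
    (f : Plane → ℂ) (ξ : Plane) : ℂ :=
  ∫ η, fioKernel d σ μ ν φ s l a ξ η * f η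

/-- The symbol hypotheses on `a`: it is smooth, supported in `B(0,2^k) × B(0,2^k)`, and its
derivatives of total order `n` in `(ξ,η)` are bounded by `A n * 2^(n m / 2)`, for every `n`.
(The norm of the `n`-th iterated derivative is comparable to the maximum of the partial derivatives
`D^α a`, `|α| = n`, with constants that depend on `n` only.) -/
structure IsSymbol (A : ℕ → ℝ) (m k : ℕ) (a : Plane × Plane → ℂ) : Prop where
  smooth : ContDiff ℝ ∞ a
  support_subset :
    Function.support a ⊆ Metric.ball (0 : Plane) (2 ^ k) ×ˢ Metric.ball (0 : Plane) (2 ^ k)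
  bound : ∀ (n : ℕ) (x : Plane × Plane),
    ‖iteratedFDeriv ℝ n a x‖ ≤ A n * (2 : ℝ) ^ ((n : ℝ) * (m : ℝ) / 2)

end

/-!
Write `E_c(v) = √(1 + c|v|²)` (`energy`) and `ε = 2^{-λ}`. Each of the phases has the form
`Φ(ξ, η) = e₁ E₁(ξ) + e₂ E₂(ξ - η) + e₃ E₃(η)` with signs `eᵢ` and coefficients `d` or `1`
(`PhaseData`), and the kernel lives on the set `|Φ| ≤ 2ε`. For fixed `ξ` or `η`, this set has area
`O(ε K⁴)` in the ball of radius `K = 2^k` (`volume_diff_le`, `volume_sum_le`), so that Schur's test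
gives the operator norm `O(ε)`. The point is the gain of a further power of `ε`. It comes from the
rotational curvature `Υ`, the mixed Hessian `∇_ξ∇_ηΦ` evaluated on the rotated gradients of `Φ` in
`ξ` and in `η` (`PhaseData.curvature`). The amplitude is split by a smooth cutoff at
`|Υ| ~ κ = ε^{1/30}`.

*Small curvature.* On the resonant set `Φ = 0` the curvature is a polynomial in two of the energies
(`PhaseData.curvature_mul`, `curvPoly`). If the sign of `ξ` differs from the two others, then for
fixed `η` smallness of this polynomial confines the energy of `ξ`, and by the resonance that of
`ξ - η`, to a short interval (`exists_abs_energy_sub_le`). By the law of cosines the direction of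
`ξ` is confined to a thin sector (`exists_cos_sub_le`), and the area gains a factor `√κ`
(`PhaseData.IsLeft.exists_volume_isBad_le`). If the sign of `ξ - η` differs from the two others,
then `Υ` is bounded below on the resonant set by a power of `K` (`exists_one_le_of_isMiddle`). The
case of `η` reduces to that of `ξ` by symmetry (`PhaseData.swap`), and phases without resonances
satisfy `|Φ| ≥ 1/(3K)`. Since one of the two families of slices gains `√κ = ε^{1/60}`, Schur's test
bounds the square of the operator norm by `ε^{2 + 1/60}` (`exists_l2Bound_of_small_curvature`).

*Large curvature.* Here the `T* T` method applies, after a decomposition of `η`-space into cells of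
diameter comparable with `κ` (`IsKernel.l2Bound_of_cells`, `IsKernel.l2Bound_of_gram`). Near the
diagonal, for `|η - η'| ≤ ρ = ε^{1/4}`, the set `|Φ(ξ, ·)| ≤ 2ε` is a strip of width `O(ε/κ)` and
length `ρ` (`volume_levelSet_inter_closedBall_le`), which gains `ρ`. Away from the diagonal the
kernel of `T* T` is integrated by parts once along the Hamiltonian field of `Φ(·, η)`
(`enorm_gram_far_le`). This field annihilates all functions of `Φ(·, η)`, the cutoff among them,
and it differentiates `Φ(·, η')` to the Poisson bracket of the two phases. As `η` and `η'` both lie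
near the same level set of `Φ(ξ, ·)`, the displacement `η' - η` is nearly parallel to the rotated
gradient, and the bracket has size `κ|η - η'|` (`PhaseData.abs_bracket_ge`). The remaining factor
`e^{isx} φ(2^λ x)` is, since `2^λ ≤ |s|^{1-δ}`, the derivative of a function of size `1/|s|` up to a
negligible error (`exists_antideriv_oscCutoff`), and derivatives of the amplitude cost only
`2^{m/2}`. The square of the operator norm is bounded by `ε^{2 + 1/12}`
(`exists_l2Bound_of_large_curvature`).

Both exponents exceed `2 · 1.004`.
-/

noncomputable section

namespace KleinGordon

open scoped RealInnerProductSpace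

/-! ### Energies and velocities -/

/-- The relativistic energy `√(1 + c|v|²)` of the momentum `v`. -/
def energy (c : ℝ) (v : Plane) : ℝ := Real.sqrt (1 + c * ‖v‖ ^ 2)

/-- The group velocity, that is, the gradient of `energy c`. -/
def velocity (c : ℝ) (v : Plane) : Plane := (c / energy c v) • v

/-- Rotation of the plane by a right angle. -/
def perp : Plane →ₗᵢ[ℝ] Plane where
  toFun v := !₂[-v 1, v 0]
  map_add' v w := by ext i; fin_cases i <;> simp [add_comm]
  map_smul' r v := by ext i; fin_cases i <;> simp
  norm_map' v := by
    simp [EuclideanSpace.norm_eq, Fin.sum_univ_two, add_comm]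

lemma inner_plane (v w : Plane) : ⟪v, w⟫ = v 0 * w 0 + v 1 * w 1 := by
  simp [PiLp.inner_apply, Fin.sum_univ_two, mul_comm]

@[simp] lemma perp_zero_coord (v : Plane) : perp v 0 = -v 1 := rfl

@[simp] lemma perp_one_coord (v : Plane) : perp v 1 = v 0 := rfl

lemma inner_perp_self (v : Plane) : ⟪perp v, v⟫ = 0 := by
  simp [inner_plane]; ring

lemma norm_perp (v : Plane) : ‖perp v‖ = ‖v‖ := perp.norm_map v

/-- Lagrange's identity in the plane. -/
lemma inner_perp_sq (v w : Plane) : ⟪perp v, w⟫ ^ 2 = ‖v‖ ^ 2 * ‖w‖ ^ 2 - ⟪v, w⟫ ^ 2 := by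
  rw [← real_inner_self_eq_norm_sq, ← real_inner_self_eq_norm_sq]
  simp only [inner_plane, perp_zero_coord, perp_one_coord]
  ring

/-- Expansion of `h` in the orthogonal frame `q`, `perp q`. -/
lemma norm_sq_smul_eq (q h : Plane) : ‖q‖ ^ 2 • h = ⟪q, h⟫ • q + ⟪perp q, h⟫ • perp q := by
  have hq : ‖q‖ ^ 2 = q 0 * q 0 + q 1 * q 1 := by
    rw [← real_inner_self_eq_norm_sq, inner_plane]
  rw [hq]
  ext i
  fin_cases i <;> simp [inner_plane] <;> ring

lemma energy_le {c : ℝ} (hc1 : c ≤ 1) (v : Plane) : energy c v ≤ 1 + ‖v‖ := by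
  refine Real.sqrt_le_iff.2 ⟨by positivity, ?_⟩
  nlinarith [mul_le_mul_of_nonneg_right hc1 (sq_nonneg ‖v‖), norm_nonneg v]

section Energy

variable {c : ℝ} (hc : 0 ≤ c)
include hc

lemma one_le_radicand (v : Plane) : 1 ≤ 1 + c * ‖v‖ ^ 2 := by
  have := mul_nonneg hc (sq_nonneg ‖v‖); linarith

lemma one_le_energy (v : Plane) : 1 ≤ energy c v := Real.one_le_sqrt.2 (one_le_radicand hc v)

lemma energy_pos (v : Plane) : 0 < energy c v := lt_of_lt_of_le one_pos (one_le_energy hc v)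

lemma energy_sq (v : Plane) : energy c v ^ 2 = 1 + c * ‖v‖ ^ 2 :=
  Real.sq_sqrt (by linarith [one_le_radicand hc v])

lemma hasFDerivAt_energy (v : Plane) :
    HasFDerivAt (energy c) (innerSL ℝ (velocity c v)) v := by
  have h1 : HasFDerivAt (fun x : Plane => 1 + c * ‖x‖ ^ 2)
      (c • (2 • (innerSL ℝ v) ∘SL (ContinuousLinearMap.id ℝ Plane))) v :=
    ((hasFDerivAt_id v).norm_sq.const_mul c).const_add 1
  have h2 := h1.sqrt (by linarith [one_le_radicand hc v] : 1 + c * ‖v‖ ^ 2 ≠ 0)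
  refine h2.congr_fderiv ?_
  ext w
  have h3 := energy_pos hc v
  have : √(1 + c * ‖v‖ ^ 2) = energy c v := rfl
  simp only [this, velocity, smul_apply, ContinuousLinearMap.comp_apply,
    ContinuousLinearMap.id_apply, innerSL_apply_apply, inner_smul_left, smul_eq_mul, nsmul_eq_mul,
    conj_trivial]
  field_simp
  push_cast
  ring

lemma contDiff_energy {n : WithTop ℕ∞} : ContDiff ℝ n (energy c) := by
  refine ContDiff.sqrt (contDiff_const.add (contDiff_const.mul (contDiff_norm_sq ℝ))) fun v => ?_
  linarith [one_le_radicand hc v]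

lemma contDiff_velocity {n : WithTop ℕ∞} : ContDiff ℝ n (velocity c) := by
  have : ContDiff ℝ n fun v : Plane => c / energy c v :=
    contDiff_const.div (contDiff_energy hc) fun v => (energy_pos hc v).ne'
  exact this.smul contDiff_id

lemma sq_norm_velocity (v : Plane) :
    ‖velocity c v‖ ^ 2 = c * (1 - 1 / energy c v ^ 2) := by
  have h := energy_pos hc v
  have h2 := energy_sq hc v
  rw [velocity, norm_smul, mul_pow, Real.norm_eq_abs, sq_abs]
  field_simp
  linear_combination (-c) * h2

lemma norm_velocity_le (hc1 : c ≤ 1) (v : Plane) : ‖velocity c v‖ ≤ 1 := by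
  have h := sq_norm_velocity hc v
  have h2 := energy_pos hc v
  have : 0 < 1 / energy c v ^ 2 := by positivity
  have h3 : ‖velocity c v‖ ^ 2 ≤ 1 := by
    rw [h]; nlinarith
  exact (sq_le_one_iff₀ (norm_nonneg _)).1 h3

end Energy

/-- The Hessian of `energy c`, as a linear map. -/
def hessian (c : ℝ) (y : Plane) : Plane →L[ℝ] Plane :=
  (c / energy c y) • (ContinuousLinearMap.id ℝ Plane -
    (c / energy c y ^ 2) • (innerSL ℝ y).smulRight y)

lemma hessian_apply (c : ℝ) (y h : Plane) :
    hessian c y h = (c / energy c y) • (h - ((c / energy c y ^ 2) * ⟪y, h⟫) • y) := by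
  simp [hessian, smul_smul]

section Hessian

variable {c : ℝ} (hc : 0 ≤ c)
include hc

lemma hasFDerivAt_velocity (v : Plane) : HasFDerivAt (velocity c) (hessian c v) v := by
  have hE := energy_pos hc v
  have h1 : HasFDerivAt (fun x => c / energy c x)
      ((-(c / energy c v ^ 2)) • innerSL ℝ (velocity c v)) v := by
    have h := ((hasDerivAt_inv hE.ne').comp_hasFDerivAt v (hasFDerivAt_energy hc v)).const_mul c
    refine (h.congr_fderiv ?_).congr_of_eventuallyEq (by simp [div_eq_mul_inv])
    ext w
    simp
    field_simp
  have h2 := h1.smul (hasFDerivAt_id v)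
  refine h2.congr_fderiv ?_
  ext1 w
  rw [hessian_apply]
  simp only [velocity, map_smul, add_apply,
    smul_apply, ContinuousLinearMap.smulRight_apply, smul_eq_mul,
    ContinuousLinearMap.id_apply, innerSL_apply_apply, smul_sub, smul_smul, id]
  rw [sub_eq_add_neg, ← neg_smul]
  congr 2
  field_simp

lemma norm_hessian_le (y : Plane) : ‖hessian c y‖ ≤ c := by
  refine ContinuousLinearMap.opNorm_le_bound _ hc fun h => ?_
  have hE := energy_pos hc y
  have hE1 := one_le_energy hc y
  have hE2 := energy_sq hc y
  rw [hessian_apply, norm_smul, Real.norm_eq_abs, abs_of_nonneg (by positivity)]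
  have key : ‖h - ((c / energy c y ^ 2) * ⟪y, h⟫) • y‖ ≤ ‖h‖ := by
    refine abs_le_of_sq_le_sq' ?_ (norm_nonneg _) |>.2
    rw [norm_sub_sq_real, inner_smul_right, norm_smul, mul_pow, Real.norm_eq_abs, sq_abs,
      real_inner_comm y h]
    set t := ⟪y, h⟫
    have : c * ‖y‖ ^ 2 = energy c y ^ 2 - 1 := by linarith
    have h3 : (c / energy c y ^ 2 * t) ^ 2 * ‖y‖ ^ 2
        = c / energy c y ^ 2 * t ^ 2 * ((energy c y ^ 2 - 1) / energy c y ^ 2) := by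
      rw [← this]; field_simp
    have h4 : (energy c y ^ 2 - 1) / energy c y ^ 2 ≤ 1 := by
      rw [div_le_one (by positivity)]; linarith
    have h5 : 0 ≤ c / energy c y ^ 2 * t ^ 2 := by positivity
    rw [h3]
    nlinarith
  calc c / energy c y * ‖h - ((c / energy c y ^ 2) * ⟪y, h⟫) • y‖
      ≤ c * ‖h‖ := by gcongr; exact div_le_self hc hE1
  
lemma norm_velocity_sub_le (x y : Plane) : ‖velocity c x - velocity c y‖ ≤ c * ‖x - y‖ :=
  convex_univ.norm_image_sub_le_of_norm_hasFDerivWithin_le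
    (fun z _ => (hasFDerivAt_velocity hc z).hasFDerivWithinAt)
    (fun z _ => norm_hessian_le hc z) (Set.mem_univ y) (Set.mem_univ x)

lemma abs_energy_sub_le (hc1 : c ≤ 1) (x y : Plane) : |energy c x - energy c y| ≤ ‖x - y‖ := by
  have := convex_univ.norm_image_sub_le_of_norm_hasFDerivWithin_le (C := 1)
    (fun z _ => (hasFDerivAt_energy hc z).hasFDerivWithinAt)
    (fun z _ => by rw [innerSL_apply_norm]; exact norm_velocity_le hc hc1 z)
    (Set.mem_univ y) (Set.mem_univ x)
  simpa using this

/-- In terms of the normalized velocity `u = v / √c`, the Hessian is `(c/E)(1 - u ⊗ u)`, and `1/E`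
and `u` are Lipschitz functions of the momentum. -/
lemma norm_hessian_sub_le (hc1 : c ≤ 1) (x y : Plane) :
    ‖hessian c x - hessian c y‖ ≤ 4 * ‖x - y‖ := by
  refine ContinuousLinearMap.opNorm_le_bound _ (by positivity) fun h => ?_
  have hEx := one_le_energy hc x
  have hEy := one_le_energy hc y
  have hx0 := energy_pos hc x
  have hy0 := energy_pos hc y
  have hrep : ∀ z, hessian c z h = (c / energy c z) • h
      - (1 / energy c z) • (⟪velocity c z, h⟫ • velocity c z) := by
    intro z
    have := energy_pos hc z
    rw [hessian_apply, velocity, inner_smul_left, smul_sub, smul_smul, smul_smul, smul_smul]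
    congr 2
    simp only [conj_trivial]
    field_simp
  have hinv : |1 / energy c x - 1 / energy c y| ≤ ‖x - y‖ := by
    have : 1 / energy c x - 1 / energy c y
        = (energy c y - energy c x) / (energy c x * energy c y) := by
      field_simp
    rw [this, abs_div, abs_of_pos (mul_pos hx0 hy0)]
    refine (div_le_self (abs_nonneg _) (one_le_mul_of_one_le_of_one_le hEx hEy)).trans ?_
    rw [abs_sub_comm]
    exact abs_energy_sub_le hc hc1 x y
  set u := velocity c x
  set v := velocity c y
  have hu : ‖u‖ ≤ 1 := norm_velocity_le hc hc1 x
  have hv : ‖v‖ ≤ 1 := norm_velocity_le hc hc1 y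
  have huv : ‖u - v‖ ≤ ‖x - y‖ :=
    (norm_velocity_sub_le hc x y).trans (mul_le_of_le_one_left (norm_nonneg _) hc1)
  have hxle : 1 / energy c x ≤ 1 := by rw [div_le_one hx0]; exact hEx
  have e : (hessian c x - hessian c y) h =
      (c * (1 / energy c x - 1 / energy c y)) • h
      - (1 / energy c x - 1 / energy c y) • (⟪v, h⟫ • v)
      - (1 / energy c x) • (⟪u - v, h⟫ • u) - (1 / energy c x) • (⟪v, h⟫ • (u - v)) := by
    rw [sub_apply, hrep, hrep, inner_sub_left]
    module
  have i1 : |⟪v, h⟫| ≤ ‖h‖ := (abs_real_inner_le_norm _ _).trans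
    (mul_le_of_le_one_left (norm_nonneg _) hv)
  have i2 : |⟪u - v, h⟫| ≤ ‖x - y‖ * ‖h‖ := (abs_real_inner_le_norm _ _).trans (by gcongr)
  have t1 : ‖(c * (1 / energy c x - 1 / energy c y)) • h‖ ≤ ‖x - y‖ * ‖h‖ := by
    rw [norm_smul, Real.norm_eq_abs, abs_mul, abs_of_nonneg hc]
    gcongr
    exact (mul_le_of_le_one_left (abs_nonneg _) hc1).trans hinv
  have t2 : ‖(1 / energy c x - 1 / energy c y) • (⟪v, h⟫ • v)‖ ≤ ‖x - y‖ * ‖h‖ := by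
    rw [norm_smul, norm_smul, Real.norm_eq_abs, Real.norm_eq_abs]
    gcongr
    calc |⟪v, h⟫| * ‖v‖ ≤ ‖h‖ * 1 := by gcongr
      _ = ‖h‖ := mul_one _
  have t3 : ‖(1 / energy c x) • (⟪u - v, h⟫ • u)‖ ≤ ‖x - y‖ * ‖h‖ := by
    rw [norm_smul, norm_smul, Real.norm_eq_abs, Real.norm_eq_abs, abs_of_pos (by positivity)]
    calc 1 / energy c x * (|⟪u - v, h⟫| * ‖u‖) ≤ 1 * ((‖x - y‖ * ‖h‖) * 1) := by gcongr
      _ = _ := by ring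
  have t4 : ‖(1 / energy c x) • (⟪v, h⟫ • (u - v))‖ ≤ ‖x - y‖ * ‖h‖ := by
    rw [norm_smul, norm_smul, Real.norm_eq_abs, Real.norm_eq_abs, abs_of_pos (by positivity)]
    calc 1 / energy c x * (|⟪v, h⟫| * ‖u - v‖) ≤ 1 * (‖h‖ * ‖x - y‖) := by gcongr
      _ = _ := by ring
  rw [e]
  refine (norm_sub_le _ _).trans ?_
  refine (add_le_add (norm_sub_le _ _) le_rfl).trans ?_
  refine (add_le_add (add_le_add (norm_sub_le _ _) le_rfl) le_rfl).trans ?_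
  linarith

/-- First-order Taylor expansion of the velocity. -/
lemma norm_velocity_taylor (hc1 : c ≤ 1) (y h : Plane) :
    ‖velocity c (y + h) - velocity c y - hessian c y h‖ ≤ 4 * ‖h‖ ^ 2 := by
  have hd : ∀ z ∈ Metric.closedBall y ‖h‖, HasFDerivWithinAt
      (fun z => velocity c z - hessian c y z) (hessian c z - hessian c y)
        (Metric.closedBall y ‖h‖) z := fun z _ =>
    ((hasFDerivAt_velocity hc z).sub (hessian c y).hasFDerivAt).hasFDerivWithinAt
  have := (convex_closedBall y ‖h‖).norm_image_sub_le_of_norm_hasFDerivWithin_le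
    (C := 4 * ‖h‖) (x := y) (y := y + h) hd (fun z hz => by
      refine (norm_hessian_sub_le hc hc1 z y).trans ?_
      gcongr
      simpa [dist_eq_norm] using hz) (by simp) (by simp)
  have e : velocity c (y + h) - hessian c y (y + h) - (velocity c y - hessian c y y)
      = velocity c (y + h) - velocity c y - hessian c y h := by
    rw [map_add]; abel
  rw [e, add_sub_cancel_left] at this
  linarith [this, sq ‖h‖]

lemma abs_energy_taylor (hc1 : c ≤ 1) (y h : Plane) :
    |energy c (y + h) - energy c y - ⟪velocity c y, h⟫| ≤ ‖h‖ ^ 2 := by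
  have hd : ∀ z ∈ Metric.closedBall y ‖h‖, HasFDerivWithinAt
      (fun z => energy c z - innerSL ℝ (velocity c y) z)
      (innerSL ℝ (velocity c z) - innerSL ℝ (velocity c y))
        (Metric.closedBall y ‖h‖) z := fun z _ =>
    ((hasFDerivAt_energy hc z).sub (innerSL ℝ (velocity c y)).hasFDerivAt).hasFDerivWithinAt
  have := (convex_closedBall y ‖h‖).norm_image_sub_le_of_norm_hasFDerivWithin_le
    (C := ‖h‖) (x := y) (y := y + h) hd (fun z hz => by
      rw [← map_sub, innerSL_apply_norm]
      refine (norm_velocity_sub_le hc z y).trans ?_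
      refine (mul_le_of_le_one_left (norm_nonneg _) hc1).trans ?_
      simpa [dist_eq_norm] using hz) (by simp) (by simp)
  rw [add_sub_cancel_left, Real.norm_eq_abs] at this
  simp only [innerSL_apply_apply, inner_add_right] at this
  have e : energy c (y + h) - (⟪velocity c y, y⟫ + ⟪velocity c y, h⟫)
      - (energy c y - ⟪velocity c y, y⟫)
      = energy c (y + h) - energy c y - ⟪velocity c y, h⟫ := by ring
  rw [e] at this
  linarith [this, sq ‖h‖]

/-- Strict monotonicity of the velocity field, with an explicit constant. -/
lemma inner_velocity_sub_ge (x y : Plane) {R : ℝ} (hx : energy c x ≤ R)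
    (hy : energy c y ≤ R) :
    c / R ^ 3 * ‖x - y‖ ^ 2 ≤ ⟪velocity c x - velocity c y, x - y⟫ := by
  have he1 := one_le_energy hc x
  have hf1 := one_le_energy hc y
  have he2 := energy_sq hc x
  have hf2 := energy_sq hc y
  rw [velocity, velocity]
  set e := energy c x
  set f := energy c y
  have hxy := norm_sub_sq_real x y
  have hin : ⟪(c / e) • x - (c / f) • y, x - y⟫
      = c / e * ‖x‖ ^ 2 + c / f * ‖y‖ ^ 2 - (c / e + c / f) * ⟪x, y⟫ := by
    rw [inner_sub_left, inner_sub_right, inner_sub_right]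
    simp only [inner_smul_left, conj_trivial, real_inner_self_eq_norm_sq]
    rw [real_inner_comm x y]
    ring
  -- the inner product is the Minkowski square of the difference of the two four-momenta, up to a
  -- positive factor; `hef` bounds that square below
  have hid : ⟪(c / e) • x - (c / f) • y, x - y⟫
      = (e + f) / (2 * e * f) * (c * ‖x - y‖ ^ 2 - (e - f) ^ 2) := by
    have hi : ⟪x, y⟫ = (‖x‖ ^ 2 + ‖y‖ ^ 2 - ‖x - y‖ ^ 2) / 2 := by linarith
    rw [hin, hi]
    field_simp
    linear_combination (-(f - e)) * (he2 - hf2)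
  have hef : (e - f) ^ 2 * (e + f) ^ 2 ≤ c * ‖x - y‖ ^ 2 * ((e + f) ^ 2 - 4) := by
    have h1 : (e - f) * (e + f) = c * ((‖x‖ - ‖y‖) * (‖x‖ + ‖y‖)) := by linarith
    have h2 : (‖x‖ - ‖y‖) ^ 2 ≤ ‖x - y‖ ^ 2 := by
      rw [← sq_abs (‖x‖ - ‖y‖)]
      have := abs_norm_sub_norm_le x y
      gcongr
    -- the Cauchy–Schwarz inequality for `(1, √c ‖x‖)` and `(1, √c ‖y‖)`
    have h3 : 1 + c * (‖x‖ * ‖y‖) ≤ e * f := by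
      refine abs_le_of_sq_le_sq' ?_ (by positivity) |>.2
      rw [mul_pow, he2, hf2]
      nlinarith [mul_nonneg hc (sq_nonneg (‖x‖ - ‖y‖))]
    have h4 : c * (‖x‖ + ‖y‖) ^ 2 ≤ (e + f) ^ 2 - 4 := by nlinarith
    calc (e - f) ^ 2 * (e + f) ^ 2 = ((e - f) * (e + f)) ^ 2 := by ring
      _ = c * (‖x‖ - ‖y‖) ^ 2 * (c * (‖x‖ + ‖y‖) ^ 2) := by rw [h1]; ring
      _ ≤ c * ‖x - y‖ ^ 2 * ((e + f) ^ 2 - 4) := by gcongr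
  have hsub : 4 * (c * ‖x - y‖ ^ 2) / (e + f) ^ 2 ≤ c * ‖x - y‖ ^ 2 - (e - f) ^ 2 := by
    rw [div_le_iff₀ (by positivity)]; linarith
  rw [hid]
  calc c / R ^ 3 * ‖x - y‖ ^ 2 ≤ 2 / (e * f * (e + f)) * (c * ‖x - y‖ ^ 2) := by
        have : 1 / R ^ 3 ≤ 2 / (e * f * (e + f)) := by
          have hR : 0 < R := by linarith
          rw [div_le_div_iff₀ (by positivity) (by positivity)]
          have : e * f * (e + f) ≤ R * R * (R + R) := by gcongr
          linarith
        calc c / R ^ 3 * ‖x - y‖ ^ 2 = 1 / R ^ 3 * (c * ‖x - y‖ ^ 2) := by ring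
          _ ≤ _ := by gcongr
    _ = (e + f) / (2 * e * f) * (4 * (c * ‖x - y‖ ^ 2) / (e + f) ^ 2) := by
        field_simp
        ring
    _ ≤ _ := by gcongr

end Hessian

/-! ### Area of plane sets by slicing -/

/-- A function whose derivative exceeds `c > 0` wherever the function is at least `δ` grows at
rate at least `c` to the right of any point where it is at least `δ`. -/
lemma add_mul_sub_le_of_deriv {h h' : ℝ → ℝ} {a b c δ : ℝ} (hab : a ≤ b) (hc : 0 ≤ c)
    (hd : ∀ x ∈ Set.Icc a b, HasDerivAt h (h' x) x)
    (hpos : ∀ x ∈ Set.Icc a b, δ ≤ h x → c < h' x) (ha : δ ≤ h a) :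
    h a + c * (b - a) ≤ h b := by
  refine image_le_of_deriv_right_lt_deriv_boundary' (f := fun x => h a + c * (x - a))
    (f' := fun _ => c) (B := h) (B' := h') (by fun_prop) ?_ (by simp)
    (fun x hx => (hd x hx).continuousAt.continuousWithinAt)
    (fun x hx => (hd x (Set.Ico_subset_Icc_self hx)).hasDerivWithinAt) ?_
    (Set.right_mem_Icc.2 hab)
  · intro x _
    have := (((hasDerivAt_id x).sub_const a).const_mul c).const_add (h a)
    simpa using this.hasDerivWithinAt
  · intro x hx hxe
    refine hpos x (Set.Ico_subset_Icc_self hx) ?_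
    rw [← hxe]
    nlinarith [hx.1, mul_nonneg hc (sub_nonneg.2 hx.1)]

lemma volume_le_of_pairwise {s : Set ℝ} {L : ℝ} (h : ∀ x ∈ s, ∀ y ∈ s, x ≤ y → y - x ≤ L) :
    volume s ≤ ENNReal.ofReal L := by
  refine (Real.volume_le_diam s).trans (Metric.ediam_le fun x hx y hy => ?_)
  rw [edist_dist, Real.dist_eq]
  refine ENNReal.ofReal_le_ofReal ?_
  rcases le_total x y with hxy | hxy
  · rw [abs_sub_comm, abs_of_nonneg (by linarith)]; exact h x hx y hy hxy
  · rw [abs_of_nonneg (by linarith)]; exact h y hy x hx hxy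

/-- The orthonormal coordinates of the plane with first axis along the unit vector `n`. -/
def frame (n : Plane) (hn : ‖n‖ = 1) : Plane →ₗᵢ[ℝ] Plane where
  toFun z := z 0 • n + z 1 • perp n
  map_add' z w := by simp only [PiLp.add_apply]; module
  map_smul' r z := by simp only [PiLp.smul_apply, smul_eq_mul, RingHom.id_apply]; module
  norm_map' z := by
    have h : ‖z 0 • n + z 1 • perp n‖ ^ 2 = ‖z‖ ^ 2 := by
      rw [norm_add_sq_real, norm_smul, norm_smul, norm_perp, hn, inner_smul_left, inner_smul_right,
        real_inner_comm, inner_perp_self, EuclideanSpace.norm_sq_eq, Fin.sum_univ_two]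
      simp
    exact (sq_eq_sq₀ (norm_nonneg _) (norm_nonneg _)).1 h

lemma lintegral_frame {n : Plane} (hn : ‖n‖ = 1) (f : Plane → ENNReal) :
    ∫⁻ z, f z = ∫⁻ p : ℝ × ℝ, f (p.1 • n + p.2 • perp n) := by
  have h1 : MeasurePreserving (frame n hn) :=
    ((frame n hn).toLinearIsometryEquiv rfl).measurePreserving
  have e1 : MeasurableEmbedding (frame n hn) :=
    ((frame n hn).toLinearIsometryEquiv rfl).toHomeomorph.measurableEmbedding
  have h2 := (EuclideanSpace.volume_preserving_symm_measurableEquiv_toLp (Fin 2)).symm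
  have h3 := (volume_preserving_finTwoArrow ℝ).symm
  rw [← h1.lintegral_comp_emb e1, ← h2.lintegral_comp_emb (MeasurableEquiv.measurableEmbedding _),
    ← h3.lintegral_comp_emb (MeasurableEquiv.measurableEmbedding _)]
  rfl

/-- Fubini along the lines of direction `n`. -/
lemma volume_le_of_slices {E : Set Plane} (hE : MeasurableSet E) {n η : Plane} (hn : ‖n‖ = 1)
    {ρ L : ℝ} (hball : E ⊆ Metric.closedBall η ρ)
    (hL : ∀ x ∈ E, ∀ t : ℝ, 0 ≤ t → x + t • n ∈ E → t ≤ L) :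
    volume E ≤ ENNReal.ofReal (2 * ρ) * ENNReal.ofReal L := by
  have hm : Measurable fun p : ℝ × ℝ => p.1 • n + p.2 • perp n := by fun_prop
  have hf : Measurable fun p : ℝ × ℝ =>
      E.indicator (fun _ => (1 : ENNReal)) (p.1 • n + p.2 • perp n) :=
    (measurable_const.indicator hE).comp hm
  rw [← lintegral_indicator_one hE, show (1 : Plane → ENNReal) = fun _ => 1 from rfl,
    lintegral_frame hn, Measure.volume_eq_prod, lintegral_prod_symm' _ hf]
  have hslice : ∀ y : ℝ, ∫⁻ x : ℝ, E.indicator (fun _ => (1 : ENNReal)) (x • n + y • perp n)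
      ≤ (Set.Icc (⟪perp n, η⟫ - ρ) (⟪perp n, η⟫ + ρ)).indicator (fun _ => ENNReal.ofReal L) y := by
    intro y
    have hset : ∫⁻ x : ℝ, E.indicator (fun _ => (1 : ENNReal)) (x • n + y • perp n)
        = volume {x : ℝ | x • n + y • perp n ∈ E} := by
      have hms : MeasurableSet {x : ℝ | x • n + y • perp n ∈ E} := by
        have : Measurable fun x : ℝ => x • n + y • perp n := by fun_prop
        exact this hE
      rw [← lintegral_indicator_one hms]
      rfl
    rw [hset]
    by_cases hy : y ∈ Set.Icc (⟪perp n, η⟫ - ρ) (⟪perp n, η⟫ + ρ)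
    · rw [Set.indicator_of_mem hy]
      refine volume_le_of_pairwise fun x hx x' hx' hxx => ?_
      refine hL _ hx (x' - x) (by linarith) ?_
      have : x • n + y • perp n + (x' - x) • n = x' • n + y • perp n := by module
      rw [this]; exact hx'
    · rw [Set.indicator_of_notMem hy]
      have : {x : ℝ | x • n + y • perp n ∈ E} = ∅ := by
        refine Set.eq_empty_of_forall_notMem fun x hx => hy ?_
        have h1 := hball hx
        rw [Metric.mem_closedBall, dist_eq_norm] at h1
        have h2 := (abs_real_inner_le_norm (perp n) (x • n + y • perp n - η)).trans
          (mul_le_mul_of_nonneg_left h1 (norm_nonneg _))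
        rw [norm_perp, hn, one_mul, inner_sub_right, inner_add_right, inner_smul_right,
          inner_smul_right, inner_perp_self, real_inner_self_eq_norm_sq, norm_perp, hn] at h2
        rw [abs_le] at h2
        constructor <;> linarith
      simp [this]
  refine (lintegral_mono hslice).trans ?_
  rw [lintegral_indicator measurableSet_Icc, setLIntegral_const, Real.volume_Icc, mul_comm]
  gcongr
  linarith

/-- The unit vector at angle `θ` from the unit vector `n`. -/
def direction (n : Plane) (θ : ℝ) : Plane := Real.cos θ • n + Real.sin θ • perp n

lemma norm_direction {n : Plane} (hn : ‖n‖ = 1) (θ : ℝ) : ‖direction n θ‖ = 1 := by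
  have h : ‖direction n θ‖ ^ 2 = 1 := by
    rw [direction, norm_add_sq_real, norm_smul, norm_smul, norm_perp, hn, inner_smul_left,
      inner_smul_right, real_inner_comm, inner_perp_self]
    simp
  exact (pow_eq_one_iff_of_nonneg (norm_nonneg _) two_ne_zero).1 h

lemma inner_direction {n : Plane} (hn : ‖n‖ = 1) (θ : ℝ) : ⟪direction n θ, n⟫ = Real.cos θ := by
  rw [direction, inner_add_left, inner_smul_left, inner_smul_left, inner_perp_self,
    real_inner_self_eq_norm_sq, hn]
  simp

lemma continuous_direction (n : Plane) : Continuous (direction n) := by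
  unfold direction; fun_prop

/-- The area of a plane set in polar coordinates about `z`. -/
lemma volume_eq_polar {E : Set Plane} (hE : MeasurableSet E) {n : Plane} (hn : ‖n‖ = 1)
    (z : Plane) :
    volume E = ∫⁻ θ in Set.Ioo (-Real.pi) Real.pi, ∫⁻ r in Set.Ioi (0 : ℝ),
      ENNReal.ofReal r * E.indicator (fun _ => 1) (z + r • direction n θ) := by
  have hm : Measurable fun p : ℝ × ℝ => ENNReal.ofReal p.1 *
      E.indicator (fun _ => (1 : ENNReal)) (z + p.1 • direction n p.2) := by
    have h2 : Measurable fun p : ℝ × ℝ => z + p.1 • direction n p.2 := by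
      have := continuous_direction n
      fun_prop
    exact (ENNReal.measurable_ofReal.comp measurable_fst).mul
      ((measurable_const.indicator hE).comp h2)
  rw [← lintegral_indicator_one hE, show (1 : Plane → ENNReal) = fun _ => 1 from rfl,
    ← lintegral_add_left_eq_self _ z, lintegral_frame hn, ← lintegral_comp_polarCoord_symm]
  have ht : polarCoord.target = Set.Ioi (0 : ℝ) ×ˢ Set.Ioo (-Real.pi) Real.pi := rfl
  rw [ht, Measure.volume_eq_prod, ← Measure.prod_restrict, ← lintegral_prod_symm' _ hm]
  refine lintegral_congr fun p => ?_
  have : polarCoord.symm p = (p.1 * Real.cos p.2, p.1 * Real.sin p.2) := rfl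
  rw [this]
  simp only [smul_eq_mul, direction, smul_add, smul_smul]

/-- Polar slices of diameter at most `L` within radius `R`, over a set `Θ` of angles. -/
lemma volume_le_of_polar_slices {E : Set Plane} (hE : MeasurableSet E) {n : Plane} (hn : ‖n‖ = 1)
    {R L : ℝ} {Θ : Set ℝ}
    (hR : ∀ x ∈ E, ‖x‖ ≤ R)
    (hL : ∀ u : Plane, ‖u‖ = 1 → ∀ r r' : ℝ, 0 < r → r ≤ r' → r • u ∈ E → r' • u ∈ E → r' - r ≤ L)
    (hΘ : ∀ θ ∈ Set.Ioo (-Real.pi) Real.pi, ∀ r : ℝ, 0 < r → r • direction n θ ∈ E → θ ∈ Θ) :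
    volume E ≤ ENNReal.ofReal R * ENNReal.ofReal L *
      volume (Θ ∩ Set.Ioo (-Real.pi) Real.pi) := by
  rw [volume_eq_polar hE hn 0]
  have hslice : ∀ θ ∈ Set.Ioo (-Real.pi) Real.pi, ∫⁻ r in Set.Ioi (0 : ℝ),
      ENNReal.ofReal r * E.indicator (fun _ => 1) (0 + r • direction n θ)
      ≤ (toMeasurable volume (Θ ∩ Set.Ioo (-Real.pi) Real.pi)).indicator
        (fun _ => ENNReal.ofReal R * ENNReal.ofReal L) θ := by
    intro θ hθ
    have hu := norm_direction hn θ
    set S : Set ℝ := {r | 0 < r ∧ r • direction n θ ∈ E}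
    have hSm : MeasurableSet S := by
      have : Measurable fun r : ℝ => r • direction n θ := by fun_prop
      exact measurableSet_Ioi.inter (this hE)
    have h1 : ∫⁻ r in Set.Ioi (0 : ℝ),
        ENNReal.ofReal r * E.indicator (fun _ => 1) (0 + r • direction n θ)
        ≤ ENNReal.ofReal R * volume S := by
      rw [← setLIntegral_const, ← lintegral_indicator measurableSet_Ioi,
        ← lintegral_indicator hSm]
      refine lintegral_mono fun r => ?_
      by_cases hr : 0 < r
      · rw [Set.indicator_of_mem (show r ∈ Set.Ioi (0 : ℝ) from hr), zero_add]
        by_cases hE' : r • direction n θ ∈ E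
        · rw [Set.indicator_of_mem hE', Set.indicator_of_mem (show r ∈ S from ⟨hr, hE'⟩), mul_one]
          refine ENNReal.ofReal_le_ofReal ?_
          have := hR _ hE'
          rwa [norm_smul, hu, mul_one, Real.norm_eq_abs, abs_of_pos hr] at this
        · rw [Set.indicator_of_notMem hE', mul_zero]; exact bot_le
      · rw [Set.indicator_of_notMem (show r ∉ Set.Ioi (0 : ℝ) from hr)]; exact bot_le
    refine h1.trans ?_
    by_cases hT : θ ∈ Θ
    · rw [Set.indicator_of_mem (subset_toMeasurable volume _ (show θ ∈ Θ ∩ _ from ⟨hT, hθ⟩))]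
      gcongr
      exact volume_le_of_pairwise fun r hr r' hr' hrr => hL _ hu r r' hr.1 hrr hr.2 hr'.2
    · have : S = ∅ := Set.eq_empty_of_forall_notMem fun r hr => hT (hΘ θ hθ r hr.1 hr.2)
      rw [this]; simp
  refine (setLIntegral_mono' measurableSet_Ioo hslice).trans ?_
  refine (setLIntegral_le_lintegral _ _).trans ?_
  rw [lintegral_indicator (measurableSet_toMeasurable _ _), setLIntegral_const,
    measure_toMeasurable]

/-- Polar slices about `z` on which `r²` varies by at most `L`. -/
lemma volume_le_of_polar_slices_sq {E : Set Plane} (hE : MeasurableSet E) (z : Plane) {L : ℝ}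
    (hL : ∀ u : Plane, ‖u‖ = 1 → ∀ r r' : ℝ, 0 < r → r ≤ r' → z + r • u ∈ E → z + r' • u ∈ E →
      r' ^ 2 - r ^ 2 ≤ L) :
    volume E ≤ ENNReal.ofReal (2 * Real.pi * L) := by
  obtain ⟨n, hn⟩ : ∃ n : Plane, ‖n‖ = 1 := ⟨EuclideanSpace.single 0 1, by simp⟩
  rw [volume_eq_polar hE hn z]
  have hslice : ∀ θ ∈ Set.Ioo (-Real.pi) Real.pi, ∫⁻ r in Set.Ioi (0 : ℝ),
      ENNReal.ofReal r * E.indicator (fun _ => 1) (z + r • direction n θ) ≤ ENNReal.ofReal L := by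
    intro θ _
    have hu := norm_direction hn θ
    by_cases hne : ∃ r₀ : ℝ, 0 < r₀ ∧ z + r₀ • direction n θ ∈ E
    · obtain ⟨r₀, hr₀, hr₀E⟩ := hne
      have hL0 : 0 ≤ L := by simpa using hL _ hu r₀ r₀ hr₀ le_rfl hr₀E hr₀E
      set p := √(max (r₀ ^ 2 - L) 0)
      set q := √(r₀ ^ 2 + L)
      have hp0 : 0 ≤ p := Real.sqrt_nonneg _
      have hpq : p ≤ q := by
        apply Real.sqrt_le_sqrt
        apply max_le <;> nlinarith
      have hle : ∫⁻ r in Set.Ioi (0 : ℝ),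
          ENNReal.ofReal r * E.indicator (fun _ => 1) (z + r • direction n θ)
          ≤ ∫⁻ r in Set.Icc p q, ENNReal.ofReal r := by
        rw [← lintegral_indicator measurableSet_Ioi, ← lintegral_indicator measurableSet_Icc]
        refine lintegral_mono fun r => ?_
        by_cases hr : 0 < r
        · rw [Set.indicator_of_mem (show r ∈ Set.Ioi (0 : ℝ) from hr)]
          by_cases hE' : z + r • direction n θ ∈ E
          · have hr2 : |r ^ 2 - r₀ ^ 2| ≤ L := by
              rcases le_total r r₀ with h | h
              · have := hL _ hu r r₀ hr h hE' hr₀E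
                rw [abs_sub_comm, abs_of_nonneg (by nlinarith)]; exact this
              · have := hL _ hu r₀ r hr₀ h hr₀E hE'
                rw [abs_of_nonneg (by nlinarith)]; exact this
            rw [abs_le] at hr2
            have hmem : r ∈ Set.Icc p q := by
              constructor
              · refine Real.sqrt_le_iff.2 ⟨hr.le, max_le (by linarith) (sq_nonneg r)⟩
              · exact Real.le_sqrt_of_sq_le (by linarith)
            rw [Set.indicator_of_mem hE', Set.indicator_of_mem hmem, mul_one]
          · rw [Set.indicator_of_notMem hE', mul_zero]; exact bot_le
        · rw [Set.indicator_of_notMem (show r ∉ Set.Ioi (0 : ℝ) from hr)]; exact bot_le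
      refine hle.trans ?_
      rw [← ofReal_integral_eq_lintegral_ofReal]
      · refine ENNReal.ofReal_le_ofReal ?_
        rw [integral_Icc_eq_integral_Ioc, ← intervalIntegral.integral_of_le hpq, integral_id,
          Real.sq_sqrt (by nlinarith), Real.sq_sqrt (le_max_right _ _)]
        linarith [le_max_left (r₀ ^ 2 - L) 0]
      · exact continuous_id.integrableOn_Icc
      · refine (ae_restrict_iff' measurableSet_Icc).2 (Filter.Eventually.of_forall fun r hr => ?_)
        exact hp0.trans hr.1
    · have : ∫⁻ r in Set.Ioi (0 : ℝ),
          ENNReal.ofReal r * E.indicator (fun _ => 1) (z + r • direction n θ) = 0 := by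
        rw [setLIntegral_eq_zero_iff measurableSet_Ioi]
        · refine Filter.Eventually.of_forall fun r hr => ?_
          rw [Set.indicator_of_notMem (fun h => hne ⟨r, hr, h⟩), mul_zero]
        · have : Measurable fun r : ℝ => z + r • direction n θ := by fun_prop
          exact ENNReal.measurable_ofReal.mul ((measurable_const.indicator hE).comp this)
      rw [this]; exact bot_le
  refine (setLIntegral_mono' measurableSet_Ioo hslice).trans ?_
  rw [setLIntegral_const, Real.volume_Ioo, mul_comm,
    ← ENNReal.ofReal_mul (by linarith [Real.pi_pos])]
  apply le_of_eq; congr 1; ring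

/-- The cosine is not flatter than quadratic, even at its critical points: a product of two sines,
each bounded below by Jordan's inequality. -/
lemma sq_sub_le_cos_sub {x y : ℝ} (hx : 0 ≤ x) (hxy : x ≤ y) (hy : y ≤ Real.pi) :
    2 * (y - x) ^ 2 / Real.pi ^ 2 ≤ Real.cos x - Real.cos y := by
  have hpi := Real.pi_pos
  set δ := (y - x) / 2 with hδ
  have hδ0 : 0 ≤ δ := by linarith
  have h1 : Real.cos x - Real.cos y = 2 * Real.sin ((x + y) / 2) * Real.sin δ := by
    rw [Real.cos_sub_cos, show (x - y) / 2 = -δ by ring, Real.sin_neg]; ring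
  have hs : 2 / Real.pi * δ ≤ Real.sin δ := Real.mul_le_sin hδ0 (by linarith)
  have hm : Real.sin δ ≤ Real.sin ((x + y) / 2) := by
    rcases le_total ((x + y) / 2) (Real.pi / 2) with h | h
    · exact Real.sin_le_sin_of_le_of_le_pi_div_two (by linarith) h (by linarith)
    · rw [← Real.sin_pi_sub ((x + y) / 2)]
      exact Real.sin_le_sin_of_le_of_le_pi_div_two (by linarith) (by linarith) (by linarith)
  have h0 : 0 ≤ 2 / Real.pi * δ := by positivity
  calc 2 * (y - x) ^ 2 / Real.pi ^ 2 = 2 * (2 / Real.pi * δ) * (2 / Real.pi * δ) := by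
        rw [hδ]; field_simp
    _ ≤ 2 * Real.sin ((x + y) / 2) * Real.sin δ := by
        have := hs.trans hm
        have h3 : 0 ≤ Real.sin ((x + y) / 2) := h0.trans this
        gcongr
    _ = _ := h1.symm

/-- A set of angles whose cosines lie within `L` of each other has measure `O(√L)`. -/
lemma volume_angles_le {Θ : Set ℝ} {L : ℝ}
    (h : ∀ x ∈ Θ, ∀ y ∈ Θ, Real.cos x - Real.cos y ≤ L) :
    volume (Θ ∩ Set.Ioo (-Real.pi) Real.pi) ≤ ENNReal.ofReal (2 * Real.pi * √L) := by
  have hpi := Real.pi_pos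
  have key : ∀ x y : ℝ, 0 ≤ x → x ≤ y → y ≤ Real.pi → Real.cos x - Real.cos y ≤ L →
      y - x ≤ Real.pi * √L := by
    intro x y hx hxy hy hL
    have h1 := (sq_sub_le_cos_sub hx hxy hy).trans hL
    rw [div_le_iff₀ (by positivity)] at h1
    have h2 : y - x ≤ √(Real.pi ^ 2 * L) := Real.le_sqrt_of_sq_le (by nlinarith)
    rwa [Real.sqrt_mul (by positivity), Real.sqrt_sq hpi.le] at h2
  have hsub : Θ ∩ Set.Ioo (-Real.pi) Real.pi
      ⊆ (Θ ∩ Set.Icc 0 Real.pi) ∪ (Θ ∩ Set.Icc (-Real.pi) 0) := by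
    rintro x ⟨hx, hx1, hx2⟩
    rcases le_total 0 x with h0 | h0
    · exact Or.inl ⟨hx, h0, hx2.le⟩
    · exact Or.inr ⟨hx, hx1.le, h0⟩
  refine (measure_mono hsub).trans ((measure_union_le _ _).trans ?_)
  have e : ENNReal.ofReal (2 * Real.pi * √L)
      = ENNReal.ofReal (Real.pi * √L) + ENNReal.ofReal (Real.pi * √L) := by
    rw [← ENNReal.ofReal_add (by positivity) (by positivity)]; congr 1; ring
  rw [e]
  refine add_le_add (volume_le_of_pairwise ?_) (volume_le_of_pairwise ?_)
  · rintro x ⟨hx, hx1, hx2⟩ y ⟨hy, hy1, hy2⟩ hxy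
    exact key x y hx1 hxy hy2 (h x hx y hy)
  · rintro x ⟨hx, hx1, hx2⟩ y ⟨hy, hy1, hy2⟩ hxy
    have := key (-y) (-x) (by linarith) (by linarith) (by linarith)
      (by rw [Real.cos_neg, Real.cos_neg]; exact h y hy x hx)
    linarith

/-! ### Integral operators on `L²` -/

/-- The integral operator with kernel `k`. -/
def integralOp (k : Plane → Plane → ℂ) (f : Plane → ℂ) (ξ : Plane) : ℂ := ∫ η, k ξ η * f η

/-- Measurable kernels, bounded by `M` and supported in the product of two balls of radius `R`. -/
structure IsKernel (k : Plane → Plane → ℂ) (M R : ℝ) : Prop where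
  measurable : Measurable fun p : Plane × Plane => k p.1 p.2
  bound : ∀ ξ η, ‖k ξ η‖ ≤ M
  left_mem : ∀ ξ η, k ξ η ≠ 0 → ξ ∈ Metric.ball (0 : Plane) R
  right_mem : ∀ ξ η, k ξ η ≠ 0 → η ∈ Metric.ball (0 : Plane) R

/-- The square of the `L²` operator norm of the integral operator with kernel `k` is at most `B`. -/
def L2Bound (k : Plane → Plane → ℂ) (B : ENNReal) : Prop :=
  ∀ f : Plane → ℂ, Measurable f → ∫⁻ η, ‖f η‖ₑ ^ 2 < ⊤ →
    ∫⁻ ξ, ‖integralOp k f ξ‖ₑ ^ 2 ≤ B * ∫⁻ η, ‖f η‖ₑ ^ 2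

lemma L2Bound.mono {k : Plane → Plane → ℂ} {B B' : ENNReal} (h : L2Bound k B) (hB : B ≤ B') :
    L2Bound k B' := fun f hf hf2 => (h f hf hf2).trans (by gcongr)

lemma memLp_two_of_lintegral {f : Plane → ℂ} (hf : Measurable f) (h : ∫⁻ η, ‖f η‖ₑ ^ 2 < ⊤) :
    MemLp f 2 volume := by
  refine ⟨hf.aestronglyMeasurable, ?_⟩
  rw [eLpNorm_eq_lintegral_rpow_enorm_toReal two_ne_zero ENNReal.ofNat_ne_top]
  refine ENNReal.rpow_lt_top_of_nonneg (by simp) ?_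
  simpa using h.ne

lemma integrableOn_ball_of_sq {f : Plane → ℂ} (hf : MemLp f 2 volume) (R : ℝ) :
    IntegrableOn f (Metric.ball 0 R) := by
  have : IsFiniteMeasure (volume.restrict (Metric.ball (0 : Plane) R)) :=
    ⟨by
      rw [Measure.restrict_apply_univ]; exact measure_ball_lt_top⟩
  exact (hf.restrict _).integrable one_le_two

namespace IsKernel

variable {k : Plane → Plane → ℂ} {M R : ℝ} (hk : IsKernel k M R)
include hk

lemma nonneg : 0 ≤ M := (norm_nonneg _).trans (hk.bound 0 0)

lemma norm_mul_le (f : Plane → ℂ) (ξ η : Plane) :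
    ‖k ξ η * f η‖ ≤ M * ‖(Metric.ball (0 : Plane) R).indicator f η‖ := by
  by_cases h : k ξ η = 0
  · rw [h, zero_mul, norm_zero]
    exact mul_nonneg hk.nonneg (norm_nonneg _)
  · rw [Set.indicator_of_mem (hk.right_mem ξ η h), norm_mul]
    gcongr
    exact hk.bound ξ η

lemma integrable_mul {f : Plane → ℂ} (hf : MemLp f 2 volume) (ξ : Plane) :
    Integrable (fun η => k ξ η * f η) volume := by
  have h1 : Integrable ((Metric.ball (0 : Plane) R).indicator f) :=
    (integrable_indicator_iff Metric.isOpen_ball.measurableSet).2 (integrableOn_ball_of_sq hf R)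
  refine (h1.norm.const_mul M).mono' ?_ (Filter.Eventually.of_forall fun η => hk.norm_mul_le f ξ η)
  exact (hk.measurable.comp measurable_prodMk_left).aestronglyMeasurable.mul hf.1

lemma measurable_integralOp {f : Plane → ℂ} (hf : Measurable f) : Measurable (integralOp k f) := by
  have : StronglyMeasurable fun p : Plane × Plane => k p.1 p.2 * f p.2 :=
    (hk.measurable.mul (hf.comp measurable_snd)).stronglyMeasurable
  exact this.integral_prod_right.measurable

lemma restrict {Q : Set Plane} (hQ : MeasurableSet Q) :
    IsKernel (fun ξ η => Q.indicator (k ξ) η) M R where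
  measurable := by
    have : (fun p : Plane × Plane => Q.indicator (k p.1) p.2)
        = (Prod.snd ⁻¹' Q).indicator fun p : Plane × Plane => k p.1 p.2 := by
      ext p; by_cases h : p.2 ∈ Q <;> simp [h]
    rw [this]
    exact hk.measurable.indicator (measurable_snd hQ)
  bound ξ η := by
    by_cases h : η ∈ Q
    · simpa [h] using hk.bound ξ η
    · simpa [h] using hk.nonneg
  left_mem ξ η h := by
    by_cases h' : η ∈ Q
    · exact hk.left_mem ξ η (by simpa [h'] using h)
    · simp [h'] at h
  right_mem ξ η h := by
    by_cases h' : η ∈ Q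
    · exact hk.right_mem ξ η (by simpa [h'] using h)
    · simp [h'] at h

end IsKernel

/-- The Cauchy–Schwarz inequality with weight `w`. -/
lemma lintegral_mul_sq_le {w F : Plane → ENNReal} (hw : Measurable w) (hF : Measurable F) :
    (∫⁻ η, w η * F η) ^ 2 ≤ (∫⁻ η, w η) * ∫⁻ η, w η * F η ^ 2 := by
  have h := ENNReal.lintegral_mul_le_Lp_mul_Lq volume Real.HolderConjugate.two_two
    (f := fun η => w η ^ (1 / 2 : ℝ)) (g := fun η => w η ^ (1 / 2 : ℝ) * F η)
    (hw.pow_const _).aemeasurable ((hw.pow_const _).mul hF).aemeasurable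
  have hsq : ∀ x : ENNReal, x ^ (1 / 2 : ℝ) * x ^ (1 / 2 : ℝ) = x := fun x => by
    rw [← ENNReal.rpow_add_of_nonneg _ _ (by norm_num) (by norm_num)]; norm_num
  have hsq' : ∀ x : ENNReal, (x ^ (1 / 2 : ℝ)) ^ 2 = x := fun x => by rw [sq, hsq]
  simp only [Pi.mul_apply, ← mul_assoc, hsq, ENNReal.rpow_ofNat, mul_pow, hsq'] at h
  calc (∫⁻ η, w η * F η) ^ 2
      ≤ ((∫⁻ η, w η) ^ (1 / 2 : ℝ) * (∫⁻ η, w η * F η ^ 2) ^ (1 / 2 : ℝ)) ^ 2 := by gcongr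
    _ = _ := by rw [mul_pow, hsq', hsq']

/-- Schur's test. -/
lemma IsKernel.schur {k : Plane → Plane → ℂ} {M R : ℝ} (hk : IsKernel k M R) {A B : ENNReal}
    (hA : ∀ ξ, ∫⁻ η, ‖k ξ η‖ₑ ≤ A) (hB : ∀ η, ∫⁻ ξ, ‖k ξ η‖ₑ ≤ B) : L2Bound k (A * B) := by
  intro f hf _
  have hm : Measurable fun p : Plane × Plane => ‖k p.1 p.2‖ₑ * ‖f p.2‖ₑ ^ 2 :=
    hk.measurable.enorm.mul ((hf.enorm.pow_const 2).comp measurable_snd)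
  calc ∫⁻ ξ, ‖integralOp k f ξ‖ₑ ^ 2
      ≤ ∫⁻ ξ, A * ∫⁻ η, ‖k ξ η‖ₑ * ‖f η‖ₑ ^ 2 := by
        refine lintegral_mono fun ξ => ?_
        have h1 : ‖integralOp k f ξ‖ₑ ≤ ∫⁻ η, ‖k ξ η‖ₑ * ‖f η‖ₑ := by
          refine (enorm_integral_le_lintegral_enorm _).trans (le_of_eq ?_)
          simp only [enorm_mul]
        have h2 := lintegral_mul_sq_le (w := fun η => ‖k ξ η‖ₑ) (F := fun η => ‖f η‖ₑ)
          (hk.measurable.comp measurable_prodMk_left).enorm hf.enorm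
        calc ‖integralOp k f ξ‖ₑ ^ 2 ≤ (∫⁻ η, ‖k ξ η‖ₑ * ‖f η‖ₑ) ^ 2 := by gcongr
          _ ≤ _ := h2
          _ ≤ _ := by gcongr; exact hA ξ
    _ = A * ∫⁻ ξ, ∫⁻ η, ‖k ξ η‖ₑ * ‖f η‖ₑ ^ 2 :=
        lintegral_const_mul _ hm.lintegral_prod_right'
    _ = A * ∫⁻ η, ∫⁻ ξ, ‖k ξ η‖ₑ * ‖f η‖ₑ ^ 2 := by
        rw [lintegral_lintegral_swap hm.aemeasurable]
    _ = A * ∫⁻ η, (∫⁻ ξ, ‖k ξ η‖ₑ) * ‖f η‖ₑ ^ 2 := by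
        congr 1
        refine lintegral_congr fun η => ?_
        rw [lintegral_mul_const]
        exact (hk.measurable.comp measurable_prodMk_right).enorm
    _ ≤ A * ∫⁻ η, B * ‖f η‖ₑ ^ 2 := by
        gcongr with η; exact hB η
    _ = _ := by rw [lintegral_const_mul _ (hf.enorm.pow_const 2), mul_assoc]

/-- Schur's test for the quadratic form of a symmetric kernel. -/
lemma lintegral_mul_mul_le {w : Plane × Plane → ENNReal} (hw : Measurable w)
    (hsymm : ∀ p, w p = w p.swap) {F : Plane → ENNReal} (hF : Measurable F) {B : ENNReal}
    (hB : ∀ η, ∫⁻ η', w (η, η') ≤ B) :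
    ∫⁻ p, F p.1 * F p.2 * w p ∂(volume.prod volume) ≤ B * ∫⁻ η, F η ^ 2 := by
  have h1 : Measurable fun p : Plane × Plane => F p.1 ^ 2 * w p :=
    ((hF.comp measurable_fst).pow_const 2).mul hw
  have hdiag : ∫⁻ p : Plane × Plane, F p.1 ^ 2 * w p ∂(volume.prod volume)
      ≤ B * ∫⁻ η, F η ^ 2 := by
    rw [lintegral_prod _ h1.aemeasurable, ← lintegral_const_mul _ (hF.pow_const 2)]
    refine lintegral_mono fun η => ?_
    have hm : Measurable fun η' => w (η, η') := hw.comp measurable_prodMk_left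
    dsimp only
    rw [lintegral_const_mul _ hm, mul_comm]
    gcongr
    exact hB η
  have hdiag' : ∫⁻ p : Plane × Plane, F p.2 ^ 2 * w p ∂(volume.prod volume)
      ≤ B * ∫⁻ η, F η ^ 2 := by
    rw [← lintegral_prod_swap]
    refine le_trans (le_of_eq (lintegral_congr fun p => ?_)) hdiag
    rw [hsymm p]; rfl
  have h5 : 2 * ∫⁻ p, F p.1 * F p.2 * w p ∂(volume.prod volume)
      ≤ 2 * (B * ∫⁻ η, F η ^ 2) := by
    rw [← lintegral_const_mul' _ _ (by simp)]
    calc ∫⁻ p, 2 * (F p.1 * F p.2 * w p) ∂(volume.prod volume)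
        ≤ ∫⁻ p, (F p.1 ^ 2 * w p + F p.2 ^ 2 * w p) ∂(volume.prod volume) := by
          refine lintegral_mono fun p => ?_
          rw [← mul_assoc, ← add_mul]
          gcongr
          generalize F p.1 = a
          generalize F p.2 = b
          rcases eq_or_ne a ⊤ with rfl | ha
          · simp
          rcases eq_or_ne b ⊤ with rfl | hb
          · simp
          lift a to NNReal using ha
          lift b to NNReal using hb
          norm_cast
          rw [← mul_assoc]
          exact ENNReal.coe_le_coe.2 (two_mul_le_add_sq a b)
      _ = _ := lintegral_add_left h1 _
      _ ≤ _ := by rw [two_mul]; exact add_le_add hdiag hdiag'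
  exact (ENNReal.mul_le_mul_iff_right two_ne_zero (by simp)).1 h5

/-- The kernel of `T* T`. -/
def gram (k : Plane → Plane → ℂ) (η η' : Plane) : ℂ := ∫ ξ, starRingEnd ℂ (k ξ η) * k ξ η'

lemma gram_symm (k : Plane → Plane → ℂ) (η η' : Plane) : ‖gram k η η'‖ₑ = ‖gram k η' η‖ₑ := by
  have : gram k η η' = starRingEnd ℂ (gram k η' η) := by
    rw [gram, gram, ← integral_conj]
    congr 1
    ext ξ
    simp [mul_comm]
  rw [this]
  simp [enorm, nnnorm]

lemma IsKernel.measurable_gram {k : Plane → Plane → ℂ} {M R : ℝ} (hk : IsKernel k M R) :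
    Measurable fun p : Plane × Plane => gram k p.1 p.2 := by
  have h1 : Measurable fun q : (Plane × Plane) × Plane =>
      starRingEnd ℂ (k q.2 q.1.1) * k q.2 q.1.2 := by
    have e1 := hk.measurable.comp (measurable_snd.prodMk (measurable_fst.comp measurable_fst) :
      Measurable fun q : (Plane × Plane) × Plane => (q.2, q.1.1))
    have e2 := hk.measurable.comp (measurable_snd.prodMk (measurable_snd.comp measurable_fst) :
      Measurable fun q : (Plane × Plane) × Plane => (q.2, q.1.2))
    exact (Complex.continuous_conj.measurable.comp e1).mul e2
  exact h1.stronglyMeasurable.integral_prod_right.measurable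

/-- The `T* T` method: Schur's test for the kernel of `T* T`. -/
lemma IsKernel.l2Bound_of_gram {k : Plane → Plane → ℂ} {M R : ℝ} (hk : IsKernel k M R)
    {B : ENNReal} (hB : ∀ η, ∫⁻ η', ‖gram k η η'‖ₑ ≤ B) : L2Bound k B := by
  intro f hf hf2
  have hfL := memLp_two_of_lintegral hf hf2
  have hball : MeasurableSet (Metric.ball (0 : Plane) R) := Metric.isOpen_ball.measurableSet
  have hfi : Integrable ((Metric.ball (0 : Plane) R).indicator f) :=
    (integrable_indicator_iff hball).2 (integrableOn_ball_of_sq hfL R)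
  set F : Plane → Plane × Plane → ℂ := fun ξ p =>
    starRingEnd ℂ (k ξ p.1 * f p.1) * (k ξ p.2 * f p.2) with hF
  have hFm : Measurable fun q : Plane × (Plane × Plane) => F q.1 q.2 := by
    have e1 := hk.measurable.comp (measurable_fst.prodMk (measurable_fst.comp measurable_snd) :
      Measurable fun q : Plane × (Plane × Plane) => (q.1, q.2.1))
    have e2 := hk.measurable.comp (measurable_fst.prodMk (measurable_snd.comp measurable_snd) :
      Measurable fun q : Plane × (Plane × Plane) => (q.1, q.2.2))
    exact (Complex.continuous_conj.measurable.comp (e1.mul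
      (hf.comp (measurable_fst.comp measurable_snd)))).mul
        (e2.mul (hf.comp (measurable_snd.comp measurable_snd)))
  have hFi : Integrable (Function.uncurry F) (volume.prod (volume.prod volume)) := by
    have h1 : Integrable ((Metric.ball (0 : Plane) R).indicator fun _ => M * M) :=
      (integrable_indicator_iff hball).2 (integrableOn_const measure_ball_lt_top.ne)
    refine (h1.mul_prod (hfi.norm.mul_prod hfi.norm)).mono' hFm.aestronglyMeasurable
      (Filter.Eventually.of_forall fun q => ?_)
    obtain ⟨ξ, η, η'⟩ := q
    simp only [Function.uncurry, hF, norm_mul (starRingEnd ℂ _), RCLike.norm_conj]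
    by_cases hξ : ξ ∈ Metric.ball (0 : Plane) R
    · rw [Set.indicator_of_mem hξ]
      calc ‖k ξ η * f η‖ * ‖k ξ η' * f η'‖ ≤ (M * _) * (M * _) :=
            mul_le_mul (hk.norm_mul_le f ξ η) (hk.norm_mul_le f ξ η') (norm_nonneg _)
              (mul_nonneg hk.nonneg (norm_nonneg _))
        _ = _ := by ring
    · have : k ξ η = 0 := by
        by_contra h; exact hξ (hk.left_mem _ _ h)
      rw [this, Set.indicator_of_notMem hξ]; simp
  -- `‖T f‖²` is the double integral of `conj (f η) f η'` against the kernel of `T* T`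
  have h1 : ∀ ξ, ((‖integralOp k f ξ‖ ^ 2 : ℝ) : ℂ) = ∫ p, F ξ p ∂(volume.prod volume) := by
    intro ξ
    rw [hF, integral_prod_mul (fun η => starRingEnd ℂ (k ξ η * f η)) (fun η => k ξ η * f η),
      integral_conj]
    change _ = starRingEnd ℂ (integralOp k f ξ) * integralOp k f ξ
    rw [mul_comm, Complex.mul_conj, Complex.normSq_eq_norm_sq]
  have h2 : ∀ p : Plane × Plane,
      ∫ ξ, F ξ p = starRingEnd ℂ (f p.1) * f p.2 * gram k p.1 p.2 := by
    intro p
    rw [gram, ← integral_const_mul]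
    congr 1
    ext ξ
    simp only [hF, map_mul]
    ring
  have h3 : (∫ ξ, ((‖integralOp k f ξ‖ ^ 2 : ℝ) : ℂ))
      = ∫ p, starRingEnd ℂ (f p.1) * f p.2 * gram k p.1 p.2 ∂(volume.prod volume) := by
    simp_rw [h1, ← h2]
    exact integral_integral_swap hFi
  have hTi : Integrable fun ξ => ‖integralOp k f ξ‖ ^ 2 := by
    have := hFi.integral_prod_left
    simp only [Function.uncurry_apply_pair, ← h1] at this
    refine this.re.congr (Filter.Eventually.of_forall fun ξ => ?_)
    exact Complex.ofReal_re _
  have h4 : ∫⁻ ξ, ‖integralOp k f ξ‖ₑ ^ 2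
      = ‖∫ ξ, ((‖integralOp k f ξ‖ ^ 2 : ℝ) : ℂ)‖ₑ := by
    rw [integral_complex_ofReal, ← ofReal_norm, Complex.norm_real, Real.norm_eq_abs, abs_of_nonneg
      (integral_nonneg fun ξ => by positivity), ofReal_integral_eq_lintegral_ofReal hTi
      (Filter.Eventually.of_forall fun ξ => by positivity)]
    refine lintegral_congr fun ξ => ?_
    rw [ENNReal.ofReal_pow (norm_nonneg _), ofReal_norm]
  rw [h4, h3]
  refine (enorm_integral_le_lintegral_enorm _).trans ?_
  refine le_trans (le_of_eq ?_) (lintegral_mul_mul_le hk.measurable_gram.enorm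
    (fun p => by rw [gram_symm]; rfl) hf.enorm hB)
  refine lintegral_congr fun p => ?_
  rw [enorm_mul, enorm_mul]
  simp [enorm, nnnorm]

lemma enorm_sum_sq_le {ι : Type*} (s : Finset ι) (g : ι → ℂ) :
    ‖∑ i ∈ s, g i‖ₑ ^ 2 ≤ s.card * ∑ i ∈ s, ‖g i‖ₑ ^ 2 := by
  have h : ‖∑ i ∈ s, g i‖₊ ^ 2 ≤ s.card * ∑ i ∈ s, ‖g i‖₊ ^ 2 :=
    (pow_le_pow_left' (nnnorm_sum_le s g) 2).trans sq_sum_le_card_mul_sum_sq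
  simp only [enorm]
  exact_mod_cast h

lemma L2Bound.sum {ι : Type*} {s : Finset ι} {k : ι → Plane → Plane → ℂ} {M R : ℝ}
    (hk : ∀ i ∈ s, IsKernel (k i) M R) {B : ENNReal} (hB : ∀ i ∈ s, L2Bound (k i) B) :
    L2Bound (fun ξ η => ∑ i ∈ s, k i ξ η) ((s.card : ENNReal) ^ 2 * B) := by
  intro f hf hf2
  have hfL := memLp_two_of_lintegral hf hf2
  have h1 : ∀ ξ, integralOp (fun ξ η => ∑ i ∈ s, k i ξ η) f ξ = ∑ i ∈ s, integralOp (k i) f ξ := by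
    intro ξ
    simp only [integralOp, Finset.sum_mul]
    exact integral_finsetSum s fun i hi => (hk i hi).integrable_mul hfL ξ
  calc ∫⁻ ξ, ‖integralOp (fun ξ η => ∑ i ∈ s, k i ξ η) f ξ‖ₑ ^ 2
      ≤ ∫⁻ ξ, s.card * ∑ i ∈ s, ‖integralOp (k i) f ξ‖ₑ ^ 2 := by
        refine lintegral_mono fun ξ => ?_
        rw [h1]; exact enorm_sum_sq_le s _
    _ = s.card * ∑ i ∈ s, ∫⁻ ξ, ‖integralOp (k i) f ξ‖ₑ ^ 2 := by
        rw [lintegral_const_mul' _ _ (by simp), lintegral_finsetSum']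
        exact fun i hi => (((hk i hi).measurable_integralOp hf).enorm.pow_const 2).aemeasurable
    _ ≤ s.card * ∑ i ∈ s, B * ∫⁻ η, ‖f η‖ₑ ^ 2 := by
        gcongr with i hi; exact hB i hi f hf hf2
    _ = _ := by rw [Finset.sum_const, nsmul_eq_mul]; ring

lemma L2Bound.add {k k' : Plane → Plane → ℂ} {M M' R : ℝ} (hk : IsKernel k M R)
    (hk' : IsKernel k' M' R) {B B' : ENNReal} (hB : L2Bound k B) (hB' : L2Bound k' B') :
    L2Bound (fun ξ η => k ξ η + k' ξ η) (2 * (B + B')) := by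
  intro f hf hf2
  have hfL := memLp_two_of_lintegral hf hf2
  have h1 : ∀ ξ, integralOp (fun ξ η => k ξ η + k' ξ η) f ξ
      = integralOp k f ξ + integralOp k' f ξ := by
    intro ξ
    simp only [integralOp, add_mul]
    exact integral_add (hk.integrable_mul hfL ξ) (hk'.integrable_mul hfL ξ)
  have h2 : ∀ a b : ℂ, ‖a + b‖ₑ ^ 2 ≤ 2 * (‖a‖ₑ ^ 2 + ‖b‖ₑ ^ 2) := by
    intro a b
    simpa using enorm_sum_sq_le Finset.univ ![a, b]
  calc ∫⁻ ξ, ‖integralOp (fun ξ η => k ξ η + k' ξ η) f ξ‖ₑ ^ 2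
      ≤ ∫⁻ ξ, 2 * (‖integralOp k f ξ‖ₑ ^ 2 + ‖integralOp k' f ξ‖ₑ ^ 2) := by
        refine lintegral_mono fun ξ => ?_
        rw [h1]; exact h2 _ _
    _ = 2 * ((∫⁻ ξ, ‖integralOp k f ξ‖ₑ ^ 2) + ∫⁻ ξ, ‖integralOp k' f ξ‖ₑ ^ 2) := by
        rw [lintegral_const_mul' _ _ (by simp), lintegral_add_left]
        exact (hk.measurable_integralOp hf).enorm.pow_const 2
    _ ≤ 2 * (B * (∫⁻ η, ‖f η‖ₑ ^ 2) + B' * ∫⁻ η, ‖f η‖ₑ ^ 2) := by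
        gcongr
        · exact hB f hf hf2
        · exact hB' f hf hf2
    _ = _ := by ring

/-- A bound in the sense of `L2Bound` is a bound of `L²` norms. -/
lemma IsKernel.eLpNorm_integralOp_le {k : Plane → Plane → ℂ} {M R : ℝ} (hk : IsKernel k M R)
    {D : ℝ} (hD : 0 ≤ D) (hB : L2Bound k (ENNReal.ofReal (D ^ 2))) {f : Plane → ℂ}
    (hf : MemLp f 2 volume) :
    MemLp (integralOp k f) 2 volume ∧
      eLpNorm (integralOp k f) 2 volume ≤ ENNReal.ofReal D * eLpNorm f 2 volume := by
  set f₀ := hf.1.mk f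
  have hff : f =ᵐ[volume] f₀ := hf.1.ae_eq_mk
  have hf₀ : Measurable f₀ := hf.1.stronglyMeasurable_mk.measurable
  have hop : integralOp k f = integralOp k f₀ := by
    ext ξ
    exact integral_congr_ae (hff.mono fun η hη => by simp only [hη])
  have hL2 : ∀ g : Plane → ℂ, eLpNorm g 2 volume = (∫⁻ η, ‖g η‖ₑ ^ 2) ^ (1 / 2 : ℝ) := by
    intro g
    rw [eLpNorm_eq_lintegral_rpow_enorm_toReal two_ne_zero ENNReal.ofNat_ne_top]
    simp
  have hfin : ∫⁻ η, ‖f₀ η‖ₑ ^ 2 < ⊤ := by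
    have h := ((memLp_congr_ae hff).1 hf).2
    rw [hL2] at h
    by_contra hc
    rw [not_lt, top_le_iff] at hc
    rw [hc, ENNReal.top_rpow_of_pos (by norm_num)] at h
    exact lt_irrefl _ h
  have hle : eLpNorm (integralOp k f) 2 volume ≤ ENNReal.ofReal D * eLpNorm f 2 volume := by
    rw [eLpNorm_congr_ae hff, hop, hL2, hL2]
    have h := hB f₀ hf₀ hfin
    calc (∫⁻ ξ, ‖integralOp k f₀ ξ‖ₑ ^ 2) ^ (1 / 2 : ℝ)
        ≤ (ENNReal.ofReal (D ^ 2) * ∫⁻ η, ‖f₀ η‖ₑ ^ 2) ^ (1 / 2 : ℝ) := by gcongr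
      _ = _ := by
        rw [ENNReal.mul_rpow_of_nonneg _ _ (by norm_num),
          ENNReal.ofReal_rpow_of_nonneg (by positivity) (by norm_num), ← Real.sqrt_eq_rpow,
          Real.sqrt_sq hD]
  refine ⟨⟨?_, hle.trans_lt (ENNReal.mul_lt_top ENNReal.ofReal_lt_top hf.2)⟩, hle⟩
  rw [hop]
  exact (hk.measurable_integralOp hf₀).aestronglyMeasurable

/-! ### Phases and their rotational curvature -/

/-- Coefficients of a phase `e₁ E₁(ξ) + e₂ E₂(ξ - η) + e₃ E₃(η)`, where `Eᵢ = energy cᵢ`. -/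
structure PhaseData where
  (c₁ c₂ c₃ e₁ e₂ e₃ : ℝ)
  pos₁ : 0 < c₁
  pos₂ : 0 < c₂
  pos₃ : 0 < c₃
  le₁ : c₁ ≤ 1
  le₂ : c₂ ≤ 1
  le₃ : c₃ ≤ 1
  sign₁ : |e₁| = 1
  sign₂ : |e₂| = 1
  sign₃ : |e₃| = 1

namespace PhaseData

variable (P : PhaseData)

/-- The phase function. -/
def val (ξ η : Plane) : ℝ :=
  P.e₁ * energy P.c₁ ξ + P.e₂ * energy P.c₂ (ξ - η) + P.e₃ * energy P.c₃ η

/-- The gradient of the phase in `ξ`. -/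
def gradLeft (ξ η : Plane) : Plane :=
  P.e₁ • velocity P.c₁ ξ + P.e₂ • velocity P.c₂ (ξ - η)

/-- The gradient of the phase in `η`. -/
def gradRight (ξ η : Plane) : Plane :=
  P.e₃ • velocity P.c₃ η - P.e₂ • velocity P.c₂ (ξ - η)

/-- The rotational curvature of the phase: up to sign, the mixed Hessian `∇_ξ∇_ηΦ` evaluated on
the rotated gradients. -/
def curvature (ξ η : Plane) : ℝ :=
  ⟪perp (P.gradLeft ξ η), hessian P.c₂ (ξ - η) (perp (P.gradRight ξ η))⟫

/-- The Poisson bracket, in the variable `ξ`, of `Φ(·, η)` and `Φ(·, η')`. -/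
def bracket (η η' ξ : Plane) : ℝ := ⟪perp (P.gradLeft ξ η), P.gradLeft ξ η'⟫

lemma hasFDerivAt_val (ξ η : Plane) :
    HasFDerivAt (fun ξ => P.val ξ η) (innerSL ℝ (P.gradLeft ξ η)) ξ := by
  have h1 := (hasFDerivAt_energy P.pos₁.le ξ).const_mul P.e₁
  have h2 := ((hasFDerivAt_energy P.pos₂.le (ξ - η)).comp ξ
    ((hasFDerivAt_id ξ).sub_const η)).const_mul P.e₂
  refine ((h1.add h2).add_const (P.e₃ * energy P.c₃ η)).congr_fderiv ?_
  ext w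
  simp [gradLeft]

lemma contDiff_val {n : WithTop ℕ∞} : ContDiff ℝ n fun p : Plane × Plane => P.val p.1 p.2 := by
  have h1 := (contDiff_energy P.pos₁.le (n := n)).comp (contDiff_fst (E := Plane) (F := Plane))
  have h2 := (contDiff_energy P.pos₂.le (n := n)).comp
    ((contDiff_fst (E := Plane) (F := Plane)).sub contDiff_snd)
  have h3 := (contDiff_energy P.pos₃.le (n := n)).comp (contDiff_snd (E := Plane) (F := Plane))
  exact ((contDiff_const.mul h1).add (contDiff_const.mul h2)).add (contDiff_const.mul h3)

lemma contDiff_gradLeft {n : WithTop ℕ∞} :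
    ContDiff ℝ n fun p : Plane × Plane => P.gradLeft p.1 p.2 := by
  have h1 := (contDiff_velocity P.pos₁.le (n := n)).comp (contDiff_fst (E := Plane) (F := Plane))
  have h2 := (contDiff_velocity P.pos₂.le (n := n)).comp
    ((contDiff_fst (E := Plane) (F := Plane)).sub contDiff_snd)
  exact (h1.const_smul P.e₁).add (h2.const_smul P.e₂)

lemma contDiff_gradRight {n : WithTop ℕ∞} :
    ContDiff ℝ n fun p : Plane × Plane => P.gradRight p.1 p.2 := by
  have h1 := (contDiff_velocity P.pos₃.le (n := n)).comp (contDiff_snd (E := Plane) (F := Plane))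
  have h2 := (contDiff_velocity P.pos₂.le (n := n)).comp
    ((contDiff_fst (E := Plane) (F := Plane)).sub contDiff_snd)
  exact (h1.const_smul P.e₃).sub (h2.const_smul P.e₂)

lemma contDiff_hessian {c : ℝ} (hc : 0 ≤ c) {n : WithTop ℕ∞} : ContDiff ℝ n (hessian c) := by
  have h : hessian c = fderiv ℝ (velocity c) := by
    ext1 v; exact (hasFDerivAt_velocity hc v).fderiv.symm
  rw [h]
  exact (contDiff_velocity hc (n := ω)).fderiv_right (m := n) (by simp) |>.of_le le_rfl

lemma contDiff_curvature {n : WithTop ℕ∞} :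
    ContDiff ℝ n fun p : Plane × Plane => P.curvature p.1 p.2 := by
  have h2 := (contDiff_hessian P.pos₂.le (n := n)).comp
    ((contDiff_fst (E := Plane) (F := Plane)).sub contDiff_snd)
  exact (perp.contDiff.comp P.contDiff_gradLeft).inner ℝ
    (h2.clm_apply (perp.contDiff.comp P.contDiff_gradRight))

lemma contDiff_left {E : Type*} [NormedAddCommGroup E] [NormedSpace ℝ E] {n : WithTop ℕ∞}
    {f : Plane → Plane → E} (h : ContDiff ℝ n fun p : Plane × Plane => f p.1 p.2) (η : Plane) :
    ContDiff ℝ n fun ξ => f ξ η :=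
  h.comp (contDiff_id.prodMk contDiff_const)

lemma contDiff_bracket (η η' : Plane) {n : WithTop ℕ∞} : ContDiff ℝ n (P.bracket η η') :=
  (perp.contDiff.comp (contDiff_left P.contDiff_gradLeft η)).inner ℝ
    (contDiff_left P.contDiff_gradLeft η')

lemma norm_gradLeft_le (ξ η : Plane) : ‖P.gradLeft ξ η‖ ≤ 2 := by
  refine (norm_add_le _ _).trans ?_
  rw [norm_smul, norm_smul, Real.norm_eq_abs, Real.norm_eq_abs, P.sign₁, P.sign₂]
  linarith [norm_velocity_le P.pos₁.le P.le₁ ξ, norm_velocity_le P.pos₂.le P.le₂ (ξ - η)]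

lemma norm_gradRight_le (ξ η : Plane) : ‖P.gradRight ξ η‖ ≤ 2 := by
  refine (norm_sub_le _ _).trans ?_
  rw [norm_smul, norm_smul, Real.norm_eq_abs, Real.norm_eq_abs, P.sign₃, P.sign₂]
  linarith [norm_velocity_le P.pos₃.le P.le₃ η, norm_velocity_le P.pos₂.le P.le₂ (ξ - η)]

lemma norm_velocity_sub_le_one {c : ℝ} (hc : 0 ≤ c) (hc1 : c ≤ 1) (x y : Plane) :
    ‖velocity c x - velocity c y‖ ≤ ‖x - y‖ :=
  (norm_velocity_sub_le hc x y).trans (mul_le_of_le_one_left (norm_nonneg _) hc1)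

lemma norm_gradLeft_sub_le (ξ ξ' η : Plane) :
    ‖P.gradLeft ξ η - P.gradLeft ξ' η‖ ≤ 2 * ‖ξ - ξ'‖ := by
  have e : P.gradLeft ξ η - P.gradLeft ξ' η = P.e₁ • (velocity P.c₁ ξ - velocity P.c₁ ξ')
      + P.e₂ • (velocity P.c₂ (ξ - η) - velocity P.c₂ (ξ' - η)) := by
    simp only [gradLeft]; module
  rw [e]
  refine (norm_add_le _ _).trans ?_
  rw [norm_smul, norm_smul, Real.norm_eq_abs, Real.norm_eq_abs, P.sign₁, P.sign₂]
  have h1 := norm_velocity_sub_le_one P.pos₁.le P.le₁ ξ ξ'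
  have h2 := norm_velocity_sub_le_one P.pos₂.le P.le₂ (ξ - η) (ξ' - η)
  rw [sub_sub_sub_cancel_right] at h2
  linarith

lemma norm_gradRight_sub_le (ξ η η' : Plane) :
    ‖P.gradRight ξ η - P.gradRight ξ η'‖ ≤ 2 * ‖η - η'‖ := by
  have e : P.gradRight ξ η - P.gradRight ξ η' = P.e₃ • (velocity P.c₃ η - velocity P.c₃ η')
      + P.e₂ • (velocity P.c₂ (ξ - η') - velocity P.c₂ (ξ - η)) := by
    simp only [gradRight]; module
  rw [e]
  refine (norm_add_le _ _).trans ?_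
  rw [norm_smul, norm_smul, Real.norm_eq_abs, Real.norm_eq_abs, P.sign₃, P.sign₂]
  have h1 := norm_velocity_sub_le_one P.pos₃.le P.le₃ η η'
  have h2 := norm_velocity_sub_le_one P.pos₂.le P.le₂ (ξ - η') (ξ - η)
  rw [sub_sub_sub_cancel_left] at h2
  linarith

lemma norm_gradRight_sub_left_le (ξ ξ' η : Plane) :
    ‖P.gradRight ξ η - P.gradRight ξ' η‖ ≤ ‖ξ - ξ'‖ := by
  have e : P.gradRight ξ η - P.gradRight ξ' η
      = (-P.e₂) • (velocity P.c₂ (ξ - η) - velocity P.c₂ (ξ' - η)) := by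
    simp only [gradRight]; module
  rw [e, norm_smul, Real.norm_eq_abs, abs_neg, P.sign₂, one_mul]
  have h2 := norm_velocity_sub_le_one P.pos₂.le P.le₂ (ξ - η) (ξ' - η)
  rwa [sub_sub_sub_cancel_right] at h2

lemma norm_hessian_apply_le {c : ℝ} (hc : 0 ≤ c) (hc1 : c ≤ 1) (y h : Plane) :
    ‖hessian c y h‖ ≤ ‖h‖ :=
  ((hessian c y).le_of_opNorm_le (norm_hessian_le hc y) h).trans
    (mul_le_of_le_one_left (norm_nonneg _) hc1)

/-- Where the curvature is large, so is the gradient in `η`. -/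
lemma abs_curvature_le (ξ η : Plane) : |P.curvature ξ η| ≤ 2 * ‖P.gradRight ξ η‖ := by
  refine (abs_real_inner_le_norm _ _).trans ?_
  have h := norm_hessian_apply_le P.pos₂.le P.le₂ (ξ - η) (perp (P.gradRight ξ η))
  rw [norm_perp] at h ⊢
  exact mul_le_mul (P.norm_gradLeft_le ξ η) h (norm_nonneg _) (by norm_num)

lemma abs_curvature_sub_le (ξ ξ' η : Plane) :
    |P.curvature ξ η - P.curvature ξ' η| ≤ 22 * ‖ξ - ξ'‖ := by
  set p := P.gradLeft ξ η
  set p' := P.gradLeft ξ' η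
  set q := P.gradRight ξ η
  set q' := P.gradRight ξ' η
  have e : P.curvature ξ η - P.curvature ξ' η =
      ⟪perp (p - p'), hessian P.c₂ (ξ - η) (perp q)⟫
      + ⟪perp p', (hessian P.c₂ (ξ - η) - hessian P.c₂ (ξ' - η)) (perp q)⟫
      + ⟪perp p', hessian P.c₂ (ξ' - η) (perp (q - q'))⟫ := by
    simp only [curvature, map_sub, inner_sub_left, inner_sub_right, sub_apply]
    ring
  have t1 : |⟪perp (p - p'), hessian P.c₂ (ξ - η) (perp q)⟫| ≤ (2 * ‖ξ - ξ'‖) * 2 := by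
    refine (abs_real_inner_le_norm _ _).trans ?_
    have h := norm_hessian_apply_le P.pos₂.le P.le₂ (ξ - η) (perp q)
    rw [norm_perp] at h ⊢
    exact mul_le_mul (P.norm_gradLeft_sub_le ξ ξ' η) (h.trans (P.norm_gradRight_le ξ η))
      (norm_nonneg _) (by positivity)
  have t2 : |⟪perp p', (hessian P.c₂ (ξ - η) - hessian P.c₂ (ξ' - η)) (perp q)⟫|
      ≤ 2 * (4 * ‖ξ - ξ'‖ * 2) := by
    refine (abs_real_inner_le_norm _ _).trans ?_
    have h := (hessian P.c₂ (ξ - η) - hessian P.c₂ (ξ' - η)).le_of_opNorm_le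
      (norm_hessian_sub_le P.pos₂.le P.le₂ (ξ - η) (ξ' - η)) (perp q)
    rw [sub_sub_sub_cancel_right, norm_perp] at h
    rw [norm_perp]
    exact mul_le_mul (P.norm_gradLeft_le ξ' η)
      (h.trans (by gcongr; exact P.norm_gradRight_le ξ η)) (norm_nonneg _) (by norm_num)
  have t3 : |⟪perp p', hessian P.c₂ (ξ' - η) (perp (q - q'))⟫| ≤ 2 * ‖ξ - ξ'‖ := by
    refine (abs_real_inner_le_norm _ _).trans ?_
    have h := norm_hessian_apply_le P.pos₂.le P.le₂ (ξ' - η) (perp (q - q'))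
    rw [norm_perp] at h ⊢
    exact mul_le_mul (P.norm_gradLeft_le ξ' η) (h.trans (P.norm_gradRight_sub_left_le ξ ξ' η))
      (norm_nonneg _) (by norm_num)
  rw [e]
  refine (abs_add_le _ _).trans ((add_le_add (abs_add_le _ _) le_rfl).trans ?_)
  linarith

lemma norm_fderiv_curvature_le (ξ η : Plane) : ‖fderiv ℝ (fun ξ => P.curvature ξ η) ξ‖ ≤ 22 := by
  have : LipschitzWith 22 fun ξ => P.curvature ξ η :=
    LipschitzWith.of_dist_le_mul fun x y => by
      rw [dist_eq_norm, dist_eq_norm]; exact P.abs_curvature_sub_le x y η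
  exact norm_fderiv_le_of_lipschitz ℝ this

lemma norm_fderiv_bracket_le (η η' ξ : Plane) : ‖fderiv ℝ (P.bracket η η') ξ‖ ≤ 8 := by
  have : LipschitzWith 8 (P.bracket η η') := LipschitzWith.of_dist_le_mul fun x y => by
    rw [dist_eq_norm, dist_eq_norm, Real.norm_eq_abs]
    have e : P.bracket η η' x - P.bracket η η' y
        = ⟪perp (P.gradLeft x η - P.gradLeft y η), P.gradLeft x η'⟫
          + ⟪perp (P.gradLeft y η), P.gradLeft x η' - P.gradLeft y η'⟫ := by
      simp only [bracket, map_sub, inner_sub_left, inner_sub_right]; ring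
    rw [e]
    refine (abs_add_le _ _).trans ?_
    have t1 := abs_real_inner_le_norm (perp (P.gradLeft x η - P.gradLeft y η)) (P.gradLeft x η')
    have t2 := abs_real_inner_le_norm (perp (P.gradLeft y η))
      (P.gradLeft x η' - P.gradLeft y η')
    rw [norm_perp] at t1 t2
    have t3 := mul_le_mul (P.norm_gradLeft_sub_le x y η) (P.norm_gradLeft_le x η')
      (norm_nonneg _) (by positivity)
    have t4 := mul_le_mul (P.norm_gradLeft_le y η) (P.norm_gradLeft_sub_le x y η')
      (norm_nonneg _) (by norm_num)
    push_cast
    linarith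
  exact norm_fderiv_le_of_lipschitz ℝ this

/-- First-order Taylor expansion of the phase in `η`. -/
lemma abs_val_taylor_right (ξ η h : Plane) :
    |P.val ξ (η + h) - P.val ξ η - ⟪P.gradRight ξ η, h⟫| ≤ 2 * ‖h‖ ^ 2 := by
  have h1 := abs_energy_taylor P.pos₃.le P.le₃ η h
  have h2 := abs_energy_taylor P.pos₂.le P.le₂ (ξ - η) (-h)
  rw [norm_neg, inner_neg_right, show ξ - η + -h = ξ - (η + h) by abel] at h2
  have e : P.val ξ (η + h) - P.val ξ η - ⟪P.gradRight ξ η, h⟫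
      = P.e₂ * (energy P.c₂ (ξ - (η + h)) - energy P.c₂ (ξ - η) - -⟪velocity P.c₂ (ξ - η), h⟫)
        + P.e₃ * (energy P.c₃ (η + h) - energy P.c₃ η - ⟪velocity P.c₃ η, h⟫) := by
    simp only [val, gradRight, inner_sub_left, inner_smul_left, conj_trivial]
    ring
  rw [e]
  refine (abs_add_le _ _).trans ?_
  rw [abs_mul, abs_mul, P.sign₂, P.sign₃]
  linarith

/-- Where the curvature is at least `κ`, two nearby points `η`, `η + h` of the level set of
`Φ(ξ, ·)` have a bracket of size `κ|h|`: the displacement `h` is then nearly parallel to the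
rotated gradient in `η`, on which the mixed Hessian is the curvature. -/
lemma abs_bracket_ge {κ ε : ℝ} {ξ η h : Plane} (hκ : 0 < κ) (hcurv : κ ≤ |P.curvature ξ η|)
    (h1 : |P.val ξ η| ≤ 2 * ε) (h2 : |P.val ξ (η + h)| ≤ 2 * ε) (hh : ‖h‖ ≤ κ / 64)
    (hε : ε ≤ κ * ‖h‖ / 128) :
    κ * ‖h‖ / 16 ≤ |P.bracket η (η + h) ξ| := by
  set p := P.gradLeft ξ η with hp
  set q := P.gradRight ξ η
  set Mh := hessian P.c₂ (ξ - η) h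
  have hh0 := norm_nonneg h
  have hq2 : ‖q‖ ≤ 2 := P.norm_gradRight_le ξ η
  have hqκ : κ / 2 ≤ ‖q‖ := by linarith [P.abs_curvature_le ξ η]
  have hq0 : 0 < ‖q‖ := by linarith
  -- both points lie near the level set, hence `h` is nearly orthogonal to the gradient `q`
  have hqh : |⟪q, h⟫| ≤ κ * ‖h‖ / 16 := by
    have h3 := P.abs_val_taylor_right ξ η h
    have h4 : 2 * ‖h‖ ^ 2 ≤ κ * ‖h‖ / 32 := by nlinarith
    rw [abs_le] at *
    constructor <;> linarith [h3.1, h3.2, h1.1, h1.2, h2.1, h2.2]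
  have hJq : ‖q‖ * ‖h‖ / 2 ≤ |⟪perp q, h⟫| := by
    refine abs_le_of_sq_le_sq' ?_ (abs_nonneg _) |>.2
    rw [sq_abs, inner_perp_sq]
    have h5 : ⟪q, h⟫ ^ 2 ≤ (‖q‖ * ‖h‖ / 8) ^ 2 := by
      rw [← sq_abs ⟪q, h⟫]
      have : |⟪q, h⟫| ≤ ‖q‖ * ‖h‖ / 8 := by nlinarith
      gcongr
    nlinarith [mul_nonneg hq0.le hh0]
  have hlow : 3 / 16 * (κ * ‖h‖) ≤ |⟪perp p, Mh⟫| := by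
    -- in the frame `q`, `perp q`, the component along `perp q` carries the curvature
    have e : ‖q‖ ^ 2 * ⟪perp p, Mh⟫ = ⟪q, h⟫ * ⟪perp p, hessian P.c₂ (ξ - η) q⟫
        + ⟪perp q, h⟫ * P.curvature ξ η := by
      have := congrArg (fun z => ⟪perp p, hessian P.c₂ (ξ - η) z⟫) (norm_sq_smul_eq q h)
      simp only [map_add, map_smul, inner_add_right, inner_smul_right] at this
      exact this
    have t1 : |⟪perp p, hessian P.c₂ (ξ - η) q⟫| ≤ 2 * ‖q‖ := by
      refine (abs_real_inner_le_norm _ _).trans ?_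
      rw [norm_perp]
      exact mul_le_mul (P.norm_gradLeft_le ξ η) (norm_hessian_apply_le P.pos₂.le P.le₂ _ _)
        (norm_nonneg _) (by norm_num)
    have t2 : |⟪q, h⟫ * ⟪perp p, hessian P.c₂ (ξ - η) q⟫| ≤ κ * ‖h‖ / 16 * (2 * ‖q‖) := by
      rw [abs_mul]; gcongr
    have t3 : ‖q‖ * ‖h‖ / 2 * κ ≤ |⟪perp q, h⟫ * P.curvature ξ η| := by
      rw [abs_mul]; gcongr
    have t4 : ‖q‖ * ‖h‖ / 2 * κ - κ * ‖h‖ / 16 * (2 * ‖q‖) ≤ ‖q‖ ^ 2 * |⟪perp p, Mh⟫| := by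
      have e' : ‖q‖ ^ 2 * |⟪perp p, Mh⟫| = |‖q‖ ^ 2 * ⟪perp p, Mh⟫| := by
        rw [abs_mul, abs_of_nonneg (sq_nonneg ‖q‖)]
      rw [e', e]
      have := abs_sub_abs_le_abs_add (⟪perp q, h⟫ * P.curvature ξ η)
        (⟪q, h⟫ * ⟪perp p, hessian P.c₂ (ξ - η) q⟫)
      rw [add_comm (⟪perp q, h⟫ * P.curvature ξ η)] at this
      linarith
    have t5 : 3 / 8 * (κ * ‖h‖) ≤ ‖q‖ * |⟪perp p, Mh⟫| := by
      refine le_of_mul_le_mul_left ?_ hq0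
      nlinarith
    nlinarith [abs_nonneg ⟪perp p, Mh⟫]
  have hT := norm_velocity_taylor P.pos₂.le P.le₂ (ξ - η) (-h)
  rw [norm_neg, map_neg, show ξ - η + -h = ξ - (η + h) by abel] at hT
  -- the bracket vanishes at `h = 0`; to first order in `h` it is `⟪perp p, Mh⟫` up to sign
  set r := velocity P.c₂ (ξ - (η + h)) - velocity P.c₂ (ξ - η) - -Mh with hr
  have e : P.bracket η (η + h) ξ = P.e₂ * (⟪perp p, r⟫ - ⟪perp p, Mh⟫) := by
    have e1 : P.gradLeft ξ (η + h) = p + P.e₂ • (r - Mh) := by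
      simp only [gradLeft, hp, hr]; module
    rw [bracket, e1, inner_add_right, inner_perp_self, inner_smul_right, inner_sub_right, zero_add]
  rw [e, abs_mul, P.sign₂, one_mul]
  have hr2 : |⟪perp p, r⟫| ≤ 2 * (4 * ‖h‖ ^ 2) := by
    refine (abs_real_inner_le_norm _ _).trans ?_
    rw [norm_perp]
    exact mul_le_mul (P.norm_gradLeft_le ξ η) hT (norm_nonneg _) (by norm_num)
  have h6 : 8 * ‖h‖ ^ 2 ≤ κ * ‖h‖ / 8 := by nlinarith
  have := abs_sub_abs_le_abs_sub ⟪perp p, Mh⟫ ⟪perp p, r⟫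
  rw [abs_sub_comm]
  linarith

/-- Along the Hamiltonian field of `Φ(·, η)`, which is divergence free, derivatives integrate to
zero. -/
lemma integral_fderiv_perp_gradLeft {F : Plane → ℂ} (hF : ContDiff ℝ 1 F)
    (hs : HasCompactSupport F) (η : Plane) :
    ∫ ξ, fderiv ℝ F ξ (perp (P.gradLeft ξ η)) = 0 := by
  set G : Plane → ℝ := fun ξ => P.val ξ η
  have hG2 : ContDiff ℝ 2 G := contDiff_left P.contDiff_val η
  set b₀ : Plane := EuclideanSpace.single 0 1
  set b₁ : Plane := EuclideanSpace.single 1 1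
  have hGd : ∀ ξ v, fderiv ℝ G ξ v = ⟪P.gradLeft ξ η, v⟫ := fun ξ v => by
    rw [(P.hasFDerivAt_val ξ η).fderiv]; rfl
  have hperp : ∀ ξ, perp (P.gradLeft ξ η) = (fderiv ℝ G ξ b₀) • b₁ - (fderiv ℝ G ξ b₁) • b₀ := by
    intro ξ
    rw [hGd, hGd]
    ext i
    fin_cases i <;> simp [inner_plane, b₀, b₁]
  have hdG : ∀ v, ContDiff ℝ 1 fun ξ => fderiv ℝ G ξ v := fun v =>
    (hG2.fderiv_right (m := 1) (by norm_num)).clm_apply contDiff_const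
  have hdF : ∀ v, Continuous fun ξ => fderiv ℝ F ξ v := fun v =>
    (hF.continuous_fderiv one_ne_zero).clm_apply continuous_const
  have hsF : ∀ v, HasCompactSupport fun ξ => fderiv ℝ F ξ v := fun v =>
    (hs.fderiv (𝕜 := ℝ)).comp_left (g := fun L : Plane →L[ℝ] ℂ => L v) (by simp)
  have key : ∀ v w, ∫ ξ, (fderiv ℝ G ξ v) • fderiv ℝ F ξ w
      = -∫ ξ, (fderiv ℝ (fun ξ => fderiv ℝ G ξ v) ξ w) • F ξ := by
    intro v w
    refine integral_smul_fderiv_eq_neg_fderiv_smul_of_integrable ?_ ?_ ?_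
      (fun ξ _ => (hdG v).differentiable one_ne_zero ξ)
      (fun ξ _ => hF.differentiable one_ne_zero ξ)
    · refine Continuous.integrable_of_hasCompactSupport ?_ hs.smul_left
      exact (((hdG v).continuous_fderiv one_ne_zero).clm_apply continuous_const).smul hF.continuous
    · exact ((hdG v).continuous.smul (hdF w)).integrable_of_hasCompactSupport (hsF w).smul_left
    · exact ((hdG v).continuous.smul hF.continuous).integrable_of_hasCompactSupport hs.smul_left
  -- the field is divergence free because second derivatives commute
  have hsymm : ∀ ξ, fderiv ℝ (fun ξ => fderiv ℝ G ξ b₀) ξ b₁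
      = fderiv ℝ (fun ξ => fderiv ℝ G ξ b₁) ξ b₀ := by
    intro ξ
    have h1 : DifferentiableAt ℝ (fderiv ℝ G) ξ :=
      (hG2.fderiv_right (m := 1) (by norm_num)).differentiable one_ne_zero ξ
    have h2 : IsSymmSndFDerivAt ℝ G ξ :=
      hG2.contDiffAt.isSymmSndFDerivAt (by simp)
    have e : ∀ v w, fderiv ℝ (fun ξ => fderiv ℝ G ξ v) ξ w = fderiv ℝ (fderiv ℝ G) ξ w v := by
      intro v w
      rw [fderiv_clm_apply h1 (differentiableAt_const v)]
      simp
    rw [e, e]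
    exact h2.eq b₁ b₀
  have hint : ∀ v w, Integrable fun ξ => (fderiv ℝ G ξ v) • fderiv ℝ F ξ w := fun v w =>
    ((hdG v).continuous.smul (hdF w)).integrable_of_hasCompactSupport (hsF w).smul_left
  calc ∫ ξ, fderiv ℝ F ξ (perp (P.gradLeft ξ η))
      = ∫ ξ, ((fderiv ℝ G ξ b₀) • fderiv ℝ F ξ b₁ - (fderiv ℝ G ξ b₁) • fderiv ℝ F ξ b₀) := by
        congr 1; ext1 ξ; rw [hperp, map_sub, map_smul, map_smul]
    _ = 0 := by
        rw [integral_sub (hint _ _) (hint _ _), key, key]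
        simp only [hsymm, sub_self]

end PhaseData

/-! ### Oscillatory kernels and integration by parts -/

/-- The oscillating cutoff `e^{isx} φ(tx)`. -/
def oscCutoff (φ : ℝ → ℝ) (s t x : ℝ) : ℂ :=
  Complex.exp (Complex.I * ((s * x : ℝ) : ℂ)) * ((φ (t * x) : ℝ) : ℂ)

lemma norm_oscCutoff (φ : ℝ → ℝ) (s t x : ℝ) : ‖oscCutoff φ s t x‖ = |φ (t * x)| := by
  rw [oscCutoff, norm_mul, mul_comm Complex.I, Complex.norm_exp_ofReal_mul_I, one_mul,
    Complex.norm_real, Real.norm_eq_abs]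

lemma contDiff_oscCutoff {φ : ℝ → ℝ} (hφ : ContDiff ℝ ∞ φ) (s t : ℝ) :
    ContDiff ℝ ∞ (oscCutoff φ s t) := by
  have h1 : ContDiff ℝ ∞ fun x : ℝ => ((s * x : ℝ) : ℂ) :=
    Complex.ofRealCLM.contDiff.comp (contDiff_const.mul contDiff_id)
  have h2 : ContDiff ℝ ∞ fun x : ℝ => ((φ (t * x) : ℝ) : ℂ) :=
    Complex.ofRealCLM.contDiff.comp (hφ.comp (contDiff_const.mul contDiff_id))
  exact ((contDiff_const.mul h1).cexp).mul h2

lemma hasDerivAt_oscCutoff {φ : ℝ → ℝ} (hφ : ContDiff ℝ ∞ φ) (s t x : ℝ) :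
    HasDerivAt (oscCutoff φ s t)
      (Complex.I * s * oscCutoff φ s t x + t * oscCutoff (deriv φ) s t x) x := by
  have h0 : HasDerivAt (fun x : ℝ => ((s * x : ℝ) : ℂ)) (s : ℂ) x := by
    simpa using ((hasDerivAt_id x).const_mul s).ofReal_comp
  have h1 : HasDerivAt (fun x : ℝ => Complex.exp (Complex.I * ((s * x : ℝ) : ℂ)))
      (Complex.exp (Complex.I * ((s * x : ℝ) : ℂ)) * (Complex.I * s)) x :=
    (h0.const_mul Complex.I).cexp
  have h2 : HasDerivAt (fun x : ℝ => ((φ (t * x) : ℝ) : ℂ)) ((deriv φ (t * x) * t : ℝ) : ℂ) x := by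
    have hd : HasDerivAt φ (deriv φ (t * x)) (t * x) :=
      (hφ.differentiable (by simp)).differentiableAt.hasDerivAt
    have := hd.comp x ((hasDerivAt_id x).const_mul t)
    simpa using this.ofReal_comp
  refine (h1.mul h2).congr_deriv ?_
  simp only [oscCutoff]
  push_cast
  ring

/-- When `t ≪ |s|`, the oscillating cutoff `e^{isx} φ(tx)` is, up to an error of size `(t/|s|)^N`,
the derivative of a function of size `1/|s|` with the same support. -/
lemma exists_antideriv_oscCutoff (N : ℕ) : ∀ φ : ℝ → ℝ, ContDiff ℝ ∞ φ →
    Function.support φ ⊆ Set.Icc (-(8 / 5)) (8 / 5) →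
    ∃ C : ℝ, 0 ≤ C ∧ ∀ s t : ℝ, 0 < t → s ≠ 0 → t / |s| ≤ 2 → ∃ Ψ : ℝ → ℂ, ContDiff ℝ ∞ Ψ ∧
      (∀ x, ‖Ψ x‖ ≤ C / |s|) ∧ (∀ x, 8 / 5 < t * |x| → Ψ x = 0) ∧
      ∀ x, ‖oscCutoff φ s t x - deriv Ψ x‖ ≤ C * (t / |s|) ^ N := by
  have hbdd : ∀ φ : ℝ → ℝ, ContDiff ℝ ∞ φ → Function.support φ ⊆ Set.Icc (-(8 / 5)) (8 / 5) →
      ∃ C : ℝ, 0 ≤ C ∧ ∀ x, |φ x| ≤ C := by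
    intro φ hφ hs
    have hc : HasCompactSupport φ := HasCompactSupport.of_support_subset_isCompact isCompact_Icc hs
    obtain ⟨C, hC⟩ := hφ.continuous.bounded_above_of_compact_support hc
    exact ⟨C, (norm_nonneg _).trans (hC 0), hC⟩
  induction N with
  | zero =>
    intro φ hφ hs
    obtain ⟨C, hC0, hC⟩ := hbdd φ hφ hs
    refine ⟨C, hC0, fun s t _ _ _ => ⟨fun _ => 0, contDiff_const, fun x => ?_, fun x _ => rfl,
      fun x => ?_⟩⟩
    · simp only [norm_zero]; positivity
    · simpa [norm_oscCutoff] using hC _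
  | succ N ih =>
    intro φ hφ hs
    obtain ⟨C₀, hC₀0, hC₀⟩ := hbdd φ hφ hs
    have hφ' : ContDiff ℝ ∞ (deriv φ) := hφ.deriv'
    have hs' : Function.support (deriv φ) ⊆ Set.Icc (-(8 / 5)) (8 / 5) :=
      support_deriv_subset.trans (closure_minimal hs isClosed_Icc)
    obtain ⟨C₁, hC₁0, hC₁⟩ := ih (deriv φ) hφ' hs'
    refine ⟨C₀ + 2 * C₁, by positivity, fun s t ht hs0 hst => ?_⟩
    obtain ⟨Ψ₁, hΨ, hΨb, hΨs, hΨd⟩ := hC₁ s t ht hs0 hst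
    have hsc : (Complex.I * s : ℂ) ≠ 0 := mul_ne_zero Complex.I_ne_zero (by exact_mod_cast hs0)
    have hns : ‖(Complex.I * s : ℂ)‖ = |s| := by simp
    have hnt : ‖(t / (Complex.I * s) : ℂ)‖ = t / |s| := by
      rw [norm_div, hns, Complex.norm_real, Real.norm_eq_abs, abs_of_pos ht]
    -- differentiating `e^{isx} φ(tx) / (is)` leaves the error `(t / (is)) e^{isx} φ'(tx)`, to which
    -- the induction hypothesis for `φ'` applies
    refine ⟨fun x => oscCutoff φ s t x / (Complex.I * s) - t / (Complex.I * s) * Ψ₁ x,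
      ?_, ?_, ?_, ?_⟩
    · exact ((contDiff_oscCutoff hφ s t).div_const _).sub (contDiff_const.mul hΨ)
    · intro x
      refine (norm_sub_le _ _).trans ?_
      rw [norm_div, hns, norm_mul, hnt, norm_oscCutoff]
      calc |φ (t * x)| / |s| + t / |s| * ‖Ψ₁ x‖ ≤ C₀ / |s| + 2 * (C₁ / |s|) := by
            gcongr
            · exact hC₀ _
            · exact hΨb x
        _ = _ := by ring
    · intro x hx
      have h0 : φ (t * x) = 0 := by
        by_contra h
        have h2 : |t * x| ≤ 8 / 5 := abs_le.2 (hs h)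
        rw [abs_mul, abs_of_pos ht] at h2
        linarith
      simp [hΨs x hx, oscCutoff, h0]
    · intro x
      have h1 := (hasDerivAt_oscCutoff hφ s t x).div_const (Complex.I * s)
      have h2 := ((hΨ.differentiable (by simp)).differentiableAt (x := x)).hasDerivAt.const_mul
        ((t : ℂ) / (Complex.I * s))
      rw [(h1.fun_sub h2).deriv]
      have e : oscCutoff φ s t x - ((Complex.I * s * oscCutoff φ s t x
          + t * oscCutoff (deriv φ) s t x) / (Complex.I * s) - t / (Complex.I * s) * deriv Ψ₁ x)
          = -(t / (Complex.I * s)) * (oscCutoff (deriv φ) s t x - deriv Ψ₁ x) := by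
        have h3 : (Complex.I * s * oscCutoff φ s t x + t * oscCutoff (deriv φ) s t x)
            / (Complex.I * s) = oscCutoff φ s t x
              + t / (Complex.I * s) * oscCutoff (deriv φ) s t x := by
          rw [add_div, mul_div_cancel_left₀ _ hsc]; ring
        rw [h3]
        ring
      rw [e, norm_mul, norm_neg, hnt]
      calc t / |s| * ‖oscCutoff (deriv φ) s t x - deriv Ψ₁ x‖
          ≤ t / |s| * (C₁ * (t / |s|) ^ N) := by gcongr; exact hΨd x
        _ = C₁ * (t / |s|) ^ (N + 1) := by ring
        _ ≤ (C₀ + 2 * C₁) * (t / |s|) ^ (N + 1) := by gcongr; linarith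

/-- Amplitudes of size `M₀`, with derivative of size `M₁` in the first variable, supported where
the rotational curvature is at least `κ`. -/
structure IsAmplitude (P : PhaseData) (b : Plane → Plane → ℂ) (K κ M₀ M₁ : ℝ) : Prop where
  measurable : Measurable fun p : Plane × Plane => b p.1 p.2
  contDiff : ∀ η, ContDiff ℝ 1 fun ξ => b ξ η
  bound : ∀ ξ η, ‖b ξ η‖ ≤ M₀
  bound_fderiv : ∀ ξ η, ‖fderiv ℝ (fun ξ => b ξ η) ξ‖ ≤ M₁
  left_mem : ∀ ξ η, b ξ η ≠ 0 → ξ ∈ Metric.ball (0 : Plane) K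
  right_mem : ∀ ξ η, b ξ η ≠ 0 → η ∈ Metric.ball (0 : Plane) K
  curvature : ∀ ξ η, b ξ η ≠ 0 → κ ≤ |P.curvature ξ η|

/-- The kernel `e^{isΦ} φ(tΦ) b`. -/
def oscKernel (P : PhaseData) (φ : ℝ → ℝ) (s t : ℝ) (b : Plane → Plane → ℂ) (ξ η : Plane) : ℂ :=
  oscCutoff φ s t (P.val ξ η) * b ξ η

lemma _root_.IsCutoff.abs_le_one {φ : ℝ → ℝ} (hφ : IsCutoff φ) (x : ℝ) : |φ x| ≤ 1 := by
  rw [abs_of_nonneg (hφ.mem_Icc x).1]; exact (hφ.mem_Icc x).2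

lemma oscCutoff_eq_zero {φ : ℝ → ℝ} (hφ : IsCutoff φ) {s t x : ℝ} (ht : 0 < t)
    (hx : 8 / 5 < t * |x|) : oscCutoff φ s t x = 0 := by
  have h0 : φ (t * x) = 0 := by
    by_contra h
    have h2 : |t * x| ≤ 8 / 5 := abs_le.2 (hφ.support_subset h)
    rw [abs_mul, abs_of_pos ht] at h2
    linarith
  simp [oscCutoff, h0]

/-- Points of the support of an amplitude at which the phase is at most `2/t`. -/
def levelSet (P : PhaseData) (K κ t : ℝ) : Set (Plane × Plane) :=
  {p | p.1 ∈ Metric.closedBall 0 K ∧ p.2 ∈ Metric.closedBall 0 K ∧ κ ≤ |P.curvature p.1 p.2| ∧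
    |P.val p.1 p.2| ≤ 2 / t}

lemma measurableSet_levelSet (P : PhaseData) (K κ t : ℝ) : MeasurableSet (levelSet P K κ t) := by
  have h1 : MeasurableSet {p : Plane × Plane | p.1 ∈ Metric.closedBall (0 : Plane) K} :=
    measurable_fst Metric.isClosed_closedBall.measurableSet
  have h2 : MeasurableSet {p : Plane × Plane | p.2 ∈ Metric.closedBall (0 : Plane) K} :=
    measurable_snd Metric.isClosed_closedBall.measurableSet
  have h3 : MeasurableSet {p : Plane × Plane | κ ≤ |P.curvature p.1 p.2|} :=
    measurableSet_le measurable_const (P.contDiff_curvature (n := 0)).continuous.abs.measurable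
  have h4 : MeasurableSet {p : Plane × Plane | |P.val p.1 p.2| ≤ 2 / t} :=
    measurableSet_le (P.contDiff_val (n := 0)).continuous.abs.measurable measurable_const
  exact h1.inter (h2.inter (h3.inter h4))

section Gram

variable {P : PhaseData} {φ : ℝ → ℝ} (hφ : IsCutoff φ) {s t K κ M₀ M₁ : ℝ}
  {b : Plane → Plane → ℂ} (hb : IsAmplitude P b K κ M₀ M₁)
include hφ hb

lemma norm_oscKernel_le (ξ η : Plane) : ‖oscKernel P φ s t b ξ η‖ ≤ M₀ := by
  rw [oscKernel, norm_mul, norm_oscCutoff]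
  calc |φ (t * P.val ξ η)| * ‖b ξ η‖ ≤ 1 * M₀ := by
        gcongr
        · exact hφ.abs_le_one _
        · exact hb.bound ξ η
    _ = M₀ := one_mul _

lemma isKernel_oscKernel : IsKernel (oscKernel P φ s t b) M₀ K where
  measurable := ((contDiff_oscCutoff hφ.smooth s t).continuous.comp
    (P.contDiff_val (n := 0)).continuous).measurable.mul hb.measurable
  bound := norm_oscKernel_le hφ hb
  left_mem ξ η h := hb.left_mem ξ η fun h0 => h (by simp [oscKernel, h0])
  right_mem ξ η h := hb.right_mem ξ η fun h0 => h (by simp [oscKernel, h0])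

variable (ht : 0 < t)
include ht

lemma mem_levelSet_of_ne_zero {ξ η : Plane} (h : oscKernel P φ s t b ξ η ≠ 0) :
    (ξ, η) ∈ levelSet P K κ t := by
  have h1 : b ξ η ≠ 0 := fun h0 => h (by simp [oscKernel, h0])
  refine ⟨Metric.ball_subset_closedBall (hb.left_mem _ _ h1),
    Metric.ball_subset_closedBall (hb.right_mem _ _ h1), hb.curvature _ _ h1, ?_⟩
  by_contra h2
  refine h ?_
  rw [oscKernel, oscCutoff_eq_zero hφ ht, zero_mul]
  rw [not_le, div_lt_iff₀ ht] at h2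
  dsimp only at h2
  linarith

/-- Trivial bound for the kernel of `T* T`. -/
lemma enorm_gram_le (η η' : Plane) :
    ‖gram (oscKernel P φ s t b) η η'‖ₑ ≤ ∫⁻ ξ, ENNReal.ofReal (M₀ ^ 2) *
      ((levelSet P K κ t).indicator 1 (ξ, η) * (levelSet P K κ t).indicator 1 (ξ, η')) := by
  refine (enorm_integral_le_lintegral_enorm _).trans (lintegral_mono fun ξ => ?_)
  by_cases h : oscKernel P φ s t b ξ η = 0
  · simp [h]
  by_cases h' : oscKernel P φ s t b ξ η' = 0
  · simp [h']
  rw [Set.indicator_of_mem (mem_levelSet_of_ne_zero hφ hb ht h),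
    Set.indicator_of_mem (mem_levelSet_of_ne_zero hφ hb ht h'), Pi.one_apply, Pi.one_apply,
    mul_one, mul_one, ← ofReal_norm]
  refine ENNReal.ofReal_le_ofReal ?_
  rw [norm_mul, RCLike.norm_conj, sq]
  exact mul_le_mul (norm_oscKernel_le hφ hb _ _) (norm_oscKernel_le hφ hb _ _)
    (norm_nonneg _) ((norm_nonneg _).trans (hb.bound ξ η))

end Gram

lemma hasDerivAt_regularized_inv {q : ℝ} (hq : 0 < q) (x : ℝ) :
    HasDerivAt (fun x => x / (x ^ 2 + q)) ((q - x ^ 2) / (x ^ 2 + q) ^ 2) x := by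
  have h0 : x ^ 2 + q ≠ 0 := by positivity
  have h1 : HasDerivAt (fun x => x ^ 2 + q) (2 * x) x := by
    simpa using (hasDerivAt_pow 2 x).add_const q
  refine ((hasDerivAt_id x).div h1 h0).congr_deriv ?_
  simp only [id]
  congr 1
  ring

lemma deriv_eq_zero_of_support {Ψ : ℝ → ℂ} {t : ℝ} (h : ∀ x, 8 / 5 < t * |x| → Ψ x = 0) {x : ℝ}
    (hx : 8 / 5 < t * |x|) : deriv Ψ x = 0 := by
  have ho : IsOpen {x : ℝ | 8 / 5 < t * |x|} := isOpen_lt continuous_const (by fun_prop)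
  have : Ψ =ᶠ[nhds x] fun _ => 0 := by
    filter_upwards [ho.mem_nhds hx] with y hy using h y hy
  rw [this.deriv_eq, deriv_const]

/-- The support conditions of an amplitude are closed, hence they hold also where only its
derivative does not vanish. -/
lemma IsAmplitude.mem_of_ne_zero {P : PhaseData} {b : Plane → Plane → ℂ} {K κ M₀ M₁ : ℝ}
    (hb : IsAmplitude P b K κ M₀ M₁) {ξ η : Plane}
    (h : ¬(b ξ η = 0 ∧ fderiv ℝ (fun ξ => b ξ η) ξ = 0)) :
    ξ ∈ Metric.closedBall (0 : Plane) K ∧ η ∈ Metric.closedBall (0 : Plane) K ∧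
      κ ≤ |P.curvature ξ η| := by
  have hξ : ξ ∈ tsupport fun ξ => b ξ η := by
    by_contra hc
    exact h ⟨image_eq_zero_of_notMem_tsupport (f := fun ξ => b ξ η) hc,
      image_eq_zero_of_notMem_tsupport (f := fderiv ℝ fun ξ => b ξ η)
        fun h' => hc (tsupport_fderiv_subset ℝ h')⟩
  have hcl : IsClosed {ξ : Plane | ξ ∈ Metric.closedBall (0 : Plane) K ∧
      η ∈ Metric.closedBall (0 : Plane) K ∧ κ ≤ |P.curvature ξ η|} := by
    have hc : Continuous fun ξ => P.curvature ξ η :=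
      (PhaseData.contDiff_left P.contDiff_curvature η (n := 0)).continuous
    exact Metric.isClosed_closedBall.inter
      (isClosed_const.inter (isClosed_le continuous_const hc.abs))
  refine closure_minimal (fun ξ hξ => ?_) hcl hξ
  exact ⟨Metric.ball_subset_closedBall (hb.left_mem _ _ hξ),
    Metric.ball_subset_closedBall (hb.right_mem _ _ hξ), hb.curvature _ _ hξ⟩

/-- Derivative, along the Hamiltonian field of `Φ(·, η)`, of the product that is integrated by parts
in `enorm_gram_far_le`: the factor that depends on `Φ(·, η)` alone is not differentiated. -/
lemma fderiv_hamiltonian_mul (P : PhaseData) (η η' : Plane) {β : Plane → ℂ} (hβ : ContDiff ℝ 1 β)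
    {θ Ψ : ℝ → ℂ} (hθ : ContDiff ℝ ∞ θ) (hΨ : ContDiff ℝ ∞ Ψ) {q : ℝ} (hq : 0 < q) (ξ : Plane) :
    fderiv ℝ (fun ξ => β ξ * ((P.bracket η η' ξ / (P.bracket η η' ξ ^ 2 + q) : ℝ) : ℂ) *
      (θ (P.val ξ η) * Ψ (P.val ξ η'))) ξ (perp (P.gradLeft ξ η)) =
      (fderiv ℝ β ξ (perp (P.gradLeft ξ η)) *
          ((P.bracket η η' ξ / (P.bracket η η' ξ ^ 2 + q) : ℝ) : ℂ)
        + β ξ * (((q - P.bracket η η' ξ ^ 2) / (P.bracket η η' ξ ^ 2 + q) ^ 2 *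
          fderiv ℝ (P.bracket η η') ξ (perp (P.gradLeft ξ η)) : ℝ) : ℂ)) *
        (θ (P.val ξ η) * Ψ (P.val ξ η'))
      + β ξ * ((P.bracket η η' ξ / (P.bracket η η' ξ ^ 2 + q) : ℝ) : ℂ) *
        (θ (P.val ξ η) * (((P.bracket η η' ξ : ℝ) : ℂ) * deriv Ψ (P.val ξ η'))) := by
  set v := perp (P.gradLeft ξ η) with hv
  have hz : ξ + (0 : ℝ) • v = ξ := by simp
  have h1 : HasDerivAt (fun τ : ℝ => β (ξ + τ • v)) (fderiv ℝ β ξ v) 0 :=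
    (hβ.differentiable one_ne_zero ξ).hasFDerivAt.hasLineDerivAt v
  have h2 : HasDerivAt (fun τ : ℝ => P.bracket η η' (ξ + τ • v))
      (fderiv ℝ (P.bracket η η') ξ v) 0 :=
    ((P.contDiff_bracket η η' (n := 1)).differentiable one_ne_zero ξ).hasFDerivAt.hasLineDerivAt v
  have h3 : HasDerivAt (fun τ : ℝ => P.val (ξ + τ • v) η) 0 0 := by
    have := (P.hasFDerivAt_val ξ η).hasLineDerivAt v
    rw [innerSL_apply_apply, hv, real_inner_comm, inner_perp_self] at this
    exact this
  have h4 : HasDerivAt (fun τ : ℝ => P.val (ξ + τ • v) η') (P.bracket η η' ξ) 0 := by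
    have := (P.hasFDerivAt_val ξ η').hasLineDerivAt v
    rw [innerSL_apply_apply, hv, real_inner_comm] at this
    exact this
  have h5 : HasDerivAt (fun τ : ℝ => ((P.bracket η η' (ξ + τ • v) /
        (P.bracket η η' (ξ + τ • v) ^ 2 + q) : ℝ) : ℂ))
      (((q - P.bracket η η' ξ ^ 2) / (P.bracket η η' ξ ^ 2 + q) ^ 2 *
        fderiv ℝ (P.bracket η η') ξ v : ℝ) : ℂ) 0 := by
    have hr' := hasDerivAt_regularized_inv hq (P.bracket η η' (ξ + (0 : ℝ) • v))
    have := (hr'.comp (0 : ℝ) h2).ofReal_comp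
    rw [hz] at this
    exact this
  have h6 : HasDerivAt (fun τ : ℝ => θ (P.val (ξ + τ • v) η)) 0 0 := by
    have ho : HasDerivAt θ (deriv θ (P.val (ξ + (0 : ℝ) • v) η))
        (P.val (ξ + (0 : ℝ) • v) η) := (hθ.differentiable (by simp) _).hasDerivAt
    have h := ho.scomp (0 : ℝ) h3
    rw [zero_smul] at h
    exact h
  have h7 : HasDerivAt (fun τ : ℝ => Ψ (P.val (ξ + τ • v) η'))
      (((P.bracket η η' ξ : ℝ) : ℂ) * deriv Ψ (P.val ξ η')) 0 := by
    have ho : HasDerivAt Ψ (deriv Ψ (P.val (ξ + (0 : ℝ) • v) η'))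
        (P.val (ξ + (0 : ℝ) • v) η') := (hΨ.differentiable (by simp) _).hasDerivAt
    have h := ho.scomp (0 : ℝ) h4
    rw [hz, Complex.real_smul] at h
    exact h
  have h8 := (h1.fun_mul h5).fun_mul (h6.fun_mul h7)
  have hd : DifferentiableAt ℝ (fun ξ => β ξ *
      ((P.bracket η η' ξ / (P.bracket η η' ξ ^ 2 + q) : ℝ) : ℂ) *
      (θ (P.val ξ η) * Ψ (P.val ξ η'))) ξ := by
    have d1 : DifferentiableAt ℝ (fun ξ => ((P.bracket η η' ξ /
        (P.bracket η η' ξ ^ 2 + q) : ℝ) : ℂ)) ξ :=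
      Complex.ofRealCLM.differentiableAt.comp ξ
        ((hasDerivAt_regularized_inv hq _).differentiableAt.comp ξ
          ((P.contDiff_bracket η η' (n := 1)).differentiable one_ne_zero ξ))
    exact ((hβ.differentiable one_ne_zero ξ).mul d1).mul
      (((hθ.differentiable (by simp) _).comp ξ (P.hasFDerivAt_val ξ η).differentiableAt).mul
        ((hΨ.differentiable (by simp) _).comp ξ (P.hasFDerivAt_val ξ η').differentiableAt))
  refine ((hd.hasFDerivAt.hasLineDerivAt v).unique h8).trans ?_
  simp only [hz]
  ring

lemma integrable_fderiv_perp_gradLeft (P : PhaseData) {F : Plane → ℂ} (hF : ContDiff ℝ 1 F)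
    (hs : HasCompactSupport F) (η : Plane) :
    Integrable fun ξ => fderiv ℝ F ξ (perp (P.gradLeft ξ η)) := by
  have hc : Continuous fun ξ => fderiv ℝ F ξ (perp (P.gradLeft ξ η)) :=
    (hF.continuous_fderiv one_ne_zero).clm_apply
      (perp.continuous.comp (PhaseData.contDiff_left P.contDiff_gradLeft η (n := 0)).continuous)
  refine hc.integrable_of_hasCompactSupport ?_
  refine HasCompactSupport.intro (hs.fderiv (𝕜 := ℝ)).isCompact fun ξ hξ => ?_
  have : fderiv ℝ F ξ = 0 := image_eq_zero_of_notMem_tsupport hξ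
  rw [this]; rfl

lemma IsKernel.integrable_conj_mul {k : Plane → Plane → ℂ} {M R : ℝ} (hk : IsKernel k M R)
    (η η' : Plane) : Integrable fun ξ => starRingEnd ℂ (k ξ η) * k ξ η' := by
  have hM : 0 ≤ M := (norm_nonneg _).trans (hk.bound 0 0)
  have hm : Measurable fun ξ => starRingEnd ℂ (k ξ η) * k ξ η' :=
    (Complex.continuous_conj.measurable.comp (hk.measurable.comp measurable_prodMk_right)).mul
      (hk.measurable.comp measurable_prodMk_right)
  have h1 : Integrable ((Metric.ball (0 : Plane) R).indicator fun _ => M * M) :=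
    (integrable_indicator_iff Metric.isOpen_ball.measurableSet).2
      (integrableOn_const measure_ball_lt_top.ne)
  refine h1.mono' hm.aestronglyMeasurable (Filter.Eventually.of_forall fun ξ => ?_)
  by_cases hξ : ξ ∈ Metric.ball (0 : Plane) R
  · rw [Set.indicator_of_mem hξ, norm_mul, RCLike.norm_conj]
    exact mul_le_mul (hk.bound _ _) (hk.bound _ _) (norm_nonneg _) hM
  · have : k ξ η = 0 := by
      by_contra h; exact hξ (hk.left_mem _ _ h)
    rw [Set.indicator_of_notMem hξ, this]; simp

/-- Estimate of the integrand that is left after the integration by parts in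
`enorm_gram_far_le`. -/
lemma norm_remainder_le {β o x y z u v w p : ℂ} {B X Y Z U V W S : ℝ} (hβ : ‖β‖ ≤ B)
    (ho : ‖o‖ ≤ 1) (hx : ‖x‖ ≤ X) (hy : ‖y‖ ≤ Y) (hz : ‖z‖ ≤ Z) (hu : ‖u‖ ≤ U) (hv : ‖v‖ ≤ V)
    (hw : ‖w‖ ≤ W) (hp : ‖p‖ ≤ S) :
    ‖β * o * (x + y * z) - (u * v + β * w) * (o * p)‖ ≤ B * (X + Y * Z) + (U * V + B * W) * S := by
  have hB := (norm_nonneg _).trans hβ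
  have hY := (norm_nonneg _).trans hy
  have hU := (norm_nonneg _).trans hu
  have hV := (norm_nonneg _).trans hv
  have hW := (norm_nonneg _).trans hw
  have t1 : ‖x + y * z‖ ≤ X + Y * Z := by
    refine (norm_add_le _ _).trans ?_
    rw [norm_mul]; gcongr
  have t2 : ‖u * v + β * w‖ ≤ U * V + B * W := by
    refine (norm_add_le _ _).trans ?_
    rw [norm_mul, norm_mul]; gcongr
  refine (norm_sub_le _ _).trans ?_
  rw [norm_mul, norm_mul, norm_mul, norm_mul o]
  calc ‖β‖ * ‖o‖ * ‖x + y * z‖ + ‖u * v + β * w‖ * (‖o‖ * ‖p‖)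
      ≤ B * 1 * (X + Y * Z) + (U * V + B * W) * (1 * S) := by gcongr
    _ = _ := by ring

/-- Off-diagonal bound for the kernel of `T* T`, by one integration by parts along the Hamiltonian
field of `Φ(·, η)`. This field annihilates every function of `Φ(·, η)`, in particular the cutoff
`φ(tΦ(ξ, η))`, and it differentiates `Φ(ξ, η')` to the bracket. Division by the bracket `g` is
replaced by multiplication with `g/(g² + q)`, `q > 0` small, in order to stay with smooth
functions. -/
lemma enorm_gram_far_le {P : PhaseData} {φ : ℝ → ℝ} (hφ : IsCutoff φ) {s t K κ M₀ M₁ : ℝ}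
    {b : Plane → Plane → ℂ} (hb : IsAmplitude P b K κ M₀ M₁) (ht : 0 < t) (hs : s ≠ 0)
    {C δ : ℝ} (hδ : 0 < δ) (hδ1 : δ ≤ 1) {Ψ : ℝ → ℂ} (hΨ : ContDiff ℝ ∞ Ψ)
    (hΨb : ∀ x, ‖Ψ x‖ ≤ C / |s|) (hΨs : ∀ x, 8 / 5 < t * |x| → Ψ x = 0)
    (hΨd : ∀ x, ‖oscCutoff φ s t x - deriv Ψ x‖ ≤ C * δ)
    {η η' : Plane} {ρ : ℝ} (hκ : 0 < κ) (hρ : 0 < ρ) (hρh : ρ ≤ ‖η' - η‖)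
    (hh : ‖η' - η‖ ≤ κ / 64) (htρ : 1 / t ≤ κ * ρ / 128) :
    ‖gram (oscKernel P φ s t b) η η'‖ₑ ≤ ∫⁻ ξ, ENNReal.ofReal
      (M₀ ^ 2 * ((2 * C + 1) * δ) + (64 * (M₀ * M₁) / (κ * ρ) + 4096 * M₀ ^ 2 / (κ * ρ) ^ 2) *
        (C / |s|)) *
      ((levelSet P K κ t).indicator 1 (ξ, η) * (levelSet P K κ t).indicator 1 (ξ, η')) := by
  set g₀ := κ * ρ / 16 with hg₀
  have hg₀0 : 0 < g₀ := by positivity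
  -- with `|g| ≥ g₀`, this choice of `q` makes `1 - g · g/(g² + q) = q/(g² + q)` at most `δ`
  set q := g₀ ^ 2 * δ with hq
  have hq0 : 0 < q := by positivity
  set g : Plane → ℝ := P.bracket η η'
  set e : Plane → Plane := fun ξ => perp (P.gradLeft ξ η) with he
  set osc := oscCutoff φ s t with hosc
  set β : Plane → ℂ := fun ξ => starRingEnd ℂ (b ξ η) * b ξ η' with hβ
  set r : ℝ → ℝ := fun x => x / (x ^ 2 + q) with hr
  have hoscC : ContDiff ℝ ∞ osc := contDiff_oscCutoff hφ.smooth s t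
  have hC0 : 0 ≤ C := by
    have := (norm_nonneg _).trans (hΨb 0)
    by_contra h
    exact absurd this (not_le.2 (div_neg_of_neg_of_pos (not_le.1 h) (abs_pos.2 hs)))
  have hM₀ : 0 ≤ M₀ := (norm_nonneg _).trans (hb.bound 0 0)
  have hM₁ : 0 ≤ M₁ := (norm_nonneg _).trans (hb.bound_fderiv 0 0)
  have hosc1 : ∀ x, ‖osc x‖ ≤ 1 := fun x => by
    rw [hosc, norm_oscCutoff]; exact hφ.abs_le_one _
  have hrC : ContDiff ℝ ∞ r := by
    refine contDiff_id.div ((contDiff_id.pow 2).add contDiff_const) fun x => ?_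
    have : (0 : ℝ) < x ^ 2 + q := by positivity
    exact this.ne'
  have hconj : ContDiff ℝ ∞ (starRingEnd ℂ : ℂ → ℂ) := Complex.conjCLE.contDiff
  have hβC : ContDiff ℝ 1 β :=
    ((hconj.of_le (by simp)).comp (hb.contDiff η)).mul (hb.contDiff η')
  set F : Plane → ℂ := fun ξ => β ξ * ((r (g ξ) : ℝ) : ℂ) *
    (starRingEnd ℂ (osc (P.val ξ η)) * Ψ (P.val ξ η')) with hF
  have hFC : ContDiff ℝ 1 F := by
    have h1 : ContDiff ℝ 1 fun ξ => ((r (g ξ) : ℝ) : ℂ) := Complex.ofRealCLM.contDiff.comp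
      ((hrC.of_le (by simp)).comp (P.contDiff_bracket η η'))
    have h2 : ContDiff ℝ 1 fun ξ => starRingEnd ℂ (osc (P.val ξ η)) :=
      (hconj.of_le (by simp)).comp ((hoscC.of_le (by simp)).comp
        (PhaseData.contDiff_left P.contDiff_val η))
    have h3 : ContDiff ℝ 1 fun ξ => Ψ (P.val ξ η') :=
      (hΨ.of_le (by simp)).comp (PhaseData.contDiff_left P.contDiff_val η')
    exact (hβC.mul h1).mul (h2.mul h3)
  have hFs : HasCompactSupport F := by
    refine HasCompactSupport.intro (isCompact_closedBall (0 : Plane) K) fun ξ hξ => ?_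
    have : b ξ η = 0 := by
      by_contra h
      exact hξ (Metric.ball_subset_closedBall (hb.left_mem _ _ h))
    simp [hF, hβ, this]
  -- the derivative of `F` along the field `e`
  have hDF : ∀ ξ, fderiv ℝ F ξ (e ξ) =
      (fderiv ℝ β ξ (e ξ) * ((r (g ξ) : ℝ) : ℂ)
        + β ξ * (((q - g ξ ^ 2) / (g ξ ^ 2 + q) ^ 2 * fderiv ℝ g ξ (e ξ) : ℝ) : ℂ)) *
        (starRingEnd ℂ (osc (P.val ξ η)) * Ψ (P.val ξ η'))
      + β ξ * ((r (g ξ) : ℝ) : ℂ) *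
        (starRingEnd ℂ (osc (P.val ξ η)) * (((g ξ : ℝ) : ℂ) * deriv Ψ (P.val ξ η'))) :=
    fderiv_hamiltonian_mul P η η' hβC (hconj.comp hoscC) hΨ hq0
  have hint : Integrable fun ξ => fderiv ℝ F ξ (e ξ) := integrable_fderiv_perp_gradLeft P hFC hFs η
  have hintI := (isKernel_oscKernel (s := s) (t := t) hφ hb).integrable_conj_mul η η'
  have hgram : gram (oscKernel P φ s t b) η η' = ∫ ξ, (starRingEnd ℂ (oscKernel P φ s t b ξ η)
      * oscKernel P φ s t b ξ η' - fderiv ℝ F ξ (e ξ)) := by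
    rw [integral_sub hintI hint, P.integral_fderiv_perp_gradLeft hFC hFs η, sub_zero, gram]
  rw [hgram]
  refine (enorm_integral_le_lintegral_enorm _).trans (lintegral_mono fun ξ => ?_)
  -- the leading term `osc (Φ(ξ, η'))` cancels against `g · r(g) · Ψ'(Φ(ξ, η'))`, and the remainder
  -- contains derivatives of `β` and of `r ∘ g` only
  have hI : starRingEnd ℂ (oscKernel P φ s t b ξ η) * oscKernel P φ s t b ξ η'
      - fderiv ℝ F ξ (e ξ)
      = β ξ * starRingEnd ℂ (osc (P.val ξ η)) *
          ((osc (P.val ξ η') - deriv Ψ (P.val ξ η'))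
            + ((1 - r (g ξ) * g ξ : ℝ) : ℂ) * deriv Ψ (P.val ξ η'))
        - (fderiv ℝ β ξ (e ξ) * ((r (g ξ) : ℝ) : ℂ)
        + β ξ * (((q - g ξ ^ 2) / (g ξ ^ 2 + q) ^ 2 * fderiv ℝ g ξ (e ξ) : ℝ) : ℂ)) *
        (starRingEnd ℂ (osc (P.val ξ η)) * Ψ (P.val ξ η')) := by
    rw [hDF, oscKernel, oscKernel, map_mul]
    simp only [hβ, hosc]
    push_cast
    ring
  have hβb : ‖β ξ‖ ≤ M₀ ^ 2 := by
    rw [hβ, norm_mul, RCLike.norm_conj, sq]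
    exact mul_le_mul (hb.bound _ _) (hb.bound _ _) (norm_nonneg _) hM₀
  have hfβ : fderiv ℝ β ξ (e ξ) = starRingEnd ℂ (b ξ η) * fderiv ℝ (fun ξ => b ξ η') ξ (e ξ)
      + starRingEnd ℂ (fderiv ℝ (fun ξ => b ξ η) ξ (e ξ)) * b ξ η' := by
    have h1 := ((hb.contDiff η).differentiable one_ne_zero ξ).hasFDerivAt
    have h2 := ((hb.contDiff η').differentiable one_ne_zero ξ).hasFDerivAt
    have h1' := (Complex.conjCLE : ℂ →L[ℝ] ℂ).hasFDerivAt.comp ξ h1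
    have h3 := (h1'.mul h2).fderiv
    have h4 : fderiv ℝ β ξ = _ := h3
    rw [h4]
    simp [mul_comm]
  by_cases hz : b ξ η = 0 ∧ fderiv ℝ (fun ξ => b ξ η) ξ = 0
  · have h1 : β ξ = 0 := by simp [hβ, hz.1]
    rw [hI, hfβ, h1, hz.1, hz.2]; simp
  by_cases hz' : b ξ η' = 0 ∧ fderiv ℝ (fun ξ => b ξ η') ξ = 0
  · have h1 : β ξ = 0 := by simp [hβ, hz'.1]
    rw [hI, hfβ, h1, hz'.1, hz'.2]; simp
  have h2t : ∀ x : ℝ, ¬|x| ≤ 2 / t → 8 / 5 < t * |x| := fun x hx => by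
    rw [not_le, div_lt_iff₀ ht] at hx; linarith
  by_cases hv : |P.val ξ η| ≤ 2 / t
  swap
  · have : osc (P.val ξ η) = 0 := oscCutoff_eq_zero hφ ht (h2t _ hv)
    rw [hI, this]; simp
  by_cases hv' : |P.val ξ η'| ≤ 2 / t
  swap
  · have h1 : osc (P.val ξ η') = 0 := oscCutoff_eq_zero hφ ht (h2t _ hv')
    rw [hI, h1, hΨs _ (h2t _ hv'), deriv_eq_zero_of_support hΨs (h2t _ hv')]; simp
  obtain ⟨m1, m2, m3⟩ := hb.mem_of_ne_zero hz
  obtain ⟨-, m2', m3'⟩ := hb.mem_of_ne_zero hz'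
  have hmem : (ξ, η) ∈ levelSet P K κ t := ⟨m1, m2, m3, hv⟩
  have hmem' : (ξ, η') ∈ levelSet P K κ t := ⟨m1, m2', m3', hv'⟩
  rw [Set.indicator_of_mem hmem, Set.indicator_of_mem hmem', Pi.one_apply, Pi.one_apply, mul_one,
    mul_one, ← ofReal_norm]
  refine ENNReal.ofReal_le_ofReal ?_
  have hgl : g₀ ≤ |g ξ| := by
    have h1 : 1 / t ≤ κ * ‖η' - η‖ / 128 := htρ.trans (by gcongr)
    have h2 := P.abs_bracket_ge (ε := 1 / t) (h := η' - η) hκ m3 (by rw [mul_one_div]; exact hv)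
      (by rw [mul_one_div, add_sub_cancel]; exact hv') hh h1
    rw [add_sub_cancel] at h2
    refine le_trans ?_ h2
    rw [hg₀]; gcongr
  have hgsq : g₀ ^ 2 ≤ g ξ ^ 2 := by
    rw [← sq_abs (g ξ)]; gcongr
  have hden : 0 < g ξ ^ 2 + q := by positivity
  have hr1 : ‖((r (g ξ) : ℝ) : ℂ)‖ ≤ 1 / g₀ := by
    rw [Complex.norm_real, Real.norm_eq_abs, hr, abs_div, abs_of_pos hden,
      div_le_div_iff₀ hden hg₀0, one_mul]
    nlinarith [sq_abs (g ξ)]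
  have hr2 : ‖((1 - r (g ξ) * g ξ : ℝ) : ℂ)‖ ≤ δ := by
    have e1 : 1 - r (g ξ) * g ξ = q / (g ξ ^ 2 + q) := by
      rw [hr]; field_simp; ring
    rw [Complex.norm_real, Real.norm_eq_abs, e1, abs_of_pos (by positivity), div_le_iff₀ hden, hq]
    nlinarith
  have hDg : |fderiv ℝ g ξ (e ξ)| ≤ 16 := by
    have h1 := (fderiv ℝ g ξ).le_of_opNorm_le (P.norm_fderiv_bracket_le η η' ξ) (e ξ)
    have h2 : ‖e ξ‖ ≤ 2 := by rw [he, norm_perp]; exact P.norm_gradLeft_le ξ η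
    rw [Real.norm_eq_abs] at h1
    linarith
  have hr3 : ‖(((q - g ξ ^ 2) / (g ξ ^ 2 + q) ^ 2 * fderiv ℝ g ξ (e ξ) : ℝ) : ℂ)‖
      ≤ 1 / g₀ ^ 2 * 16 := by
    rw [Complex.norm_real, Real.norm_eq_abs, abs_mul]
    gcongr
    rw [abs_div, abs_of_pos (by positivity : 0 < (g ξ ^ 2 + q) ^ 2),
      div_le_div_iff₀ (by positivity) (by positivity), one_mul]
    have h1 : |q - g ξ ^ 2| ≤ g ξ ^ 2 + q := by
      rw [abs_le]; constructor <;> nlinarith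
    have h2 : g₀ ^ 2 ≤ g ξ ^ 2 + q := by linarith
    calc |q - g ξ ^ 2| * g₀ ^ 2 ≤ (g ξ ^ 2 + q) * (g ξ ^ 2 + q) := by gcongr
      _ = _ := by ring
  have hDβ : ‖fderiv ℝ β ξ (e ξ)‖ ≤ 4 * (M₀ * M₁) := by
    have h2 : ‖e ξ‖ ≤ 2 := by rw [he, norm_perp]; exact P.norm_gradLeft_le ξ η
    have h3 : ∀ η, ‖fderiv ℝ (fun ξ => b ξ η) ξ (e ξ)‖ ≤ M₁ * 2 := fun η =>
      ((fderiv ℝ (fun ξ => b ξ η) ξ).le_of_opNorm_le (hb.bound_fderiv ξ η) (e ξ)).trans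
        (by gcongr)
    rw [hfβ]
    refine (norm_add_le _ _).trans ?_
    rw [norm_mul, norm_mul, RCLike.norm_conj, RCLike.norm_conj]
    have t1 := mul_le_mul (hb.bound ξ η) (h3 η') (norm_nonneg _) hM₀
    have t2 := mul_le_mul (h3 η) (hb.bound ξ η') (norm_nonneg _) (by positivity)
    linarith
  have hdΨ : ‖deriv Ψ (P.val ξ η')‖ ≤ C + 1 := by
    have h1 := hΨd (P.val ξ η')
    have h2 := norm_sub_norm_le (deriv Ψ (P.val ξ η')) (osc (P.val ξ η'))
    rw [norm_sub_rev] at h2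
    have h3 : C * δ ≤ C := mul_le_of_le_one_right hC0 hδ1
    linarith [hosc1 (P.val ξ η')]
  have hoc : ‖starRingEnd ℂ (osc (P.val ξ η))‖ ≤ 1 := by
    rw [RCLike.norm_conj]; exact hosc1 _
  rw [hI]
  refine (norm_remainder_le hβb hoc (hΨd _) hr2 hdΨ hDβ hr1 hr3 (hΨb _)).trans_eq ?_
  simp only [hg₀]
  field_simp
  ring

/-! ### The `T* T` estimate where the curvature is bounded below -/

/-- Within a small disc, the level set `|Φ(ξ, ·)| ≤ 2/t` is a strip of width `O(1/(κt))`: where the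
curvature is at least `κ`, so is the gradient in `η`. -/
lemma volume_levelSet_inter_closedBall_le (P : PhaseData) {K κ t ρ : ℝ} (hκ : 0 < κ) (ht : 0 < t)
    (hρκ : ρ ≤ κ / 64) (ξ η : Plane) :
    volume (Metric.closedBall η ρ ∩ {η' | (ξ, η') ∈ levelSet P K κ t}) ≤
      ENNReal.ofReal (2 * ρ) * ENNReal.ofReal (16 / (κ * t)) := by
  set E := Metric.closedBall η ρ ∩ {η' | (ξ, η') ∈ levelSet P K κ t}
  have hE : MeasurableSet E := Metric.isClosed_closedBall.measurableSet.inter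
    (measurable_prodMk_left (measurableSet_levelSet P K κ t))
  rcases E.eq_empty_or_nonempty with h | ⟨η₀, hη₀⟩
  · rw [h]; simp
  set q := P.gradRight ξ η₀
  have hqκ : κ / 2 ≤ ‖q‖ := by linarith [P.abs_curvature_le ξ η₀, hη₀.2.2.2.1]
  have hq0 : 0 < ‖q‖ := by linarith
  set n := ‖q‖⁻¹ • q with hn
  have hn1 : ‖n‖ = 1 := by
    rw [hn, norm_smul, norm_inv, norm_norm, inv_mul_cancel₀ hq0.ne']
  have hqn : ⟪q, n⟫ = ‖q‖ := by
    rw [hn, inner_smul_right, real_inner_self_eq_norm_sq]; field_simp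
  have hdist : ∀ x ∈ E, ∀ y ∈ E, ‖x - y‖ ≤ 2 * ρ := fun x hx y hy => by
    have h1 := mem_closedBall_iff_norm.1 hx.1
    have h2 := mem_closedBall_iff_norm'.1 hy.1
    have := norm_add_le (x - η) (η - y)
    rw [sub_add_sub_cancel] at this
    linarith
  refine volume_le_of_slices hE hn1 Set.inter_subset_left fun x hx τ hτ hxτ => ?_
  have h1 := P.abs_val_taylor_right ξ x (τ • n)
  have hτn : ‖τ • n‖ = τ := by rw [norm_smul, hn1, mul_one, Real.norm_eq_abs, abs_of_nonneg hτ]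
  have hτρ : τ ≤ 2 * ρ := by
    have := hdist _ hxτ _ hx
    rwa [add_sub_cancel_left, hτn] at this
  have h2 : ⟪P.gradRight ξ x, n⟫ ≥ κ / 2 - κ / 16 := by
    have h3 := P.norm_gradRight_sub_le ξ η₀ x
    have h4 := real_inner_le_norm (q - P.gradRight ξ x) n
    rw [hn1, mul_one, inner_sub_left, hqn] at h4
    have h5 := hdist _ hη₀ _ hx
    linarith
  rw [inner_smul_right, hτn] at h1
  have h3 := hx.2.2.2.2
  have h4 := hxτ.2.2.2.2
  dsimp only at h3 h4
  have h5 : τ * (κ / 2 - κ / 16) ≤ τ * ⟪P.gradRight ξ x, n⟫ := by gcongr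
  have h6 : 2 * τ ^ 2 ≤ τ * (κ / 16) := by nlinarith
  have h7 : τ * (κ / 4) ≤ 4 / t := by
    have e : 4 / t = 2 / t + 2 / t := by ring
    have := mul_nonneg hτ hκ.le
    linarith [abs_le.1 h1, (abs_le.1 h1).1, (abs_le.1 h3).1, (abs_le.1 h4).2]
  rw [le_div_iff₀ ht] at h7
  rw [le_div_iff₀ (by positivity)]
  linarith

/-- The integral over `η' ∈ S` and `ξ` of the indicator that both `(ξ, η)` and `(ξ, η')` lie in `W`
is bounded by integration in `η'` first. -/
lemma lintegral_indicator_mul_indicator_le {W : Set (Plane × Plane)} (hW : MeasurableSet W)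
    {S : Set Plane} (η : Plane) (c : ENNReal) {X Y : ENNReal}
    (hX : volume {ξ | (ξ, η) ∈ W} ≤ X) (hY : ∀ ξ, volume (S ∩ {η' | (ξ, η') ∈ W}) ≤ Y) :
    ∫⁻ η' in S, ∫⁻ ξ, c * (W.indicator 1 (ξ, η) * W.indicator 1 (ξ, η')) ≤ c * (X * Y) := by
  have hm1 : Measurable fun ξ => W.indicator (1 : Plane × Plane → ENNReal) (ξ, η) :=
    (measurable_one.indicator hW).comp measurable_prodMk_right
  have hm : Measurable fun p : Plane × Plane =>
      c * (W.indicator (1 : Plane × Plane → ENNReal) (p.2, η) * W.indicator 1 (p.2, p.1)) :=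
    ((hm1.comp measurable_snd).mul ((measurable_one.indicator hW).comp measurable_swap)).const_mul c
  rw [lintegral_lintegral_swap hm.aemeasurable]
  have e1 : ∀ ξ, ∫⁻ η' in S, W.indicator (1 : Plane × Plane → ENNReal) (ξ, η')
      = volume (S ∩ {η' | (ξ, η') ∈ W}) := by
    intro ξ
    have hs : MeasurableSet {η' | (ξ, η') ∈ W} := measurable_prodMk_left hW
    have : (fun η' => W.indicator (1 : Plane × Plane → ENNReal) (ξ, η'))
        = {η' | (ξ, η') ∈ W}.indicator 1 := rfl
    rw [this, lintegral_indicator_one hs, Measure.restrict_apply hs, Set.inter_comm]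
  calc ∫⁻ ξ, ∫⁻ η' in S, c * (W.indicator 1 (ξ, η) * W.indicator 1 (ξ, η'))
      = ∫⁻ ξ, c * (W.indicator 1 (ξ, η) * volume (S ∩ {η' | (ξ, η') ∈ W})) := by
        refine lintegral_congr fun ξ => ?_
        have hm2 : Measurable fun η' => W.indicator (1 : Plane × Plane → ENNReal) (ξ, η') :=
          (measurable_one.indicator hW).comp measurable_prodMk_left
        rw [lintegral_const_mul _ (hm2.const_mul _), lintegral_const_mul _ hm2, e1]
    _ ≤ ∫⁻ ξ, c * (W.indicator 1 (ξ, η) * Y) := by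
        gcongr with ξ; exact hY ξ
    _ = c * (volume {ξ | (ξ, η) ∈ W} * Y) := by
        rw [lintegral_const_mul _ (hm1.mul_const _), lintegral_mul_const _ hm1]
        congr 2
        exact lintegral_indicator_one (measurable_prodMk_right hW)
    _ ≤ _ := by gcongr

/-- Restriction of the operator to functions supported in `Q` restricts the kernel of `T* T`. -/
lemma gram_restrict_le (k : Plane → Plane → ℂ) (Q : Set Plane) (η η' : Plane) :
    ‖gram (fun ξ η => Q.indicator (k ξ) η) η η'‖ₑ ≤ Q.indicator (fun η' => ‖gram k η η'‖ₑ) η' := by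
  by_cases h' : η' ∈ Q
  · by_cases h : η ∈ Q
    · simp [gram, h, h']
    · simp [gram, h]
  · simp [gram, h']

/-- `T* T` estimate for the part of the operator acting on functions supported in a small cell. -/
lemma l2Bound_cell {P : PhaseData} {φ : ℝ → ℝ} (hφ : IsCutoff φ) {s t K κ M₀ M₁ : ℝ}
    {b : Plane → Plane → ℂ} (hb : IsAmplitude P b K κ M₀ M₁) (ht : 0 < t) (hs : s ≠ 0)
    {C δ : ℝ} (hδ : 0 < δ) (hδ1 : δ ≤ 1) {Ψ : ℝ → ℂ} (hΨ : ContDiff ℝ ∞ Ψ)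
    (hΨb : ∀ x, ‖Ψ x‖ ≤ C / |s|) (hΨs : ∀ x, 8 / 5 < t * |x| → Ψ x = 0)
    (hΨd : ∀ x, ‖oscCutoff φ s t x - deriv Ψ x‖ ≤ C * δ)
    {ρ : ℝ} (hκ : 0 < κ) (hρ : 0 < ρ) (hρκ : ρ ≤ κ / 64) (htρ : 1 / t ≤ κ * ρ / 128)
    {X Y : ENNReal} (hX : ∀ η, volume {ξ | (ξ, η) ∈ levelSet P K κ t} ≤ X)
    (hY : ∀ ξ, volume {η | (ξ, η) ∈ levelSet P K κ t} ≤ Y)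
    {Q : Set Plane} (hQ : MeasurableSet Q) (hQd : ∀ x ∈ Q, ∀ y ∈ Q, ‖x - y‖ ≤ κ / 64) :
    L2Bound (fun ξ η => Q.indicator (oscKernel P φ s t b ξ) η)
      (ENNReal.ofReal (M₀ ^ 2) * (X * (ENNReal.ofReal (2 * ρ) * ENNReal.ofReal (16 / (κ * t))))
      + ENNReal.ofReal (M₀ ^ 2 * ((2 * C + 1) * δ) +
        (64 * (M₀ * M₁) / (κ * ρ) + 4096 * M₀ ^ 2 / (κ * ρ) ^ 2) * (C / |s|)) * (X * Y)) := by
  refine ((isKernel_oscKernel (s := s) (t := t) hφ hb).restrict hQ).l2Bound_of_gram fun η => ?_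
  set W := levelSet P K κ t
  have hW : MeasurableSet W := measurableSet_levelSet P K κ t
  by_cases hη : η ∈ Q
  swap
  · have : ∀ η', gram (fun ξ η => Q.indicator (oscKernel P φ s t b ξ) η) η η' = 0 := fun η' => by
      simp [gram, hη]
    simp [this]
  have hBm : MeasurableSet (Metric.closedBall η ρ) := Metric.isClosed_closedBall.measurableSet
  rw [← lintegral_add_compl _ hBm]
  refine add_le_add ?_ ?_
  -- near the diagonal: the strip width bounds the measure of the set of `η'`
  · refine le_trans (lintegral_mono fun η' => (gram_restrict_le _ Q η η').trans
      ((Set.indicator_le_self _ _ _).trans (enorm_gram_le hφ hb ht η η'))) ?_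
    exact lintegral_indicator_mul_indicator_le hW η _ (hX η) fun ξ =>
      volume_levelSet_inter_closedBall_le P hκ ht hρκ ξ η
  -- away from the diagonal: integration by parts
  · refine le_trans (setLIntegral_mono' hBm.compl fun η' hη' => (gram_restrict_le _ Q η η').trans
      (?_ : _ ≤ ∫⁻ ξ, ENNReal.ofReal (M₀ ^ 2 * ((2 * C + 1) * δ) +
        (64 * (M₀ * M₁) / (κ * ρ) + 4096 * M₀ ^ 2 / (κ * ρ) ^ 2) * (C / |s|)) *
          (W.indicator 1 (ξ, η) * W.indicator 1 (ξ, η')))) ?_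
    · by_cases h' : η' ∈ Q
      · rw [Set.indicator_of_mem h']
        refine enorm_gram_far_le hφ hb ht hs hδ hδ1 hΨ hΨb hΨs hΨd hκ hρ ?_ (hQd _ h' _ hη) htρ
        rw [Set.mem_compl_iff, mem_closedBall_iff_norm, not_le] at hη'
        exact hη'.le
      · rw [Set.indicator_of_notMem h']; exact bot_le
    · exact lintegral_indicator_mul_indicator_le hW η _ (hX η) fun ξ =>
        (measure_mono Set.inter_subset_right).trans (hY ξ)

/-- A bound on every small cell gives a bound on the whole, by the triangle inequality. -/
lemma IsKernel.l2Bound_of_cells {k : Plane → Plane → ℂ} {M R : ℝ} (hk : IsKernel k M R) {r : ℝ}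
    (hr : 0 < r) (hrR : r ≤ R) {B : ENNReal}
    (h : ∀ Q : Set Plane, MeasurableSet Q → (∀ x ∈ Q, ∀ y ∈ Q, ‖x - y‖ ≤ 2 * r) →
      L2Bound (fun ξ η => Q.indicator (k ξ) η) B) :
    L2Bound k (ENNReal.ofReal ((5 * R / r) ^ 4) * B) := by
  set cell : ℤ × ℤ → Set Plane := fun i => {η | ⌊η 0 / r⌋ = i.1 ∧ ⌊η 1 / r⌋ = i.2}
  set n : ℤ := ⌈R / r⌉
  set s : Finset (ℤ × ℤ) := Finset.Icc (-n) n ×ˢ Finset.Icc (-n) n with hs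
  have hmeas : ∀ i, MeasurableSet (cell i) := fun i => by
    have hj : ∀ j : Fin 2, Measurable fun η : Plane => ⌊η j / r⌋ := fun j =>
      Int.measurable_floor.comp (by fun_prop)
    exact (hj 0 (measurableSet_singleton i.1)).inter (hj 1 (measurableSet_singleton i.2))
  have hdiam : ∀ i, ∀ x ∈ cell i, ∀ y ∈ cell i, ‖x - y‖ ≤ 2 * r := by
    intro i x hx y hy
    have hj : ∀ a b : ℝ, ⌊a / r⌋ = ⌊b / r⌋ → (a - b) ^ 2 ≤ r ^ 2 := by
      intro a b hab
      have h1 := Int.abs_sub_lt_one_of_floor_eq_floor hab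
      rw [← sub_div, abs_div, abs_of_pos hr, div_lt_one hr] at h1
      rw [← sq_abs]
      gcongr
    have h0 := hj _ _ (hx.1.trans hy.1.symm)
    have h1 := hj _ _ (hx.2.trans hy.2.symm)
    refine le_of_sq_le_sq ?_ (by positivity)
    rw [EuclideanSpace.norm_sq_eq, Fin.sum_univ_two]
    simp only [PiLp.sub_apply, Real.norm_eq_abs, sq_abs]
    nlinarith
  have hsum : ∀ ξ η, k ξ η = ∑ i ∈ s, (cell i).indicator (k ξ) η := by
    intro ξ η
    by_cases hz : k ξ η = 0
    · rw [hz, Finset.sum_eq_zero]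
      intro i _
      by_cases hi : η ∈ cell i <;> simp [hi, hz]
    have hη := hk.right_mem _ _ hz
    rw [Finset.sum_eq_single (⌊η 0 / r⌋, ⌊η 1 / r⌋)]
    · rw [Set.indicator_of_mem]; exact ⟨rfl, rfl⟩
    · intro i _ hi
      rw [Set.indicator_of_notMem]
      rintro ⟨h1, h2⟩
      exact hi (Prod.ext h1.symm h2.symm)
    · intro hi
      exfalso
      apply hi
      rw [mem_ball_zero_iff] at hη
      have hj : ∀ j : Fin 2, ⌊η j / r⌋ ∈ Finset.Icc (-n) n := by
        intro j
        have h1 : |η j| ≤ R := by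
          have := PiLp.norm_apply_le η j
          rw [Real.norm_eq_abs] at this
          linarith
        rw [abs_le] at h1
        have h2 : R / r ≤ n := Int.le_ceil _
        have h3 : η j / r ≤ R / r := by gcongr; exact h1.2
        have h4 : -(R / r) ≤ η j / r := by rw [← neg_div]; gcongr; exact h1.1
        rw [Finset.mem_Icc]
        constructor
        · rw [Int.le_floor]; push_cast; linarith
        · have := (Int.floor_le (η j / r)).trans (h3.trans h2)
          exact Int.cast_le.1 this
      exact Finset.mk_mem_product (hj 0) (hj 1)
  have hk' : k = fun ξ η => ∑ i ∈ s, (cell i).indicator (k ξ) η := by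
    ext ξ η; exact hsum ξ η
  rw [hk']
  refine (L2Bound.sum (M := M) (R := R) (fun i _ => hk.restrict (hmeas i))
    (fun i _ => h _ (hmeas i) (hdiam i))).mono ?_
  gcongr
  have hRr : 1 ≤ R / r := (one_le_div hr).2 hrR
  have hn0 : 0 ≤ n := by
    have : (0 : ℝ) ≤ n := by linarith [Int.le_ceil (R / r)]
    exact_mod_cast this
  have hcard : (s.card : ℝ) ≤ (5 * R / r) ^ 2 := by
    rw [hs, Finset.card_product, Int.card_Icc]
    have h1 : (((n + 1 - -n).toNat : ℕ) : ℝ) ≤ 5 * R / r := by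
      have h2 : (((n + 1 - -n).toNat : ℕ) : ℤ) = 2 * n + 1 := by
        rw [Int.toNat_of_nonneg (by linarith)]; ring
      have h3 : (((n + 1 - -n).toNat : ℕ) : ℝ) = 2 * n + 1 := by exact_mod_cast h2
      have h4 := Int.ceil_lt_add_one (R / r)
      rw [h3, mul_div_assoc]
      linarith
    push_cast
    rw [sq]
    have h5 : 0 ≤ 5 * R / r := (Nat.cast_nonneg _).trans h1
    gcongr
  calc (s.card : ENNReal) ^ 2 = ENNReal.ofReal ((s.card : ℝ) ^ 2) := by
        rw [ENNReal.ofReal_pow (Nat.cast_nonneg _), ENNReal.ofReal_natCast]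
    _ ≤ _ := by
        refine ENNReal.ofReal_le_ofReal ?_
        calc (s.card : ℝ) ^ 2 ≤ ((5 * R / r) ^ 2) ^ 2 :=
              pow_le_pow_left₀ (Nat.cast_nonneg _) hcard 2
          _ = _ := by ring

/-- The `L²` bound where the rotational curvature is at least `κ`, in terms of the measures of the
level sets. The first term is the contribution of the pairs `η`, `η'` at distance at most `ρ`,
the second one the contribution of the other pairs. -/
lemma exists_l2Bound_oscKernel (N : ℕ) {φ : ℝ → ℝ} (hφ : IsCutoff φ) :
    ∃ C : ℝ, 0 ≤ C ∧ ∀ (P : PhaseData) (b : Plane → Plane → ℂ) (s t K κ M₀ M₁ ρ : ℝ)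
      (X Y : ENNReal), IsAmplitude P b K κ M₀ M₁ → 0 < t → t ≤ |s| → 0 < κ → κ ≤ K → 0 < ρ →
      ρ ≤ κ / 64 → 1 / t ≤ κ * ρ / 128 →
      (∀ η, volume {ξ | (ξ, η) ∈ levelSet P K κ t} ≤ X) →
      (∀ ξ, volume {η | (ξ, η) ∈ levelSet P K κ t} ≤ Y) →
      L2Bound (oscKernel P φ s t b) (ENNReal.ofReal ((640 * K / κ) ^ 4) *
        (ENNReal.ofReal (M₀ ^ 2) * (X * (ENNReal.ofReal (2 * ρ) * ENNReal.ofReal (16 / (κ * t))))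
        + ENNReal.ofReal (M₀ ^ 2 * ((2 * C + 1) * (t / |s|) ^ N) +
          (64 * (M₀ * M₁) / (κ * ρ) + 4096 * M₀ ^ 2 / (κ * ρ) ^ 2) * (C / |s|)) * (X * Y))) := by
  obtain ⟨C, hC0, hC⟩ := exists_antideriv_oscCutoff N φ hφ.smooth hφ.support_subset
  refine ⟨C, hC0, fun P b s t K κ M₀ M₁ ρ X Y hb ht hts hκ hκK hρ hρκ htρ hX hY => ?_⟩
  have hs : 0 < |s| := ht.trans_le hts
  have hst : t / |s| ≤ 1 := (div_le_one hs).2 hts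
  obtain ⟨Ψ, hΨ, hΨb, hΨs, hΨd⟩ := hC s t ht (abs_pos.1 hs) (by linarith)
  -- cells of side `κ/128` have diameter at most `κ/64`, as required by the bracket estimate
  have e : 640 * K / κ = 5 * K / (κ / 128) := by rw [div_div_eq_mul_div]; ring
  rw [e]
  refine (isKernel_oscKernel (s := s) (t := t) hφ hb).l2Bound_of_cells (by positivity)
    (by linarith) fun Q hQ hQd => ?_
  exact l2Bound_cell hφ hb ht (abs_pos.1 hs) (pow_pos (by positivity) N)
    (pow_le_one₀ (by positivity) hst) hΨ hΨb hΨs hΨd hκ hρ hρκ htρ hX hY hQ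
    fun x hx y hy => (hQd x hx y hy).trans (by linarith)

/-! ### The curvature on the resonant set as a polynomial in the energies -/

/-- The curvature of a phase as a polynomial in the signed energies `x`, `y`, `z` of `ξ`, `ξ - η`
and `η`, up to a normalizing factor; see `PhaseData.curvature_mul`. -/
def curvPoly (c₁ c₂ c₃ x y z : ℝ) : ℝ :=
  c₁ * c₃ * (y * y) * (((x * x - 1) / c₁ + (z * z - 1) / c₃ - (y * y - 1) / c₂) / 2)
    - c₁ * c₂ * (y * z) * (((x * x - 1) / c₁ + (y * y - 1) / c₂ - (z * z - 1) / c₃) / 2)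
    + c₂ * c₃ * (x * y) * (((x * x - 1) / c₁ - (y * y - 1) / c₂ - (z * z - 1) / c₃) / 2)
    - c₂ * c₂ * (x * z) * ((y * y - 1) / c₂)
    - c₁ * c₂ * c₃ * ((x * x - 1) / c₁ * ((z * z - 1) / c₃)
      - ((x * x - 1) / c₁ + (z * z - 1) / c₃ - (y * y - 1) / c₂) / 2
        * (((x * x - 1) / c₁ + (z * z - 1) / c₃ - (y * y - 1) / c₂) / 2))

/-- The inner products of `ξ`, `ξ - η`, `η` that occur in the curvature are determined by the three
lengths, hence by the energies. -/
lemma PhaseData.curvature_mul (P : PhaseData) (ξ η : Plane) :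
    P.curvature ξ η * ((P.e₁ * energy P.c₁ ξ) * energy P.c₂ (ξ - η) ^ 3 * (P.e₃ * energy P.c₃ η))
      = P.c₂ * curvPoly P.c₁ P.c₂ P.c₃ (P.e₁ * energy P.c₁ ξ) (P.e₂ * energy P.c₂ (ξ - η))
        (P.e₃ * energy P.c₃ η) := by
  have s1 : P.e₁ ^ 2 = 1 := by rw [← sq_abs, P.sign₁, one_pow]
  have s2 : P.e₂ ^ 2 = 1 := by rw [← sq_abs, P.sign₂, one_pow]
  have s3 : P.e₃ ^ 2 = 1 := by rw [← sq_abs, P.sign₃, one_pow]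
  have n1 : P.e₁ ≠ 0 := fun h => by rw [h] at s1; norm_num at s1
  have n2 : P.e₂ ≠ 0 := fun h => by rw [h] at s2; norm_num at s2
  have n3 : P.e₃ ≠ 0 := fun h => by rw [h] at s3; norm_num at s3
  have E1 := (energy_pos P.pos₁.le ξ).ne'
  have E2 := (energy_pos P.pos₂.le (ξ - η)).ne'
  have E3 := (energy_pos P.pos₃.le η).ne'
  have q1 := energy_sq P.pos₁.le ξ
  have q2 := energy_sq P.pos₂.le (ξ - η)
  have q3 := energy_sq P.pos₃.le η
  have nsq : ∀ v : Plane, ‖v‖ ^ 2 = v 0 * v 0 + v 1 * v 1 := fun v => by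
    rw [← real_inner_self_eq_norm_sq, inner_plane]
  rw [nsq] at q1 q2 q3
  set x := P.e₁ * energy P.c₁ ξ with hx
  set y := P.e₂ * energy P.c₂ (ξ - η) with hy
  set z := P.e₃ * energy P.c₃ η with hz
  have hx0 : x ≠ 0 := mul_ne_zero n1 E1
  have hy0 : y ≠ 0 := mul_ne_zero n2 E2
  have hz0 : z ≠ 0 := mul_ne_zero n3 E3
  have X : (x * x - 1) / P.c₁ = ξ 0 * ξ 0 + ξ 1 * ξ 1 := by
    rw [div_eq_iff P.pos₁.ne', hx]
    linear_combination energy P.c₁ ξ ^ 2 * s1 + q1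
  have Y : (y * y - 1) / P.c₂ = (ξ 0 - η 0) * (ξ 0 - η 0) + (ξ 1 - η 1) * (ξ 1 - η 1) := by
    simp only [PiLp.sub_apply] at q2
    rw [div_eq_iff P.pos₂.ne', hy]
    linear_combination energy P.c₂ (ξ - η) ^ 2 * s2 + q2
  have Z : (z * z - 1) / P.c₃ = η 0 * η 0 + η 1 * η 1 := by
    rw [div_eq_iff P.pos₃.ne', hz]
    linear_combination energy P.c₃ η ^ 2 * s3 + q3
  have hp : P.gradLeft ξ η = (P.c₁ / x) • ξ + (P.c₂ / y) • (ξ - η) := by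
    rw [PhaseData.gradLeft, velocity, velocity, smul_smul, smul_smul]
    congr 2
    · rw [hx]; field_simp; linear_combination P.c₁ * s1
    · rw [hy]; field_simp; linear_combination P.c₂ * s2
  have hq : P.gradRight ξ η = (P.c₃ / z) • η - (P.c₂ / y) • (ξ - η) := by
    rw [PhaseData.gradRight, velocity, velocity, smul_smul, smul_smul]
    congr 2
    · rw [hz]; field_simp; linear_combination P.c₃ * s3
    · rw [hy]; field_simp; linear_combination P.c₂ * s2
  have hE : energy P.c₂ (ξ - η) ^ 2 = y ^ 2 := by
    rw [hy]; linear_combination (-energy P.c₂ (ξ - η) ^ 2) * s2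
  rw [curvPoly, X, Y, Z, PhaseData.curvature, hessian_apply, hp, hq, hE]
  generalize energy P.c₂ (ξ - η) = E at *
  have hE3 : E ^ 3 = E * y ^ 2 := by rw [← hE]; ring
  rw [hE3]
  simp only [inner_plane, perp_zero_coord, perp_one_coord, PiLp.add_apply, PiLp.sub_apply,
    PiLp.smul_apply, smul_eq_mul]
  field_simp
  ring

lemma curvPoly_neg (c₁ c₂ c₃ x y z : ℝ) :
    curvPoly c₁ c₂ c₃ (-x) (-y) (-z) = curvPoly c₁ c₂ c₃ x y z := by
  simp only [curvPoly, neg_mul_neg]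

/-- Functions of three variables which, on the cube `[-M, M]³`, are `O(Mⁿ)` and have Lipschitz
constant `O(Mⁿ)` in the second variable. -/
def Tame (n : ℕ) (f : ℝ → ℝ → ℝ → ℝ) : Prop :=
  ∃ C : ℝ, 0 ≤ C ∧ ∀ M x y y' z : ℝ, 1 ≤ M → |x| ≤ M → |y| ≤ M → |y'| ≤ M → |z| ≤ M →
    |f x y z| ≤ C * M ^ n ∧ |f x y z - f x y' z| ≤ C * M ^ n * |y - y'|

namespace Tame

lemma const (c : ℝ) : Tame 0 fun _ _ _ => c :=
  ⟨|c|, abs_nonneg c, fun M x y y' z _ _ _ _ _ => by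
    simp only [pow_zero, mul_one, sub_self, abs_zero, le_refl, true_and]; positivity⟩

lemma fst : Tame 1 fun x _ _ => x :=
  ⟨1, one_pos.le, fun M x y y' z hM hx _ _ _ => by
    simp only [pow_one, one_mul, sub_self, abs_zero]
    exact ⟨hx, by positivity⟩⟩

lemma snd : Tame 1 fun _ y _ => y :=
  ⟨1, one_pos.le, fun M x y y' z hM _ hy _ _ => by
    simp only [pow_one, one_mul]
    exact ⟨hy, le_mul_of_one_le_left (abs_nonneg _) hM⟩⟩

lemma thd : Tame 1 fun _ _ z => z :=
  ⟨1, one_pos.le, fun M x y y' z hM _ _ _ hz => by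
    simp only [pow_one, one_mul, sub_self, abs_zero]
    exact ⟨hz, by positivity⟩⟩

variable {n m : ℕ} {f g : ℝ → ℝ → ℝ → ℝ}

lemma mono (hf : Tame n f) (h : n ≤ m) : Tame m f := by
  obtain ⟨C, hC, H⟩ := hf
  refine ⟨C, hC, fun M x y y' z hM hx hy hy' hz => ?_⟩
  obtain ⟨h1, h2⟩ := H M x y y' z hM hx hy hy' hz
  have hp : M ^ n ≤ M ^ m := pow_le_pow_right₀ hM h
  exact ⟨h1.trans (by gcongr), h2.trans (by gcongr)⟩

lemma add (hf : Tame n f) (hg : Tame n g) : Tame n fun x y z => f x y z + g x y z := by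
  obtain ⟨C, hC, H⟩ := hf
  obtain ⟨D, hD, G⟩ := hg
  refine ⟨C + D, by positivity, fun M x y y' z hM hx hy hy' hz => ?_⟩
  obtain ⟨h1, h2⟩ := H M x y y' z hM hx hy hy' hz
  obtain ⟨g1, g2⟩ := G M x y y' z hM hx hy hy' hz
  constructor
  · refine (abs_add_le _ _).trans ?_
    linarith
  · have e : f x y z + g x y z - (f x y' z + g x y' z)
        = (f x y z - f x y' z) + (g x y z - g x y' z) := by ring
    rw [e]
    refine (abs_add_le _ _).trans ?_
    linarith

lemma mul (hf : Tame n f) (hg : Tame m g) : Tame (n + m) fun x y z => f x y z * g x y z := by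
  obtain ⟨C, hC, H⟩ := hf
  obtain ⟨D, hD, G⟩ := hg
  refine ⟨2 * (C * D), by positivity, fun M x y y' z hM hx hy hy' hz => ?_⟩
  obtain ⟨h1, h2⟩ := H M x y y' z hM hx hy hy' hz
  obtain ⟨g1, g2⟩ := G M x y y' z hM hx hy hy' hz
  obtain ⟨h1', -⟩ := H M x y' y z hM hx hy' hy hz
  constructor
  · rw [abs_mul]
    calc |f x y z| * |g x y z| ≤ C * M ^ n * (D * M ^ m) := by gcongr
      _ = C * D * M ^ (n + m) := by ring
      _ ≤ 2 * (C * D) * M ^ (n + m) := by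
        have : 0 ≤ C * D * M ^ (n + m) := by positivity
        linarith
  · have e : f x y z * g x y z - f x y' z * g x y' z
        = (f x y z - f x y' z) * g x y z + f x y' z * (g x y z - g x y' z) := by ring
    rw [e]
    refine (abs_add_le _ _).trans ?_
    rw [abs_mul, abs_mul]
    calc |f x y z - f x y' z| * |g x y z| + |f x y' z| * |g x y z - g x y' z|
        ≤ C * M ^ n * |y - y'| * (D * M ^ m) + C * M ^ n * (D * M ^ m * |y - y'|) := by gcongr
      _ = _ := by ring

lemma const_mul (c : ℝ) (hf : Tame n f) : Tame n fun x y z => c * f x y z := by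
  simpa using (const c).mul hf

lemma div_const (hf : Tame n f) (c : ℝ) : Tame n fun x y z => f x y z / c := by
  simpa [div_eq_inv_mul] using hf.const_mul c⁻¹

lemma sub (hf : Tame n f) (hg : Tame n g) : Tame n fun x y z => f x y z - g x y z := by
  simpa [sub_eq_add_neg] using hf.add (hg.const_mul (-1))

end Tame

lemma tame_curvPoly (c₁ c₂ c₃ : ℝ) : Tame 4 (curvPoly c₁ c₂ c₃) := by
  have o : Tame 2 fun _ _ _ => (1 : ℝ) := (Tame.const 1).mono (by norm_num)
  have X := ((Tame.fst.mul Tame.fst).sub o).div_const c₁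
  have Y := ((Tame.snd.mul Tame.snd).sub o).div_const c₂
  have Z := ((Tame.thd.mul Tame.thd).sub o).div_const c₃
  have w := ((X.add Z).sub Y).div_const 2
  exact (((((Tame.snd.mul Tame.snd).const_mul (c₁ * c₃)).mul w).sub
    (((Tame.snd.mul Tame.thd).const_mul (c₁ * c₂)).mul (((X.add Y).sub Z).div_const 2))).add
    (((Tame.fst.mul Tame.snd).const_mul (c₂ * c₃)).mul (((X.sub Y).sub Z).div_const 2))).sub
    (((Tame.fst.mul Tame.thd).const_mul (c₂ * c₂)).mul Y) |>.sub
    (((X.mul Z).sub (w.mul w)).const_mul (c₁ * c₂ * c₃))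

/-!
On the resonant set, where `x + y + z = 0`, the curvature polynomial becomes a polynomial in two of
the energies. The words `left` and `middle` say which of the vectors `ξ`, `ξ - η` has the sign that
differs from the two others; its coefficient is `1`. The letters `e` (coefficient `d`) and `b`
(coefficient `1`) give the types of the remaining vectors: of `η` and `ξ - η` for `left`, of `ξ` and
`η` for `middle`.
-/

section Scalar

variable {d : ℝ}

lemma curvPoly_left_ee (hd : d ≠ 0) (a b : ℝ) :
    -4 * curvPoly 1 d d a (-(a - b)) (-b) = ((1 - d) ^ 2 * a ^ 4 + d * (4 - d))
      - 2 * (1 - d) * b * ((1 - d) * a ^ 3 + d * a) := by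
  simp only [curvPoly]; field_simp; ring

lemma curvPoly_left_be (hd : d ≠ 0) (b c : ℝ) :
    -4 * d * curvPoly 1 d 1 (b + c) (-c) (-b) =
      (1 - d) ^ 2 * c ^ 4 - 4 * d * (1 - d) * b * (b + c) + 4 * d - 1 := by
  simp only [curvPoly]; field_simp; ring

lemma curvPoly_left_eb (hd : d ≠ 0) (b c : ℝ) :
    -4 * d * curvPoly 1 1 d (b + c) (-c) (-b) =
      4 * d - ((1 - d) * b ^ 2 - 1) * ((1 - d) * b ^ 2 - 1 + 2 * (1 - d) * b * c) := by
  simp only [curvPoly]; field_simp; ring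

lemma curvPoly_middle_ee (hd : d ≠ 0) (b c : ℝ) :
    -4 * curvPoly d 1 d (-b) (b + c) (-c) =
      (1 - d) ^ 2 * (b + c) ^ 4 - 4 * (1 - d) * b * c + d * (4 - d) := by
  simp only [curvPoly]; field_simp; ring

lemma curvPoly_middle_be (hd : d ≠ 0) (b c : ℝ) :
    -4 * d * curvPoly 1 1 d (-b) (b + c) (-c) =
      (1 - d) ^ 2 * c ^ 4 + 2 * b * (1 - d) ^ 2 * c ^ 3 - 2 * (1 - d) * b * c + 4 * d - 1 := by
  simp only [curvPoly]; field_simp; ring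

lemma curvPoly_middle_eb (hd : d ≠ 0) (b c : ℝ) :
    -4 * d * curvPoly d 1 1 (-c) (b + c) (-b) =
      (1 - d) ^ 2 * c ^ 4 + 2 * b * (1 - d) ^ 2 * c ^ 3 - 2 * (1 - d) * b * c + 4 * d - 1 := by
  simp only [curvPoly]; field_simp; ring

end Scalar

/-! ### Lower bounds for the curvature polynomial -/

section Scalar

variable {d ν δ M : ℝ} (hd : 0 < d) (hd1 : d < 1) (hM : 1 ≤ M) (hδ0 : 0 ≤ δ)
include hd hd1 hM hδ0

/-- For fixed `b`, the polynomial of `curvPoly_left_ee` is small only for `a` in a short interval: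
it vanishes when `b` equals a quotient of polynomials in `a` which is strictly increasing in the
range allowed by the resonance. -/
lemma abs_sub_le_of_ee {a a' b : ℝ} (ha : 1 ≤ a) (haM : a ≤ M) (ha' : 1 ≤ a') (haM' : a' ≤ M)
    (hδ : δ * M ^ 2 ≤ 1) (h : 4 - d - δ ≤ (1 - d) * a ^ 2) (h' : 4 - d - δ ≤ (1 - d) * a' ^ 2)
    (hV : |((1 - d) ^ 2 * a ^ 4 + d * (4 - d))
      - 2 * (1 - d) * b * ((1 - d) * a ^ 3 + d * a)| ≤ ν)
    (hV' : |((1 - d) ^ 2 * a' ^ 4 + d * (4 - d))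
      - 2 * (1 - d) * b * ((1 - d) * a' ^ 3 + d * a')| ≤ ν) :
    |a - a'| ≤ 2 * ν * M ^ 3 := by
  have hM2 : 1 ≤ M ^ 2 := one_le_pow₀ hM
  have hδ1 : δ ≤ 1 := by nlinarith
  set m := (1 - d) * a * a' with hm
  have hm0 : 0 ≤ m := mul_nonneg (mul_nonneg (by linarith) (by linarith)) (by linarith)
  have hs : 2 ≤ 4 - d - δ := by linarith
  have hms : 4 - d - δ ≤ m := by
    refine le_of_sq_le_sq ?_ hm0
    have e : m ^ 2 = ((1 - d) * a ^ 2) * ((1 - d) * a' ^ 2) := by rw [hm]; ring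
    rw [e, sq]
    exact mul_le_mul h h' (by linarith) (by linarith)
  -- up to positive factors, `Br` is the divided difference at `a` and `a'` of the quotient of
  -- polynomials that `b` equals at a zero
  set Br := m ^ 3 + (1 - d) * d * (m - (4 - d)) * (a ^ 2 + a * a' + a' ^ 2) - d ^ 2 * (4 - d)
    with hBr
  have hB1 : 1 ≤ Br := by
    have h1 : (2 : ℝ) ^ 3 ≤ m ^ 3 := pow_le_pow_left₀ (by norm_num) (hs.trans hms) 3
    have h2 : d ^ 2 * (4 - d) ≤ 4 := by nlinarith
    have h3 : a ^ 2 + a * a' + a' ^ 2 ≤ 3 * M ^ 2 := by nlinarith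
    have h4 : (1 - d) * d ≤ 1 / 4 := by nlinarith [sq_nonneg (d - 1 / 2)]
    have h4' : 0 ≤ (1 - d) * d := by nlinarith
    have h5 : (1 - d) * d * δ * (a ^ 2 + a * a' + a' ^ 2) ≤ 1 / 4 * δ * (3 * M ^ 2) := by
      gcongr
    have h6 : 0 ≤ (1 - d) * d * (m - (4 - d - δ)) * (a ^ 2 + a * a' + a' ^ 2) :=
      mul_nonneg (mul_nonneg h4' (by linarith)) (by nlinarith)
    nlinarith
  have key : (a - a') * Br =
      (((1 - d) ^ 2 * a ^ 4 + d * (4 - d)) - 2 * (1 - d) * b * ((1 - d) * a ^ 3 + d * a))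
        * ((1 - d) * a' ^ 3 + d * a')
      - (((1 - d) ^ 2 * a' ^ 4 + d * (4 - d)) - 2 * (1 - d) * b * ((1 - d) * a' ^ 3 + d * a'))
        * ((1 - d) * a ^ 3 + d * a) := by
    rw [hBr, hm]; ring
  have hG : ∀ x, 1 ≤ x → x ≤ M → 0 ≤ (1 - d) * x ^ 3 + d * x ∧ (1 - d) * x ^ 3 + d * x ≤ M ^ 3 := by
    intro x hx hxM
    have h1 : x ^ 3 ≤ M ^ 3 := pow_le_pow_left₀ (by linarith) hxM 3
    have h2 : x ≤ x ^ 3 := le_self_pow₀ hx (by norm_num)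
    constructor
    · positivity
    · nlinarith
  have hν : 0 ≤ ν := (abs_nonneg _).trans hV
  calc |a - a'| ≤ |a - a'| * |Br| := by
        rw [abs_of_pos (by linarith : 0 < Br)]; exact le_mul_of_one_le_right (abs_nonneg _) hB1
    _ ≤ ν * M ^ 3 + ν * M ^ 3 := by
        rw [← abs_mul, key]
        refine (abs_sub _ _).trans ?_
        rw [abs_mul, abs_mul, abs_of_nonneg (hG a ha haM).1, abs_of_nonneg (hG a' ha' haM').1]
        exact add_le_add (mul_le_mul hV (hG a' ha' haM').2 (hG a' ha' haM').1 hν)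
          (mul_le_mul hV' (hG a ha haM).2 (hG a ha haM).1 hν)
    _ = _ := by ring

/-- For fixed `b`, the polynomial of `curvPoly_left_be` has a positive derivative in `c` near its
zeros in the range allowed by the resonance. -/
lemma abs_sub_le_of_be {c c' b : ℝ} (hc : 0 < c) (hcM : c ≤ M) (hc' : 0 < c') (hcM' : c' ≤ M)
    (hb : 1 ≤ b) (hδ : 6 * δ + ν ≤ 2 * (1 - d ^ 2)) (h : 1 - δ ≤ (1 - d) * c ^ 2)
    (h' : 1 - δ ≤ (1 - d) * c' ^ 2)
    (hV : |(1 - d) ^ 2 * c ^ 4 - 4 * d * (1 - d) * b * (b + c) + 4 * d - 1| ≤ ν)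
    (hV' : |(1 - d) ^ 2 * c' ^ 4 - 4 * d * (1 - d) * b * (b + c') + 4 * d - 1| ≤ ν) :
    |c - c'| ≤ ν * M / (1 - d ^ 2) := by
  wlog hcc : c ≤ c' generalizing c c'
  · rw [abs_sub_comm]
    exact this hc' hcM' hc hcM h' h hV' hV (le_of_not_ge hcc)
  have hd2 : 0 < 1 - d ^ 2 := by nlinarith
  have hν : 0 ≤ ν := (abs_nonneg _).trans hV
  set Br := (1 - d) ^ 2 * (c ^ 3 + c ^ 2 * c' + c * c' ^ 2 + c' ^ 3) - 4 * d * (1 - d) * b with hBr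
  have hB : 2 * (1 - d ^ 2) ≤ c * Br := by
    have h1 : c ^ 3 ≤ c ^ 2 * c' := by nlinarith [sq_nonneg c]
    have h2 : c ^ 3 ≤ c * c' ^ 2 := by nlinarith
    have h3 : c ^ 3 ≤ c' ^ 3 := pow_le_pow_left₀ hc.le hcc 3
    have h5 : (1 - d) ^ 2 * c * (4 * c ^ 3) ≤
        (1 - d) ^ 2 * c * (c ^ 3 + c ^ 2 * c' + c * c' ^ 2 + c' ^ 3) := by
      gcongr; linarith
    have h6 : 1 - 2 * δ ≤ ((1 - d) * c ^ 2) ^ 2 := by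
      rcases le_total δ 1 with hδ1 | hδ1
      · nlinarith
      · nlinarith [sq_nonneg ((1 - d) * c ^ 2)]
    have h7 : 4 * d * (1 - d) ≤ 4 * d * (1 - d) * b ^ 2 :=
      le_mul_of_one_le_right (by nlinarith) (one_le_pow₀ hb)
    have h8 := (abs_le.1 hV).1
    have e : c * Br = (1 - d) ^ 2 * c * (c ^ 3 + c ^ 2 * c' + c * c' ^ 2 + c' ^ 3)
      - 4 * d * (1 - d) * b * c := by rw [hBr]; ring
    rw [e]
    nlinarith
  have key : (c - c') * Br =
      ((1 - d) ^ 2 * c ^ 4 - 4 * d * (1 - d) * b * (b + c) + 4 * d - 1)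
      - ((1 - d) ^ 2 * c' ^ 4 - 4 * d * (1 - d) * b * (b + c') + 4 * d - 1) := by
    rw [hBr]; ring
  have h2 : |c - c'| * |Br| ≤ 2 * ν := by
    rw [← abs_mul, key]
    exact (abs_sub _ _).trans (by linarith)
  rw [le_div_iff₀ hd2]
  have h3 : |c - c'| * (2 * (1 - d ^ 2)) ≤ c * (|c - c'| * |Br|) := by
    calc |c - c'| * (2 * (1 - d ^ 2)) ≤ |c - c'| * (c * |Br|) := by
          exact mul_le_mul_of_nonneg_left (hB.trans
            (mul_le_mul_of_nonneg_left (le_abs_self _) hc.le)) (abs_nonneg _)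
      _ = _ := by ring
  have h4 : c * (|c - c'| * |Br|) ≤ M * (2 * ν) :=
    mul_le_mul hcM h2 (by positivity) (by linarith)
  linarith

/-- For fixed `b`, the polynomial of `curvPoly_left_eb` is linear in `c`, and its slope does not
vanish near its zeros in the range allowed by the resonance. -/
lemma abs_sub_le_of_eb {c c' b : ℝ} (hc : 0 < c) (hcM : c ≤ M) (hb : 1 ≤ b) (hbM : b ≤ M)
    (hν : ν ≤ 2 * d) (hδ : 4 * δ * M ^ 2 < 2 * d) (h : 1 - δ ≤ (1 - d) * b ^ 2)
    (hV : |4 * d - ((1 - d) * b ^ 2 - 1) * ((1 - d) * b ^ 2 - 1 + 2 * (1 - d) * b * c)| ≤ ν)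
    (hV' : |4 * d - ((1 - d) * b ^ 2 - 1) * ((1 - d) * b ^ 2 - 1 + 2 * (1 - d) * b * c')| ≤ ν) :
    |c - c'| ≤ 3 * ν * M ^ 2 / (2 * d * (1 - d)) := by
  have hM2 : 1 ≤ M ^ 2 := one_le_pow₀ hM
  set W := (1 - d) * b ^ 2
  set T := W - 1 + 2 * (1 - d) * b * c with hT
  have hb2 : b ^ 2 ≤ M ^ 2 := pow_le_pow_left₀ (by linarith) hbM 2
  have hbc : b * c ≤ M ^ 2 := by rw [sq]; exact mul_le_mul hbM hcM hc.le (by linarith)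
  have hbc0 : 0 < b * c := mul_pos (by linarith) hc
  have hW0 : 0 ≤ W := mul_nonneg (by linarith) (sq_nonneg b)
  have hWM : W ≤ M ^ 2 := by nlinarith [sq_nonneg b]
  have hbcd : (1 - d) * (b * c) ≤ M ^ 2 := by nlinarith
  have hbcd0 : 0 ≤ (1 - d) * (b * c) := mul_nonneg (by linarith) hbc0.le
  have hTM : T ≤ 3 * M ^ 2 := by rw [hT]; nlinarith
  have hprod : 2 * d ≤ (W - 1) * T := by linarith [(abs_le.1 hV).2]
  -- the resonance gives `W ≥ 1 - δ`, hence `W < 1` would make `(W - 1) T` smaller than `2d`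
  have hW1 : 1 ≤ W := by
    by_contra hlt
    rw [not_le] at hlt
    have : (W - 1) * T ≤ δ * (3 * M ^ 2 + 1) := by
      calc (W - 1) * T = (1 - W) * (-T) := by ring
        _ ≤ (1 - W) * 1 := by gcongr; linarith
        _ ≤ δ * (3 * M ^ 2 + 1) := by nlinarith
    nlinarith
  have hW2 : 2 * d ≤ (W - 1) * (3 * M ^ 2) :=
    hprod.trans (mul_le_mul_of_nonneg_left hTM (by linarith))
  have key : 2 * (1 - d) * b * (W - 1) * (c' - c) =
      (4 * d - (W - 1) * T) - (4 * d - (W - 1) * (W - 1 + 2 * (1 - d) * b * c')) := by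
    rw [hT]; ring
  have h2 : 2 * (1 - d) * b * (W - 1) * |c - c'| ≤ 2 * ν := by
    have h0 : 0 ≤ 2 * (1 - d) * b * (W - 1) :=
      mul_nonneg (mul_nonneg (by linarith) (by linarith)) (by linarith)
    rw [← abs_of_nonneg h0, abs_sub_comm, ← abs_mul, key]
    exact (abs_sub _ _).trans (by linarith)
  have hd' : 0 < 1 - d := by linarith
  rw [le_div_iff₀ (by positivity)]
  have h3 : (1 - d) * (W - 1) * |c - c'| ≤ (1 - d) * (W - 1) * |c - c'| * b :=
    le_mul_of_one_le_right (mul_nonneg (mul_nonneg hd'.le (by linarith)) (abs_nonneg _)) hb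
  have h4 : (1 - d) * (W - 1) * |c - c'| * (3 * M ^ 2) ≤ ν * (3 * M ^ 2) := by
    gcongr; linarith
  have h5 : (1 - d) * |c - c'| * (2 * d) ≤ (1 - d) * |c - c'| * ((W - 1) * (3 * M ^ 2)) := by
    gcongr
  linarith

omit hM hδ0 in
/-- The polynomial of `curvPoly_middle_ee` has no zeros in the range allowed by the resonance. -/
lemma one_le_of_middle_ee {b c : ℝ} (hδ : δ ≤ 1) (h : 4 - d - δ ≤ (1 - d) * (b + c) ^ 2) :
    1 ≤ (1 - d) ^ 2 * (b + c) ^ 4 - 4 * (1 - d) * b * c + d * (4 - d) := by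
  have h1 : 4 * ((1 - d) * (b * c)) ≤ (1 - d) * (b + c) ^ 2 := by
    nlinarith [mul_nonneg (by linarith : 0 ≤ 1 - d) (sq_nonneg (b - c))]
  nlinarith

/-- The polynomial of `curvPoly_middle_be` and `curvPoly_middle_eb` has no zeros in the range
allowed by the resonance. -/
lemma le_of_middle_be {b c : ℝ} (hb : 0 ≤ b) (hbM : b ≤ M) (hc : 0 ≤ c) (hcM : c ≤ M)
    (hδ : 4 * δ * M ^ 2 ≤ 2 * d) (h : 1 - δ ≤ (1 - d) * c ^ 2) :
    2 * d ≤ (1 - d) ^ 2 * c ^ 4 + 2 * b * (1 - d) ^ 2 * c ^ 3 - 2 * (1 - d) * b * c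
      + 4 * d - 1 := by
  have hM2 : 1 ≤ M ^ 2 := one_le_pow₀ hM
  have hbc : b * c ≤ M ^ 2 := by rw [sq]; exact mul_le_mul hbM hcM hc (by linarith)
  have hbc0 : 0 ≤ b * c := mul_nonneg hb hc
  set w := (1 - d) * c ^ 2 with hw
  have e : (1 - d) ^ 2 * c ^ 4 + 2 * b * (1 - d) ^ 2 * c ^ 3 - 2 * (1 - d) * b * c + 4 * d - 1
      = w ^ 2 - 1 + 4 * d + 2 * (1 - d) * (b * c) * (w - 1) := by rw [hw]; ring
  rw [e]
  have h1 : -(2 * δ) ≤ w ^ 2 - 1 := by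
    nlinarith [sq_nonneg (w - 1)]
  have h3 : 2 * (1 - d) * (b * c) ≤ 2 * M ^ 2 := by nlinarith
  have h2 : -(2 * M ^ 2 * δ) ≤ 2 * (1 - d) * (b * c) * (w - 1) := by
    have t1 : 2 * (1 - d) * (b * c) * (-δ) ≤ 2 * (1 - d) * (b * c) * (w - 1) := by
      gcongr; linarith
    have t2 : 2 * (1 - d) * (b * c) * δ ≤ 2 * M ^ 2 * δ := by gcongr
    linarith
  nlinarith

end Scalar

/-! ### Resonant points of small curvature -/

lemma energy_neg (c : ℝ) (v : Plane) : energy c (-v) = energy c v := by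
  rw [energy, energy, norm_neg]

lemma velocity_neg (c : ℝ) (v : Plane) : velocity c (-v) = -velocity c v := by
  rw [velocity, velocity, energy_neg, smul_neg]

lemma hessian_neg (c : ℝ) (v : Plane) : hessian c (-v) = hessian c v := by
  ext1 h
  simp only [hessian_apply, energy_neg, inner_neg_left, mul_neg, neg_smul, smul_neg, neg_neg]

lemma inner_hessian_comm (c : ℝ) (y v w : Plane) :
    ⟪v, hessian c y w⟫ = ⟪w, hessian c y v⟫ := by
  simp only [hessian_apply, inner_smul_right, inner_sub_right]
  rw [real_inner_comm v w, real_inner_comm v y, real_inner_comm w y]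
  ring

namespace PhaseData

/-- The phase with the roles of `ξ` and `η` exchanged. -/
def swap (P : PhaseData) : PhaseData where
  c₁ := P.c₃
  c₂ := P.c₂
  c₃ := P.c₁
  e₁ := P.e₃
  e₂ := P.e₂
  e₃ := P.e₁
  pos₁ := P.pos₃
  pos₂ := P.pos₂
  pos₃ := P.pos₁
  le₁ := P.le₃
  le₂ := P.le₂
  le₃ := P.le₁
  sign₁ := P.sign₃
  sign₂ := P.sign₂
  sign₃ := P.sign₁

variable (P : PhaseData)

lemma swap_val (ξ η : Plane) : P.swap.val η ξ = P.val ξ η := by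
  simp only [val, swap]
  rw [← neg_sub ξ η, energy_neg]
  ring

lemma swap_curvature (ξ η : Plane) : P.swap.curvature η ξ = P.curvature ξ η := by
  have h1 : P.swap.gradLeft η ξ = P.gradRight ξ η := by
    simp only [gradLeft, gradRight, swap]
    rw [← neg_sub ξ η, velocity_neg, smul_neg, ← sub_eq_add_neg]
  have h2 : P.swap.gradRight η ξ = P.gradLeft ξ η := by
    simp only [gradLeft, gradRight, swap]
    rw [← neg_sub ξ η, velocity_neg, smul_neg, sub_neg_eq_add]
  rw [curvature, curvature, h1, h2, inner_hessian_comm, ← neg_sub ξ η, hessian_neg]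
  rfl

lemma abs_curvature_sub_right_le (ξ η η' : Plane) :
    |P.curvature ξ η - P.curvature ξ η'| ≤ 22 * ‖η - η'‖ := by
  rw [← P.swap_curvature ξ η, ← P.swap_curvature ξ η']
  exact P.swap.abs_curvature_sub_le η η' ξ

/-- The sign of `ξ` differs from the two others, and resonances are possible. -/
structure IsLeft (d : ℝ) : Prop where
  c₁_eq : P.c₁ = 1
  e₂_eq : P.e₂ = -P.e₁
  e₃_eq : P.e₃ = -P.e₁
  coeff : (P.c₂ = d ∧ P.c₃ = d) ∨ (P.c₂ = d ∧ P.c₃ = 1) ∨ (P.c₂ = 1 ∧ P.c₃ = d)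

/-- The sign of `ξ - η` differs from the two others, and resonances are possible. -/
structure IsMiddle (d : ℝ) : Prop where
  c₂_eq : P.c₂ = 1
  e₁_eq : P.e₁ = -P.e₂
  e₃_eq : P.e₃ = -P.e₂
  coeff : (P.c₁ = d ∧ P.c₃ = d) ∨ (P.c₁ = 1 ∧ P.c₃ = d) ∨ (P.c₁ = d ∧ P.c₃ = 1)

/-- The points of the ball of radius `K` at which the phase is at most `τ` and the curvature at
most `κ`. -/
structure IsBad (K κ τ : ℝ) (ξ η : Plane) : Prop where
  left : ‖ξ‖ ≤ K
  right : ‖η‖ ≤ K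
  val : |P.val ξ η| ≤ τ
  curvature : |P.curvature ξ η| ≤ κ

end PhaseData

lemma energy_le_of_norm_le {c K : ℝ} (hc1 : c ≤ 1) (hK : 1 ≤ K) {v : Plane} (h : ‖v‖ ≤ 2 * K) :
    energy c v ≤ 3 * K := (energy_le hc1 v).trans (by linarith)

/-- The invariant mass of two particles of mass `1` is at least `2`. -/
lemma four_add_le_sq_energy_add {d : ℝ} (hd : 0 ≤ d) (v w : Plane) :
    4 + d * ‖v + w‖ ^ 2 ≤ (energy d v + energy d w) ^ 2 := by
  have h1 := energy_sq hd v
  have h2 := energy_sq hd w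
  have hv := energy_pos hd v
  have hw := energy_pos hd w
  have h3 : 1 + d * (‖v‖ * ‖w‖) ≤ energy d v * energy d w := by
    refine le_of_sq_le_sq ?_ (by positivity)
    rw [mul_pow, h1, h2]
    nlinarith [mul_nonneg hd (sq_nonneg (‖v‖ - ‖w‖))]
  have h4 : ‖v + w‖ ^ 2 ≤ (‖v‖ + ‖w‖) ^ 2 := by gcongr; exact norm_add_le v w
  have h5 := mul_le_mul_of_nonneg_left h4 hd
  nlinarith

/-- Where phase and curvature are small, so is the curvature polynomial after the second energy has
been replaced by its value under exact resonance. -/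
lemma abs_curvPoly_le (P : PhaseData) : ∃ C : ℝ, 0 ≤ C ∧ ∀ K κ τ : ℝ, ∀ ξ η : Plane, 1 ≤ K →
    τ ≤ κ → P.IsBad K κ τ ξ η →
    |curvPoly P.c₁ P.c₂ P.c₃ (P.e₁ * energy P.c₁ ξ)
      (-(P.e₁ * energy P.c₁ ξ) - P.e₃ * energy P.c₃ η) (P.e₃ * energy P.c₃ η)|
      ≤ C * (κ * K ^ 5) := by
  obtain ⟨C, hC, H⟩ := tame_curvPoly P.c₁ P.c₂ P.c₃
  refine ⟨3 ^ 5 / P.c₂ + 6 ^ 4 * C, by have := P.pos₂; positivity, fun K κ τ ξ η hK hτ h => ?_⟩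
  have hκ : 0 ≤ κ := (abs_nonneg _).trans h.curvature
  have l1 : energy P.c₁ ξ ≤ 3 * K := energy_le_of_norm_le P.le₁ hK (by linarith [h.left])
  have l2 : energy P.c₂ (ξ - η) ≤ 3 * K := energy_le_of_norm_le P.le₂ hK
    ((norm_sub_le _ _).trans (by linarith [h.left, h.right]))
  have l3 : energy P.c₃ η ≤ 3 * K := energy_le_of_norm_le P.le₃ hK (by linarith [h.right])
  have p1 := energy_pos P.pos₁.le ξ
  have p2 := energy_pos P.pos₂.le (ξ - η)
  have p3 := energy_pos P.pos₃.le η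
  have a1 : |P.e₁ * energy P.c₁ ξ| = energy P.c₁ ξ := by
    rw [abs_mul, P.sign₁, one_mul, abs_of_pos p1]
  have a2 : |P.e₂ * energy P.c₂ (ξ - η)| = energy P.c₂ (ξ - η) := by
    rw [abs_mul, P.sign₂, one_mul, abs_of_pos p2]
  have a3 : |P.e₃ * energy P.c₃ η| = energy P.c₃ η := by
    rw [abs_mul, P.sign₃, one_mul, abs_of_pos p3]
  have hcurv := congrArg abs (P.curvature_mul ξ η)
  rw [abs_mul, abs_mul (_ * _) (P.e₃ * _), abs_mul (P.e₁ * _), a1, a3, abs_mul P.c₂,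
    abs_of_pos P.pos₂, abs_of_pos (pow_pos p2 3)] at hcurv
  set x := P.e₁ * energy P.c₁ ξ
  set y := P.e₂ * energy P.c₂ (ξ - η)
  set z := P.e₃ * energy P.c₃ η
  have hL : |curvPoly P.c₁ P.c₂ P.c₃ x y z| ≤ 3 ^ 5 / P.c₂ * (κ * K ^ 5) := by
    have h1 : P.c₂ * |curvPoly P.c₁ P.c₂ P.c₃ x y z|
        ≤ κ * ((3 * K) * (3 * K) ^ 3 * (3 * K)) := by
      rw [← hcurv]
      gcongr
      exact h.curvature
    rw [div_mul_eq_mul_div, le_div_iff₀ P.pos₂]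
    calc _ = P.c₂ * |curvPoly P.c₁ P.c₂ P.c₃ x y z| := mul_comm _ _
      _ ≤ _ := h1
      _ = _ := by ring
  have hy' : |-x - z| ≤ 6 * K := by
    have := abs_sub (-x) z
    rw [abs_neg, a1, a3] at this
    linarith
  have h2 := (H (6 * K) x (-x - z) y z (by linarith) (by linarith) hy' (by linarith)
    (by linarith)).2
  have h3 : |-x - z - y| ≤ κ := by
    have e : -x - z - y = -P.val ξ η := by simp only [PhaseData.val, x, y, z]; ring
    rw [e, abs_neg]; exact h.val.trans hτ
  have h4 : C * (6 * K) ^ 4 * |-x - z - y| ≤ C * (6 * K) ^ 4 * κ := by gcongr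
  have h5 : C * (6 * K) ^ 4 * κ ≤ 6 ^ 4 * C * (κ * K ^ 5) := by
    have : κ * K ^ 4 ≤ κ * K ^ 5 := by gcongr; norm_num
    calc C * (6 * K) ^ 4 * κ = 6 ^ 4 * C * (κ * K ^ 4) := by ring
      _ ≤ _ := by gcongr
  have h6 := abs_sub_abs_le_abs_sub (curvPoly P.c₁ P.c₂ P.c₃ x (-x - z) z)
    (curvPoly P.c₁ P.c₂ P.c₃ x y z)
  linarith

section Constraints

variable {d κ τ K : ℝ} (hd : 0 < d) (hd1 : d < 1) (hK : 1 ≤ K) (hκ1 : κ ≤ 1) (hτ : τ ≤ κ)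
include hK hκ1 hτ

lemma abs_sq_sub_sq_le {x y : ℝ} (hx : 0 ≤ x) (hxK : x ≤ 4 * K) (hxy : |x - y| ≤ τ) :
    |x ^ 2 - y ^ 2| ≤ 12 * (κ * K) := by
  obtain ⟨u1, u2⟩ := abs_le.1 hxy
  have e : x ^ 2 - y ^ 2 = (x - y) * (2 * x - (x - y)) := by ring
  have h2 : |2 * x - (x - y)| ≤ 12 * K := by rw [abs_le]; constructor <;> linarith
  rw [e, abs_mul]
  calc |x - y| * |2 * x - (x - y)| ≤ κ * (12 * K) := by
        gcongr
        · linarith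
        · linarith
    _ = _ := by ring

include hd

/-- A lower bound for `energy 1 A`, from `energy 1 A ≈ energy d B + energy d C ≥ √(4 + d ‖A‖²)`. -/
lemma le_of_resonance_ee {A B C : Plane} (hA : A = B + C) (hl : energy 1 A ≤ 3 * K)
    (h : |energy 1 A - (energy d B + energy d C)| ≤ τ) :
    4 - d - 12 * (κ * K) ≤ (1 - d) * energy 1 A ^ 2 := by
  have h1 := four_add_le_sq_energy_add hd.le B C
  have h0 := energy_pos zero_le_one A
  have h2 := (abs_le.1 (abs_sq_sub_sq_le hK hκ1 hτ h0.le (by linarith) h)).1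
  have h3 := energy_sq zero_le_one A
  rw [← hA] at h1
  have h4 : ‖A‖ ^ 2 = energy 1 A ^ 2 - 1 := by linarith
  rw [h4] at h1
  linarith

include hd1

/-- The energy `energy d C` of a resonance equals a difference of two values of `energy 1`, which is
at most `‖C‖`; this bounds `‖C‖` from below. -/
lemma le_of_resonance_be {A B C : Plane} (hA : A = B + C) (hl : energy d C ≤ 3 * K)
    (h : |energy 1 A - energy 1 B - energy d C| ≤ τ) :
    1 - 12 * (κ * K) ≤ (1 - d) * (energy 1 A - energy 1 B) ^ 2 ∧
      1 - 12 * (κ * K) ≤ (1 - d) * energy d C ^ 2 := by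
  have h0 := energy_pos hd.le C
  have h2 := (abs_le.1 (abs_sq_sub_sq_le hK hκ1 hτ h0.le (by linarith)
    (by rw [abs_sub_comm]; exact h))).1
  have h2' := (abs_le.1 (abs_sq_sub_sq_le hK hκ1 hτ h0.le (by linarith)
    (by rw [abs_sub_comm]; exact h))).2
  have h3 := energy_sq hd.le C
  have h4 := abs_energy_sub_le zero_le_one le_rfl A B
  rw [hA, add_sub_cancel_left, ← hA] at h4
  have h5 : (energy 1 A - energy 1 B) ^ 2 ≤ ‖C‖ ^ 2 := by
    rw [← sq_abs]; gcongr
  have h6 := mul_le_mul_of_nonneg_left h5 hd.le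
  constructor
  · linarith
  · nlinarith

end Constraints

/-- For fixed `η`, the energy of `ξ` is confined to a short interval on the set of resonant points
with small curvature. -/
lemma exists_abs_energy_sub_le {d : ℝ} (hd : 0 < d) (hd1 : d < 1) {P : PhaseData}
    (hP : P.IsLeft d) : ∃ C : ℝ, 0 ≤ C ∧ ∀ K κ τ : ℝ, ∀ ξ ξ' η : Plane, 1 ≤ K → κ ≤ 1 → τ ≤ κ →
      P.IsBad K κ τ ξ η → P.IsBad K κ τ ξ' η →
      |energy P.c₁ ξ - energy P.c₁ ξ'| ≤ C * (κ * K ^ 8) := by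
  obtain ⟨D, hD, H⟩ := abs_curvPoly_le P
  have hd2 : 0 < 1 - d ^ 2 := by nlinarith
  set C₁ := (768 + 4 * D) / (d * (1 - d ^ 2)) with hC₁
  have hC₁0 : 0 ≤ C₁ := by positivity
  refine ⟨512 * D + 16 * D / (1 - d ^ 2) + 192 * D / (2 * d * (1 - d)) + 3 * C₁, by positivity,
    fun K κ τ ξ ξ' η hK hκ1 hτ h h' => ?_⟩
  have hκ : 0 ≤ κ := (abs_nonneg _).trans h.curvature
  have hK8 : ∀ n ≤ 8, κ * K ^ n ≤ κ * K ^ 8 := fun n hn => by gcongr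
  have b1 : 1 ≤ energy P.c₁ ξ := one_le_energy P.pos₁.le ξ
  have b1' : 1 ≤ energy P.c₁ ξ' := one_le_energy P.pos₁.le ξ'
  have b2 : 1 ≤ energy P.c₂ (ξ - η) := one_le_energy P.pos₂.le (ξ - η)
  have b2' : 1 ≤ energy P.c₂ (ξ' - η) := one_le_energy P.pos₂.le (ξ' - η)
  have b3 : 1 ≤ energy P.c₃ η := one_le_energy P.pos₃.le η
  have l1 : energy P.c₁ ξ ≤ 3 * K := energy_le_of_norm_le P.le₁ hK (by linarith [h.left])
  have l1' : energy P.c₁ ξ' ≤ 3 * K := energy_le_of_norm_le P.le₁ hK (by linarith [h'.left])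
  have l2 : energy P.c₂ (ξ - η) ≤ 3 * K := energy_le_of_norm_le P.le₂ hK
    ((norm_sub_le _ _).trans (by linarith [h.left, h.right]))
  have l2' : energy P.c₂ (ξ' - η) ≤ 3 * K := energy_le_of_norm_le P.le₂ hK
    ((norm_sub_le _ _).trans (by linarith [h'.left, h'.right]))
  have l3 : energy P.c₃ η ≤ 3 * K := energy_le_of_norm_le P.le₃ hK (by linarith [h.right])
  -- the resonance and the curvature bound in terms of the energies
  have key : ∀ ξ, P.IsBad K κ τ ξ η →
      |energy P.c₁ ξ - energy P.c₃ η - energy P.c₂ (ξ - η)| ≤ τ ∧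
      |curvPoly 1 P.c₂ P.c₃ (energy P.c₁ ξ) (-(energy P.c₁ ξ - energy P.c₃ η)) (-energy P.c₃ η)|
        ≤ D * (κ * K ^ 5) := by
    intro ξ h
    have hv := h.val
    have hc := H K κ τ ξ η hK hτ h
    rw [PhaseData.val, hP.e₂_eq, hP.e₃_eq] at hv
    rw [hP.e₃_eq] at hc
    rcases eq_or_eq_neg_of_abs_eq P.sign₁ with s | s
    · rw [s] at hv hc
      refine ⟨le_of_eq_of_le ?_ hv, le_of_eq_of_le ?_ hc⟩
      · congr 1; ring
      · rw [hP.c₁_eq]; congr 2 <;> ring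
    · rw [s] at hv hc
      refine ⟨le_of_eq_of_le ?_ hv, le_of_eq_of_le ?_ hc⟩
      · rw [← abs_neg]; congr 1; ring
      · rw [hP.c₁_eq, ← curvPoly_neg]; congr 2 <;> ring
  obtain ⟨ht, hc⟩ := key ξ h
  obtain ⟨ht', hc'⟩ := key ξ' h'
  have hgoal : ∀ X : ℝ, 0 ≤ X → X ≤ 512 * D + 16 * D / (1 - d ^ 2) + 192 * D / (2 * d * (1 - d)) →
      X * (κ * K ^ 8) ≤ (512 * D + 16 * D / (1 - d ^ 2) + 192 * D / (2 * d * (1 - d)) + 3 * C₁)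
        * (κ * K ^ 8) := fun X _ hX => by gcongr; linarith
  have p1 : 0 ≤ 16 * D / (1 - d ^ 2) := by positivity
  have p2 : 0 ≤ 192 * D / (2 * d * (1 - d)) := by positivity
  -- if `κ K⁵` is not small, the trivial bound `3 K` for the difference suffices
  by_cases hsmall : C₁ * (κ * K ^ 5) ≤ 1
  swap
  · rw [not_le] at hsmall
    have h1 : |energy P.c₁ ξ - energy P.c₁ ξ'| ≤ 3 * K := by
      rw [abs_le]; constructor <;> linarith
    have h2 : 3 * K * 1 ≤ 3 * K * (C₁ * (κ * K ^ 5)) := by gcongr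
    have h4 : 3 * C₁ * (κ * K ^ 6) ≤ 3 * C₁ * (κ * K ^ 8) := by gcongr 1; exact hK8 6 (by norm_num)
    have h5 : 0 ≤ (512 * D + 16 * D / (1 - d ^ 2) + 192 * D / (2 * d * (1 - d))) * (κ * K ^ 8) := by
      positivity
    linarith
  have hsm : (768 + 4 * D) * (κ * K ^ 5) ≤ d * (1 - d ^ 2) := by
    rw [hC₁, div_mul_eq_mul_div, div_le_one (by positivity)] at hsmall
    exact hsmall
  have hdd : d * (1 - d ^ 2) ≤ d := by nlinarith
  have hdd' : d * (1 - d ^ 2) ≤ 1 - d ^ 2 := by nlinarith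
  have hDκ : 0 ≤ D * (κ * K ^ 5) := by positivity
  have hκ5 : 0 ≤ κ * K ^ 5 := by positivity
  have hM : 1 ≤ 4 * K := by linarith
  have hκK1 : κ * K ≤ κ * K ^ 5 := by gcongr; exact le_self_pow₀ hK (by norm_num)
  have hκK3 : κ * K ^ 3 ≤ κ * K ^ 5 := by gcongr; norm_num
  have hκ2 : κ ≤ 1 / 2 := by
    have := le_mul_of_one_le_right hκ (one_le_pow₀ hK (n := 5))
    linarith
  set δ := 12 * (κ * K) with hδ
  have hδ0 : 0 ≤ δ := by positivity
  have hδM : δ * (4 * K) ^ 2 = 192 * (κ * K ^ 3) := by rw [hδ]; ring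
  set a := energy P.c₁ ξ with ha
  set a' := energy P.c₁ ξ' with ha'
  set b := energy P.c₃ η with hb
  set c := energy P.c₂ (ξ - η) with hc0
  set c' := energy P.c₂ (ξ' - η) with hc0'
  obtain ⟨t1, t2⟩ := abs_le.1 ht
  obtain ⟨t1', t2'⟩ := abs_le.1 ht'
  have habs : ∀ x y : ℝ, |x| ≤ y → ∀ z : ℝ, 0 ≤ z → |z * x| ≤ z * y := fun x y hxy z hz => by
    rw [abs_mul, abs_of_nonneg hz]; gcongr
  have t3 : |a - (c + b)| ≤ τ := by rw [← sub_sub, sub_right_comm]; exact ht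
  have t3' : |a' - (c' + b)| ≤ τ := by rw [← sub_sub, sub_right_comm]; exact ht'
  have e := (sub_add_cancel ξ η).symm
  have e' := (sub_add_cancel ξ' η).symm
  rw [hP.c₁_eq] at ha ha'
  rcases hP.coeff with ⟨h2, h3⟩ | ⟨h2, h3⟩ | ⟨h2, h3⟩
  · rw [h2] at hc0 hc0'
    rw [h3] at hb
    rw [h2, h3] at hc hc'
    have v := habs _ _ hc 4 (by norm_num)
    have v' := habs _ _ hc' 4 (by norm_num)
    rw [← abs_neg, ← neg_mul, curvPoly_left_ee hd.ne'] at v v'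
    rw [ha, hb, hc0] at t3
    rw [ha', hb, hc0'] at t3'
    have r := le_of_resonance_ee hd hK hκ1 hτ e (ha ▸ l1) t3
    have r' := le_of_resonance_ee hd hK hκ1 hτ e' (ha' ▸ l1') t3'
    rw [← ha] at r
    rw [← ha'] at r'
    have := abs_sub_le_of_ee hd hd1 hM hδ0 b1 (by linarith) b1' (by linarith)
      (by rw [hδM]; linarith) r r' v v'
    calc |a - a'| ≤ 2 * (4 * (D * (κ * K ^ 5))) * (4 * K) ^ 3 := this
      _ = 512 * D * (κ * K ^ 8) := by ring
      _ ≤ _ := hgoal _ (by positivity) (by linarith)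
  · rw [h2] at hc0 hc0'
    rw [h3] at hb
    rw [h2, h3] at hc hc'
    have v := habs _ _ hc (4 * d) (by positivity)
    have v' := habs _ _ hc' (4 * d) (by positivity)
    have w := curvPoly_left_be hd.ne' b (a - b)
    have w' := curvPoly_left_be hd.ne' b (a' - b)
    rw [add_sub_cancel] at w w'
    rw [← abs_neg, ← neg_mul, ← neg_mul, w] at v
    rw [← abs_neg, ← neg_mul, ← neg_mul, w'] at v'
    rw [ha, hb, hc0] at ht
    rw [ha', hb, hc0'] at ht'
    have r := (le_of_resonance_be hd hd1 hK hκ1 hτ (by rw [add_comm]; exact e) (hc0 ▸ l2) ht).1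
    have r' := (le_of_resonance_be hd hd1 hK hκ1 hτ (by rw [add_comm]; exact e') (hc0' ▸ l2') ht').1
    rw [← ha, ← hb] at r
    rw [← ha', ← hb] at r'
    have hdD : d * (D * (κ * K ^ 5)) ≤ D * (κ * K ^ 5) := mul_le_of_le_one_left hDκ hd1.le
    have := abs_sub_le_of_be hd hd1 hM hδ0 (ν := 4 * d * (D * (κ * K ^ 5))) (c := a - b)
      (c' := a' - b) (b := b) (by linarith) (by linarith) (by linarith) (by linarith) b3
      (by linarith) r r'
      (by rwa [add_sub_cancel]) (by rwa [add_sub_cancel])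
    rw [sub_sub_sub_cancel_right] at this
    calc |a - a'| ≤ 4 * d * (D * (κ * K ^ 5)) * (4 * K) / (1 - d ^ 2) := this
      _ ≤ 4 * 1 * (D * (κ * K ^ 5)) * (4 * K) / (1 - d ^ 2) := by gcongr
      _ = 16 * D / (1 - d ^ 2) * (κ * K ^ 6) := by ring
      _ ≤ 16 * D / (1 - d ^ 2) * (κ * K ^ 8) := by gcongr 1; exact hK8 6 (by norm_num)
      _ ≤ _ := hgoal _ (by positivity) (by linarith)
  · rw [h2] at hc0 hc0'
    rw [h3] at hb
    rw [h2, h3] at hc hc'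
    have v := habs _ _ hc (4 * d) (by positivity)
    have v' := habs _ _ hc' (4 * d) (by positivity)
    have w := curvPoly_left_eb hd.ne' b (a - b)
    have w' := curvPoly_left_eb hd.ne' b (a' - b)
    rw [add_sub_cancel] at w w'
    rw [← abs_neg, ← neg_mul, ← neg_mul, w] at v
    rw [← abs_neg, ← neg_mul, ← neg_mul, w'] at v'
    rw [sub_right_comm, ha, hb, hc0] at ht
    have r := (le_of_resonance_be hd hd1 hK hκ1 hτ e (hb ▸ l3) ht).2
    rw [← hb] at r
    have hd4 : 4 * D * (κ * K ^ 5) ≤ 2 := by linarith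
    have := abs_sub_le_of_eb hd hd1 hM hδ0 (ν := 4 * d * (D * (κ * K ^ 5))) (c := a - b)
      (c' := a' - b) (b := b) (by linarith)
      (by linarith) b3 (by linarith)
      (by linarith [mul_le_mul_of_nonneg_left hd4 hd.le]) (by rw [mul_assoc, hδM]; linarith) r v v'
    rw [sub_sub_sub_cancel_right] at this
    calc |a - a'| ≤ 3 * (4 * d * (D * (κ * K ^ 5))) * (4 * K) ^ 2 / (2 * d * (1 - d)) := this
      _ ≤ 3 * (4 * 1 * (D * (κ * K ^ 5))) * (4 * K) ^ 2 / (2 * d * (1 - d)) := by gcongr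
      _ = 192 * D / (2 * d * (1 - d)) * (κ * K ^ 7) := by ring
      _ ≤ 192 * D / (2 * d * (1 - d)) * (κ * K ^ 8) := by gcongr 1; exact hK8 7 (by norm_num)
      _ ≤ _ := hgoal _ (by positivity) (by linarith)

/-! ### Localization of the resonant points of small curvature -/

/-- At `η = 0` all gradients are parallel to `ξ`, and the curvature is explicit. -/
lemma abs_curvature_zero {P : PhaseData} (h : P.e₂ = -P.e₁) (ξ : Plane) :
    |P.curvature ξ 0| = (P.c₂ / energy P.c₂ ξ) ^ 2 *
      |P.c₁ / energy P.c₁ ξ - P.c₂ / energy P.c₂ ξ| * ‖ξ‖ ^ 2 := by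
  have hv : velocity P.c₃ 0 = 0 := by simp [velocity]
  have h0 : ⟪ξ, perp ξ⟫ = 0 := by rw [real_inner_comm, inner_perp_self]
  have hp : P.gradLeft ξ 0 = (P.e₁ * (P.c₁ / energy P.c₁ ξ - P.c₂ / energy P.c₂ ξ)) • ξ := by
    rw [PhaseData.gradLeft, h, sub_zero, velocity, velocity]; module
  have hq : P.gradRight ξ 0 = (P.e₁ * (P.c₂ / energy P.c₂ ξ)) • ξ := by
    rw [PhaseData.gradRight, hv, h, sub_zero, velocity]; module
  have e : P.curvature ξ 0 = P.e₁ ^ 2 * (P.c₂ / energy P.c₂ ξ) ^ 2 *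
      (P.c₁ / energy P.c₁ ξ - P.c₂ / energy P.c₂ ξ) * ‖ξ‖ ^ 2 := by
    rw [PhaseData.curvature, hp, hq, sub_zero, hessian_apply]
    simp only [map_smul, inner_smul_right, inner_smul_left, h0, mul_zero, zero_smul, sub_zero,
      real_inner_self_eq_norm_sq, norm_perp, conj_trivial]
    ring
  have s1 : P.e₁ ^ 2 = 1 := by rw [← sq_abs, P.sign₁, one_pow]
  rw [e, s1, one_mul, abs_mul, abs_mul, abs_of_nonneg (sq_nonneg ‖ξ‖),
    abs_of_nonneg (sq_nonneg (P.c₂ / _))]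

lemma PhaseData.IsLeft.abs_energy_sub_le {d : ℝ} {P : PhaseData} (hP : P.IsLeft d) {K κ τ : ℝ}
    {ξ η : Plane} (h : P.IsBad K κ τ ξ η) :
    |energy P.c₁ ξ - energy P.c₃ η - energy P.c₂ (ξ - η)| ≤ τ := by
  have hv := h.val
  rw [PhaseData.val, hP.e₂_eq, hP.e₃_eq] at hv
  rcases eq_or_eq_neg_of_abs_eq P.sign₁ with s | s
  · rw [s] at hv
    refine le_of_eq_of_le ?_ hv
    congr 1; ring
  · rw [s] at hv
    refine le_of_eq_of_le ?_ hv
    rw [← abs_neg]; congr 1; ring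

/-- Resonant points with small curvature do not exist for `η` near the origin. -/
lemma exists_one_le_of_isLeft {d : ℝ} (hd : 0 < d) (hd1 : d < 1) {P : PhaseData}
    (hP : P.IsLeft d) : ∃ C : ℝ, 0 ≤ C ∧ ∀ K κ τ : ℝ, ∀ ξ η : Plane, 1 ≤ K → τ ≤ κ →
      P.IsBad K κ τ ξ η → 1 ≤ C * K ^ 5 * (κ + ‖η‖) := by
  have hd2 : 0 < 1 - d ^ 2 := by nlinarith
  refine ⟨2 + 64 * 22 / (d ^ 2 * (1 - d ^ 2)), by positivity, fun K κ τ ξ η hK hτ h => ?_⟩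
  have hκ : 0 ≤ κ := (abs_nonneg _).trans h.curvature
  have hη := norm_nonneg η
  have hK5 : 1 ≤ K ^ 5 := one_le_pow₀ hK
  have hlow : ∀ x y : ℝ, 0 ≤ x → x ≤ 2 → 0 ≤ y → y ≤ 64 * 22 / (d ^ 2 * (1 - d ^ 2)) * K ^ 5 →
      1 ≤ x * (κ + ‖η‖) ∨ 1 ≤ y * (κ + ‖η‖) →
      1 ≤ (2 + 64 * 22 / (d ^ 2 * (1 - d ^ 2))) * K ^ 5 * (κ + ‖η‖) := by
    intro x y hx hx2 hy hy2 hxy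
    rcases hxy with h | h
    · refine h.trans ?_
      gcongr
      nlinarith
    · refine h.trans ?_
      gcongr
      nlinarith
  have hv := hP.abs_energy_sub_le h
  rw [hP.c₁_eq] at hv
  have b2 : 1 ≤ energy P.c₂ (ξ - η) := one_le_energy P.pos₂.le (ξ - η)
  have b3 : 1 ≤ energy P.c₃ η := one_le_energy P.pos₃.le η
  have hv1 := (abs_le.1 hv).1
  -- if `c₂ = 1`, the phase itself is not small near `η = 0`
  by_cases hc : P.c₂ = 1
  · refine hlow 1 0 (by norm_num) (by norm_num) le_rfl (by positivity) (Or.inl ?_)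
    have h1 := (abs_le.1 (abs_energy_sub_le zero_le_one le_rfl ξ (ξ - η))).2
    rw [sub_sub_cancel] at h1
    rw [hc] at hv1
    linarith
  have hc2 : P.c₂ = d := by
    rcases hP.coeff with ⟨h, -⟩ | ⟨h, -⟩ | ⟨h, -⟩
    · exact h
    · exact h
    · exact absurd h hc
  by_cases hκ2 : κ ≤ 1 / 2
  swap
  · rw [not_le] at hκ2
    exact hlow 2 0 (by norm_num) le_rfl le_rfl (by positivity) (Or.inl (by linarith))
  refine hlow 0 _ le_rfl (by norm_num) (by positivity) le_rfl (Or.inr ?_)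
  -- compare with the curvature at `η = 0`, which is bounded below by a multiple of `K⁻⁵`
  have hcurv : |P.curvature ξ 0| ≤ 22 * (κ + ‖η‖) := by
    have h1 := P.abs_curvature_sub_right_le ξ 0 η
    rw [zero_sub, norm_neg] at h1
    have h2 := abs_sub_abs_le_abs_sub (P.curvature ξ 0) (P.curvature ξ η)
    linarith [h.curvature]
  rw [abs_curvature_zero hP.e₂_eq, hP.c₁_eq, hc2] at hcurv
  have q1 := energy_sq zero_le_one ξ
  have q2 := energy_sq hd.le ξ
  have a1 : energy 1 ξ ≤ 2 * K := (energy_le le_rfl ξ).trans (by linarith [h.left])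
  have a2 : energy d ξ ≤ 2 * K := (energy_le hd1.le ξ).trans (by linarith [h.left])
  have p1 := energy_pos zero_le_one ξ
  have p2 := energy_pos hd.le ξ
  have hξ : 1 ≤ ‖ξ‖ ^ 2 := by nlinarith
  set a := energy 1 ξ
  set c := energy d ξ
  have hca : (1 - d ^ 2) / (4 * K) ≤ c - d * a := by
    rw [div_le_iff₀ (by positivity)]
    have h1 : 1 - d ^ 2 ≤ (c - d * a) * (c + d * a) := by
      have : (c - d * a) * (c + d * a) = 1 - d ^ 2 + d * (1 - d) * ‖ξ‖ ^ 2 := by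
        linear_combination q2 - d ^ 2 * q1
      rw [this]
      have : 0 ≤ d * (1 - d) * ‖ξ‖ ^ 2 := by
        positivity
      linarith
    have h2 : c + d * a ≤ 4 * K := by nlinarith
    have h3 : 0 < c + d * a := by positivity
    have h4 : 0 ≤ c - d * a := by
      by_contra hlt
      rw [not_le] at hlt
      nlinarith
    calc 1 - d ^ 2 ≤ (c - d * a) * (c + d * a) := h1
      _ ≤ (c - d * a) * (4 * K) := by gcongr
  have e : 1 / a - d / c = (c - d * a) / (a * c) := by field_simp
  have hpos : 0 < (1 - d ^ 2) / (4 * K) := by positivity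
  have hca0 : 0 ≤ c - d * a := hpos.le.trans hca
  have hlow2 : (1 - d ^ 2) / (4 * K) / (2 * K * (2 * K)) ≤ |1 / a - d / c| := by
    rw [e, abs_of_nonneg (div_nonneg hca0 (by positivity))]
    gcongr
  have hlow3 : (d / (2 * K)) ^ 2 * ((1 - d ^ 2) / (4 * K) / (2 * K * (2 * K))) * 1
      ≤ (d / c) ^ 2 * |1 / a - d / c| * ‖ξ‖ ^ 2 := by gcongr
  have h5 := hlow3.trans hcurv
  have e2 : (d / (2 * K)) ^ 2 * ((1 - d ^ 2) / (4 * K) / (2 * K * (2 * K))) * 1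
      = d ^ 2 * (1 - d ^ 2) / (64 * K ^ 5) := by field_simp; ring
  rw [e2, div_le_iff₀ (by positivity)] at h5
  rw [div_mul_eq_mul_div, div_mul_eq_mul_div, le_div_iff₀ (by positivity), one_mul]
  linarith

/-- When the sign of `ξ - η` differs from the two others, the curvature is not small on the
resonant set. -/
lemma exists_one_le_of_isMiddle {d : ℝ} (hd : 0 < d) (hd1 : d < 1) {P : PhaseData}
    (hP : P.IsMiddle d) : ∃ C : ℝ, 0 ≤ C ∧ ∀ K κ τ : ℝ, ∀ ξ η : Plane, 1 ≤ K → κ ≤ 1 → τ ≤ κ →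
      P.IsBad K κ τ ξ η → 1 ≤ C * (κ * K ^ 5) := by
  obtain ⟨D, hD, H⟩ := abs_curvPoly_le P
  refine ⟨(768 + 4 * D) / d, by positivity, fun K κ τ ξ η hK hκ1 hτ h => ?_⟩
  have hκ : 0 ≤ κ := (abs_nonneg _).trans h.curvature
  have hc := H K κ τ ξ η hK hτ h
  have hv := h.val
  have hnorm : ‖ξ - η‖ ≤ 2 * K := (norm_sub_le _ _).trans (by linarith [h.left, h.right])
  have l1 : energy P.c₁ ξ ≤ 3 * K := energy_le_of_norm_le P.le₁ hK (by linarith [h.left])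
  have l2 : energy P.c₂ (ξ - η) ≤ 3 * K := energy_le_of_norm_le P.le₂ hK hnorm
  have l3 : energy P.c₃ η ≤ 3 * K := energy_le_of_norm_le P.le₃ hK (by linarith [h.right])
  have b1 : 1 ≤ energy P.c₁ ξ := one_le_energy P.pos₁.le ξ
  have b3 : 1 ≤ energy P.c₃ η := one_le_energy P.pos₃.le η
  rw [PhaseData.val, hP.e₁_eq, hP.e₃_eq, hP.c₂_eq] at hv
  rw [hP.e₁_eq, hP.e₃_eq, hP.c₂_eq] at hc
  obtain ⟨hv, hc⟩ : |energy 1 (ξ - η) - (energy P.c₁ ξ + energy P.c₃ η)| ≤ τ ∧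
      |curvPoly P.c₁ 1 P.c₃ (-energy P.c₁ ξ) (energy P.c₁ ξ + energy P.c₃ η) (-energy P.c₃ η)|
        ≤ D * (κ * K ^ 5) := by
    rcases eq_or_eq_neg_of_abs_eq P.sign₂ with s | s
    · rw [s] at hv hc
      refine ⟨le_of_eq_of_le ?_ hv, le_of_eq_of_le ?_ hc⟩
      · congr 1; ring
      · congr 2 <;> ring
    · rw [s] at hv hc
      refine ⟨le_of_eq_of_le ?_ hv, le_of_eq_of_le ?_ hc⟩
      · rw [← abs_neg]; congr 1; ring
      · rw [← curvPoly_neg]; congr 2 <;> ring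
  have hl : energy 1 (ξ - η) ≤ 3 * K := hP.c₂_eq ▸ l2
  by_contra hlt
  rw [not_le, div_mul_eq_mul_div, div_lt_one hd] at hlt
  have hκK1 : κ * K ≤ κ * K ^ 5 := by gcongr; exact le_self_pow₀ hK (by norm_num)
  have hκK3 : κ * K ^ 3 ≤ κ * K ^ 5 := by gcongr; norm_num
  have hDκ : 0 ≤ D * (κ * K ^ 5) := by positivity
  have hκ5 : 0 ≤ κ * K ^ 5 := by positivity
  have hM : 1 ≤ 4 * K := by linarith
  have hδ0 : 0 ≤ 12 * (κ * K) := by positivity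
  have hδM : 4 * (12 * (κ * K)) * (4 * K) ^ 2 = 768 * (κ * K ^ 3) := by ring
  have e : ξ - η = ξ + -η := sub_eq_add_neg ξ η
  have e' : ξ - η = -η + ξ := by abel
  have hη : ∀ c, energy c (-η) = energy c η := fun c => energy_neg c η
  rcases hP.coeff with ⟨h1, h3⟩ | ⟨h1, h3⟩ | ⟨h1, h3⟩
  · rw [h1, h3] at hc hv
    have hc4 : |4 * curvPoly d 1 d (-energy d ξ) (energy d ξ + energy d η) (-energy d η)|
        ≤ 4 * (D * (κ * K ^ 5)) := by rw [abs_mul, abs_of_pos (by norm_num : (0:ℝ) < 4)]; gcongr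
    rw [← abs_neg, ← neg_mul, curvPoly_middle_ee hd.ne'] at hc4
    have r : 4 - d - 24 * (κ * K) ≤ (1 - d) * (energy d ξ + energy d η) ^ 2 := by
      have r0 := le_of_resonance_ee hd hK hκ1 hτ e hl (by rw [hη]; exact hv)
      have r1 := (abs_le.1 (abs_sq_sub_sq_le hK hκ1 hτ (energy_pos zero_le_one _).le
        (by linarith) hv)).2
      have r2 : (1 - d) * (energy 1 (ξ - η) ^ 2 - (energy d ξ + energy d η) ^ 2)
          ≤ 1 * (12 * (κ * K)) := by
        nlinarith
      linarith
    have := one_le_of_middle_ee hd hd1 (by linarith) r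
    linarith [(abs_le.1 hc4).2]
  · rw [h1, h3] at hc hv
    have hc4 : |4 * d * curvPoly 1 1 d (-energy 1 ξ) (energy 1 ξ + energy d η) (-energy d η)|
        ≤ 4 * d * (D * (κ * K ^ 5)) := by
      rw [abs_mul, abs_of_pos (by positivity : 0 < 4 * d)]; gcongr
    rw [← abs_neg, ← neg_mul, ← neg_mul, curvPoly_middle_be hd.ne'] at hc4
    have r := (le_of_resonance_be hd hd1 hK hκ1 hτ e (by rw [hη, ← h3]; exact l3)
      (by rw [hη, sub_sub]; exact hv)).2
    rw [hη] at r
    rw [h1] at b1 l1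
    rw [h3] at b3 l3
    have := le_of_middle_be hd hd1 hM hδ0 (b := energy 1 ξ) (c := energy d η) (by linarith)
      (by linarith) (by linarith) (by linarith) (by rw [hδM]; linarith) r
    have h5 : 4 * (D * (κ * K ^ 5)) < 1 := by linarith
    linarith [(abs_le.1 hc4).2, mul_lt_mul_of_pos_left h5 hd]
  · rw [h1, h3] at hc hv
    rw [add_comm] at hc
    have hc4 : |4 * d * curvPoly d 1 1 (-energy d ξ) (energy 1 η + energy d ξ) (-energy 1 η)|
        ≤ 4 * d * (D * (κ * K ^ 5)) := by
      rw [abs_mul, abs_of_pos (by positivity : 0 < 4 * d)]; gcongr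
    rw [← abs_neg, ← neg_mul, ← neg_mul, curvPoly_middle_eb hd.ne'] at hc4
    have r := (le_of_resonance_be hd hd1 hK hκ1 hτ e' (by rw [← h1]; exact l1)
      (by rw [hη, sub_sub, add_comm (energy 1 η)]; exact hv)).2
    rw [h1] at b1 l1
    rw [h3] at b3 l3
    have := le_of_middle_be hd hd1 hM hδ0 (b := energy 1 η) (c := energy d ξ) (by linarith)
      (by linarith) (by linarith) (by linarith) (by rw [hδM]; linarith) r
    have h5 : 4 * (D * (κ * K ^ 5)) < 1 := by linarith
    linarith [(abs_le.1 hc4).2, mul_lt_mul_of_pos_left h5 hd]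

lemma norm_sq_direction_sub {n : Plane} (hn : ‖n‖ = 1) (r β θ : ℝ) :
    ‖r • direction n θ - β • n‖ ^ 2 = r ^ 2 + β ^ 2 - 2 * (β * (r * Real.cos θ)) := by
  rw [norm_sub_sq_real, norm_smul, norm_smul, norm_direction hn, hn, mul_one, mul_one,
    inner_smul_left, inner_smul_right, inner_direction hn, Real.norm_eq_abs, Real.norm_eq_abs,
    sq_abs, sq_abs, conj_trivial]
  ring

/-- For fixed `η`, the resonant points `ξ` with small curvature lie in a thin sector. -/
lemma exists_cos_sub_le {d : ℝ} (hd : 0 < d) (hd1 : d < 1) {P : PhaseData}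
    (hP : P.IsLeft d) : ∃ C : ℝ, 0 ≤ C ∧ ∀ K κ τ : ℝ, ∀ n : Plane, ∀ β r r' θ θ' : ℝ,
      1 ≤ K → κ ≤ 1 → τ ≤ κ → ‖n‖ = 1 → 0 ≤ β → 0 < r → 0 < r' →
      P.IsBad K κ τ (r • direction n θ) (β • n) → P.IsBad K κ τ (r' • direction n θ') (β • n) →
      Real.cos θ - Real.cos θ' ≤ C * (κ * K ^ 15) := by
  obtain ⟨C₁, hC₁, H₁⟩ := exists_abs_energy_sub_le hd hd1 hP
  obtain ⟨C₂, hC₂, H₂⟩ := exists_one_le_of_isLeft hd hd1 hP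
  have hc2 := P.pos₂
  set B := 6 * C₁ + 3 * (C₁ + 2) / P.c₂ with hB
  refine ⟨4 + 2 * C₂ + C₂ * B, by positivity,
    fun K κ τ n β r r' θ θ' hK hκ1 hτ hn hβ hr hr' h h' => ?_⟩
  have hκ : 0 ≤ κ := (abs_nonneg _).trans h.curvature
  have hK15 : ∀ n ≤ 15, κ * K ^ n ≤ κ * K ^ 15 := fun n hn => by gcongr
  have hκ15 : 0 ≤ κ * K ^ 15 := by positivity
  have hcos : Real.cos θ - Real.cos θ' ≤ 2 := by
    linarith [Real.cos_le_one θ, Real.neg_one_le_cos θ']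
  by_cases hκ2 : κ ≤ 1 / 2
  swap
  · have h1 : κ ≤ κ * K ^ 15 := le_mul_of_one_le_right hκ (one_le_pow₀ hK)
    have h2 : 0 ≤ (2 * C₂ + C₂ * B) * (κ * K ^ 15) := by positivity
    linarith
  rcases le_total (Real.cos θ - Real.cos θ') 0 with hneg | hΔ
  · exact hneg.trans (by positivity)
  have l1 := energy_le_of_norm_le P.le₁ hK (by linarith [h.left] : ‖r • direction n θ‖ ≤ 2 * K)
  have l1' := energy_le_of_norm_le P.le₁ hK
    (by linarith [h'.left] : ‖r' • direction n θ'‖ ≤ 2 * K)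
  have l2 := energy_le_of_norm_le P.le₂ hK ((norm_sub_le _ _).trans (by
    linarith [h.left, h.right]) : ‖r • direction n θ - β • n‖ ≤ 2 * K)
  have l2' := energy_le_of_norm_le P.le₂ hK ((norm_sub_le _ _).trans (by
    linarith [h'.left, h'.right]) : ‖r' • direction n θ' - β • n‖ ≤ 2 * K)
  have b2 := one_le_energy P.pos₂.le (r • direction n θ - β • n)
  have b2' := one_le_energy P.pos₂.le (r' • direction n θ' - β • n)
  have b3 := one_le_energy P.pos₃.le (β • n)
  have q1 := energy_sq P.pos₁.le (r • direction n θ)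
  have q1' := energy_sq P.pos₁.le (r' • direction n θ')
  have q2 := energy_sq P.pos₂.le (r • direction n θ - β • n)
  have q2' := energy_sq P.pos₂.le (r' • direction n θ' - β • n)
  have v := abs_le.1 (hP.abs_energy_sub_le h)
  have v' := abs_le.1 (hP.abs_energy_sub_le h')
  have hdiff := abs_le.1 (H₁ K κ τ _ _ _ hK hκ1 hτ h h')
  have hone := H₂ K κ τ _ _ hK hτ h
  have hβK := h.right
  rw [norm_sq_direction_sub hn] at q2 q2'
  rw [norm_smul, norm_direction hn, mul_one, Real.norm_eq_abs, sq_abs, hP.c₁_eq, one_mul] at q1 q1'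
  rw [norm_smul, hn, mul_one, Real.norm_eq_abs, abs_of_nonneg hβ] at hone hβK
  rw [hP.c₁_eq] at l1 l1' v v' hdiff
  set a := energy 1 (r • direction n θ)
  set a' := energy 1 (r' • direction n θ')
  set c := energy P.c₂ (r • direction n θ - β • n)
  set c' := energy P.c₂ (r' • direction n θ' - β • n)
  set b := energy P.c₃ (β • n)
  have hX : κ ≤ κ * K ^ 8 := le_mul_of_one_le_right hκ (one_le_pow₀ hK)
  have ha : 3 / 2 ≤ a := by linarith
  have ha' : 3 / 2 ≤ a' := by linarith
  have hr1 : 1 ≤ r := (one_le_sq_iff₀ hr.le).1 (by nlinarith only [ha, q1])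
  have hr1' : 1 ≤ r' := (one_le_sq_iff₀ hr'.le).1 (by nlinarith only [ha', q1'])
  have hsq : ∀ x y Y : ℝ, 0 ≤ x → x ≤ 3 * K → 0 ≤ y → y ≤ 3 * K → |x - y| ≤ Y →
      |x ^ 2 - y ^ 2| ≤ 6 * K * Y := by
    intro x y Y hx hxK hy hyK hxy
    rw [sq_sub_sq, abs_mul, abs_of_nonneg (by linarith : 0 ≤ x + y)]
    gcongr
    linarith
  have s1 := abs_le.1 (hsq a a' (C₁ * (κ * K ^ 8)) (by linarith) l1 (by linarith) l1'
    (abs_le.2 hdiff))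
  have s2 := hsq c c' ((C₁ + 2) * (κ * K ^ 8)) (by linarith) l2 (by linarith) l2' (by
    rw [abs_le]; constructor <;> linarith [v.1, v.2, v'.1, v'.2, hdiff.1, hdiff.2])
  have s3 : |(c ^ 2 - c' ^ 2) / P.c₂| ≤ 6 * K * ((C₁ + 2) * (κ * K ^ 8)) / P.c₂ := by
    rw [abs_div, abs_of_pos hc2]; gcongr
  have hrr : |r - r'| ≤ 3 * K * (C₁ * (κ * K ^ 8)) := by
    have e : |r - r'| * (r + r') = |a ^ 2 - a' ^ 2| := by
      rw [q1, q1', ← abs_of_pos (by linarith : 0 < r + r'), ← abs_mul]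
      congr 1; ring
    have h1 : |r - r'| * 2 ≤ |r - r'| * (r + r') := by gcongr; linarith
    rw [e] at h1
    linarith [abs_le.2 s1]
  -- the law of cosines for the triangles with sides `ξ`, `η`, `ξ - η`
  have key : 2 * β * r * (Real.cos θ - Real.cos θ') =
      (a ^ 2 - a' ^ 2) - (c ^ 2 - c' ^ 2) / P.c₂ - 2 * β * Real.cos θ' * (r - r') := by
    have e : (c ^ 2 - c' ^ 2) / P.c₂ = (r ^ 2 + β ^ 2 - 2 * (β * (r * Real.cos θ)))
        - (r' ^ 2 + β ^ 2 - 2 * (β * (r' * Real.cos θ'))) := by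
      rw [q2, q2', div_eq_iff hc2.ne']; ring
    rw [e, q1, q1']; ring
  have s4 : |2 * β * Real.cos θ' * (r - r')| ≤ 2 * K * 1 * (3 * K * (C₁ * (κ * K ^ 8))) := by
    rw [abs_mul, abs_mul, abs_of_nonneg (by linarith : 0 ≤ 2 * β)]
    gcongr
    exact Real.abs_cos_le_one θ'
  have s5 : β * (Real.cos θ - Real.cos θ') ≤ B * (κ * K ^ 10) := by
    have h1 : 2 * (β * (Real.cos θ - Real.cos θ')) ≤ 2 * β * r * (Real.cos θ - Real.cos θ') := by
      have : 0 ≤ β * (Real.cos θ - Real.cos θ') := mul_nonneg hβ hΔ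
      nlinarith only [this, hr1]
    have h2 : κ * K ^ 9 ≤ κ * K ^ 10 := by gcongr; norm_num
    have e1 : 6 * K * (C₁ * (κ * K ^ 8)) ≤ 6 * C₁ * (κ * K ^ 10) := by
      calc _ = 6 * C₁ * (κ * K ^ 9) := by ring
        _ ≤ _ := by gcongr
    have e2 : 6 * K * ((C₁ + 2) * (κ * K ^ 8)) / P.c₂ ≤ 6 * (C₁ + 2) / P.c₂ * (κ * K ^ 10) := by
      calc _ = 6 * (C₁ + 2) / P.c₂ * (κ * K ^ 9) := by ring
        _ ≤ _ := by gcongr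
    have e4 : 2 * (B * (κ * K ^ 10)) = 6 * C₁ * (κ * K ^ 10) + 6 * (C₁ + 2) / P.c₂ * (κ * K ^ 10)
        + 6 * C₁ * (κ * K ^ 10) := by rw [hB]; ring
    linarith [(abs_le.1 s3).1, (abs_le.1 s4).1, s1.2]
  -- `hone` replaces the division by `β`: if `β` is small, then `κ` is not
  calc Real.cos θ - Real.cos θ' = 1 * (Real.cos θ - Real.cos θ') := (one_mul _).symm
    _ ≤ C₂ * K ^ 5 * (κ + β) * (Real.cos θ - Real.cos θ') := by gcongr
    _ = C₂ * K ^ 5 * κ * (Real.cos θ - Real.cos θ')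
        + C₂ * K ^ 5 * (β * (Real.cos θ - Real.cos θ')) := by ring
    _ ≤ C₂ * K ^ 5 * κ * 2 + C₂ * K ^ 5 * (B * (κ * K ^ 10)) := by gcongr
    _ = 2 * C₂ * (κ * K ^ 5) + C₂ * B * (κ * K ^ 15) := by ring
    _ ≤ 2 * C₂ * (κ * K ^ 15) + C₂ * B * (κ * K ^ 15) := by gcongr 2; exact hK15 5 (by norm_num)
    _ ≤ _ := by linarith

/-! ### Areas of the resonant sets -/

lemma hasDerivAt_energy_add_smul {c : ℝ} (hc : 0 ≤ c) (z u : Plane) (r : ℝ) :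
    HasDerivAt (fun r : ℝ => energy c (z + r • u)) ⟪velocity c (z + r • u), u⟫ r := by
  have h1 : HasDerivAt (fun r : ℝ => z + r • u) u r := by
    simpa using ((hasDerivAt_id r).smul_const u).const_add z
  exact (hasFDerivAt_energy hc (z + r • u)).comp_hasDerivAt r h1

/-- Where `energy 1 A` exceeds `energy c C` by a fixed amount, the corresponding speeds differ by
at least `O(R⁻³)`. -/
lemma lt_norm_velocity_sub {c R : ℝ} (hc : 0 < c) (hc1 : c ≤ 1) (hR : 1 ≤ R) {x y : Plane}
    (hx : ‖x‖ ≤ R) (hy : ‖y‖ ≤ 2 * R) (h : energy c y + 1 / 2 ≤ energy 1 x) :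
    1 / (80 * R ^ 3) < ‖velocity 1 x‖ - ‖velocity c y‖ := by
  have h1 := sq_norm_velocity zero_le_one x
  have h2 := sq_norm_velocity hc.le y
  have b1 := norm_velocity_le zero_le_one le_rfl x
  have b2 := norm_velocity_le hc.le hc1 y
  have l1 : energy 1 x ≤ 2 * R := (energy_le le_rfl x).trans (by linarith)
  have l2 : energy c y ≤ 3 * R := energy_le_of_norm_le hc1 hR hy
  have p1 := energy_pos zero_le_one x
  have p2 := one_le_energy hc.le y
  have n1 := norm_nonneg (velocity 1 x)
  set a := energy 1 x
  set e := energy c y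
  set v := ‖velocity 1 x‖
  set w := ‖velocity c y‖
  have hdiff : 1 / e ^ 2 - 1 / a ^ 2 ≤ v ^ 2 - w ^ 2 := by
    rw [h1, h2]
    nlinarith
  have hlow : 1 / (36 * R ^ 3) ≤ 1 / e ^ 2 - 1 / a ^ 2 := by
    have e1 : 1 / e ^ 2 - 1 / a ^ 2 = (a - e) * (a + e) / (e ^ 2 * a ^ 2) := by
      field_simp; ring
    rw [e1, div_le_div_iff₀ (by positivity) (by positivity)]
    have h3 : e ^ 2 * a ≤ (3 * R) ^ 2 * (2 * R) := by gcongr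
    have h4 : 1 / 2 * a ≤ (a - e) * (a + e) := by
      have : 1 / 2 * (a + e) ≤ (a - e) * (a + e) := by gcongr; linarith
      linarith
    calc 1 * (e ^ 2 * a ^ 2) = (e ^ 2 * a) * a := by ring
      _ ≤ ((3 * R) ^ 2 * (2 * R)) * a := by gcongr
      _ = (1 / 2 * a) * (36 * R ^ 3) := by ring
      _ ≤ _ := by gcongr
  have hpos : 0 < 1 / (36 * R ^ 3) := by positivity
  have hvw0 : 0 ≤ v - w := by
    by_contra hlt
    rw [not_le] at hlt
    have : (v - w) * (v + w) ≤ 0 := mul_nonpos_of_nonpos_of_nonneg hlt.le (by linarith)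
    linarith
  have h5 : (v - w) * (v + w) ≤ (v - w) * 2 := by gcongr; linarith
  have e2 : 1 / (80 * R ^ 3) = 36 / 80 * (1 / (36 * R ^ 3)) := by field_simp
  rw [e2]
  linarith

/-- The set where `energy 1 A = b + energy c (A - B)` up to an error `τ` is thin in the radial
direction. -/
lemma radial_sub_le {c b τ R : ℝ} (hc : 0 < c) (hc1 : c ≤ 1) (hb : 1 ≤ b) (hτ : τ ≤ 1 / 2)
    (hR : 1 ≤ R) {B u : Plane} (hB : ‖B‖ ≤ R) (hu : ‖u‖ = 1) {r r' : ℝ} (hr : 0 < r)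
    (hrr : r ≤ r') (hr' : ‖r' • u‖ ≤ R)
    (h : |energy 1 (r • u) - (b + energy c (r • u - B))| ≤ τ)
    (h' : |energy 1 (r' • u) - (b + energy c (r' • u - B))| ≤ τ) :
    r' - r ≤ 160 * R ^ 3 * τ := by
  have hR3 : 0 < 80 * R ^ 3 := by positivity
  have hn : ∀ x : ℝ, 0 ≤ x → ‖x • u‖ = x := fun x hx => by
    rw [norm_smul, hu, mul_one, Real.norm_eq_abs, abs_of_nonneg hx]
  rw [hn r' (hr.le.trans hrr)] at hr'
  have key := add_mul_sub_le_of_deriv (δ := 1 / 2) (c := 1 / (80 * R ^ 3))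
    (h := fun x => energy 1 (x • u) - energy c (x • u - B))
    (h' := fun x => ⟪velocity 1 (x • u), u⟫ - ⟪velocity c (x • u - B), u⟫) hrr (by positivity)
    (fun x _ => by
      have h1 := hasDerivAt_energy_add_smul zero_le_one 0 u x
      have h2 := hasDerivAt_energy_add_smul hc.le (-B) u x
      simp only [zero_add] at h1
      simp only [neg_add_eq_sub] at h2
      exact h1.sub h2)
    (fun x hx hδ => by
      have hx0 : 0 < x := hr.trans_le hx.1
      have hxR : ‖x • u‖ ≤ R := by rw [hn x hx0.le]; exact hx.2.trans hr'
      have h1 := lt_norm_velocity_sub hc hc1 hR hxR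
        ((norm_sub_le _ _).trans (by linarith) : ‖x • u - B‖ ≤ 2 * R) (by linarith)
      have h2 : ⟪velocity 1 (x • u), u⟫ = ‖velocity 1 (x • u)‖ := by
        have he := energy_pos zero_le_one (x • u)
        rw [velocity, norm_smul, hn x hx0.le, inner_smul_left, inner_smul_left,
          real_inner_self_eq_norm_sq, hu, conj_trivial, conj_trivial, Real.norm_eq_abs,
          abs_of_pos (by positivity)]
        ring
      have h3 := real_inner_le_norm (velocity c (x • u - B)) u
      rw [hu, mul_one] at h3
      linarith)
    (by linarith [(abs_le.1 h).1])
  have h3 : 1 / (80 * R ^ 3) * (r' - r) ≤ 2 * τ := by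
    linarith [(abs_le.1 h).1, (abs_le.1 h').2]
  rw [one_div, inv_mul_le_iff₀ hR3] at h3
  linarith

/-- Area of the set where `energy 1 A = b + energy c (A - B)` up to an error `τ`. -/
lemma volume_diff_le {c b τ R : ℝ} (hc : 0 < c) (hc1 : c ≤ 1) (hb : 1 ≤ b) (hτ : τ ≤ 1 / 2)
    (hR : 1 ≤ R) {B : Plane} (hB : ‖B‖ ≤ R) :
    volume {A : Plane | ‖A‖ ≤ R ∧ |energy 1 A - (b + energy c (A - B))| ≤ τ} ≤
      ENNReal.ofReal (1100 * τ * R ^ 4) := by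
  rcases lt_or_ge τ 0 with hτ0 | hτ0
  · have : {A : Plane | ‖A‖ ≤ R ∧ |energy 1 A - (b + energy c (A - B))| ≤ τ} = ∅ := by
      ext A
      simp only [Set.mem_ofPred_eq, Set.mem_empty_iff_false, iff_false, not_and, not_le]
      exact fun _ => hτ0.trans_le (abs_nonneg _)
    rw [this]; simp
  have c1 : Continuous (energy 1) := (contDiff_energy zero_le_one (n := 0)).continuous
  have c2 : Continuous (energy c) := (contDiff_energy hc.le (n := 0)).continuous
  have hcont : Continuous fun A : Plane => |energy 1 A - (b + energy c (A - B))| := by fun_prop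
  have hE : MeasurableSet {A : Plane | ‖A‖ ≤ R ∧ |energy 1 A - (b + energy c (A - B))| ≤ τ} :=
    (isClosed_le continuous_norm continuous_const).measurableSet.inter
      (isClosed_le hcont continuous_const).measurableSet
  obtain ⟨n, hn⟩ : ∃ n : Plane, ‖n‖ = 1 := ⟨EuclideanSpace.single 0 1, by simp⟩
  refine (volume_le_of_polar_slices hE hn (L := 160 * R ^ 3 * τ) (Θ := Set.univ)
    (fun x hx => hx.1) (fun u hu r r' hr hrr h h' =>
      radial_sub_le hc hc1 hb hτ hR hB hu hr hrr h'.1 h.2 h'.2) (fun _ _ _ _ _ => trivial)).trans ?_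
  rw [Set.univ_inter, Real.volume_Ioo, ← ENNReal.ofReal_mul (by linarith),
    ← ENNReal.ofReal_mul (by positivity)]
  refine ENNReal.ofReal_le_ofReal ?_
  calc R * (160 * R ^ 3 * τ) * (Real.pi - -Real.pi) = 320 * Real.pi * τ * R ^ 4 := by ring
    _ ≤ 320 * 3.15 * τ * R ^ 4 := by gcongr; exact Real.pi_lt_d2.le
    _ ≤ 1100 * τ * R ^ 4 := by gcongr; norm_num

/-- The minimizer of `B ↦ energy c B + energy c' (A - B)`. -/
lemma exists_velocity_eq {c c' : ℝ} (hc : 0 ≤ c) (hc' : 0 ≤ c') (A : Plane) :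
    ∃ z : Plane, ‖z‖ ≤ ‖A‖ ∧ velocity c z = velocity c' (A - z) := by
  have v1 : Continuous (velocity c) := (contDiff_velocity hc (n := 0)).continuous
  have v2 : Continuous (velocity c') := (contDiff_velocity hc' (n := 0)).continuous
  have hg : ContinuousOn
      (fun s : ℝ => ⟪velocity c (s • A) - velocity c' (A - s • A), A⟫) (Set.Icc 0 1) := by
    fun_prop
  have hpos : ∀ c : ℝ, 0 ≤ c → 0 ≤ ⟪velocity c A, A⟫ := fun c hc => by
    have := energy_pos hc A
    rw [velocity, inner_smul_left, real_inner_self_eq_norm_sq, conj_trivial]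
    positivity
  have h0 : velocity c 0 = 0 ∧ velocity c' 0 = 0 := by simp [velocity]
  obtain ⟨s, hs, hs0⟩ := intermediate_value_Icc zero_le_one hg (show (0 : ℝ) ∈ _ by
    simp only [zero_smul, sub_zero, one_smul, sub_self, h0.1, h0.2, zero_sub, inner_neg_left]
    exact ⟨by linarith [hpos c' hc'], hpos c hc⟩)
  refine ⟨s • A, ?_, ?_⟩
  · rw [norm_smul, Real.norm_eq_abs, abs_of_nonneg hs.1]
    exact mul_le_of_le_one_left (norm_nonneg _) hs.2
  · have e : velocity c (s • A) - velocity c' (A - s • A)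
        = (c / energy c (s • A) * s - c' / energy c' (A - s • A) * (1 - s)) • A := by
      rw [velocity, velocity]; module
    dsimp only at hs0
    rw [e, inner_smul_left, conj_trivial] at hs0
    rw [← sub_eq_zero, e]
    rcases mul_eq_zero.1 hs0 with h | h
    · rw [h, zero_smul]
    · rw [inner_self_eq_zero.1 h, smul_zero]

/-- Area of the set where `energy c B + energy c' (A - B) = a` up to an error `τ`, by strict
convexity of the left side. -/
lemma volume_sum_le {c c' a τ R : ℝ} (hc : 0 < c) (hc1 : c ≤ 1) (hc' : 0 < c') (hR : 1 ≤ R)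
    {A : Plane} (hA : ‖A‖ ≤ R) :
    volume {B : Plane | ‖B‖ ≤ R ∧ |a - (energy c B + energy c' (A - B))| ≤ τ} ≤
      ENNReal.ofReal (1700 / c * τ * R ^ 4) := by
  rcases lt_or_ge τ 0 with hτ0 | hτ0
  · have : {B : Plane | ‖B‖ ≤ R ∧ |a - (energy c B + energy c' (A - B))| ≤ τ} = ∅ := by
      ext A
      simp only [Set.mem_ofPred_eq, Set.mem_empty_iff_false, iff_false, not_and, not_le]
      exact fun _ => hτ0.trans_le (abs_nonneg _)
    rw [this]; simp
  have c1 : Continuous (energy c) := (contDiff_energy hc.le (n := 0)).continuous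
  have c2 : Continuous (energy c') := (contDiff_energy hc'.le (n := 0)).continuous
  have hcont : Continuous fun B : Plane => |a - (energy c B + energy c' (A - B))| := by fun_prop
  have hE : MeasurableSet {B : Plane | ‖B‖ ≤ R ∧ |a - (energy c B + energy c' (A - B))| ≤ τ} :=
    (isClosed_le continuous_norm continuous_const).measurableSet.inter
      (isClosed_le hcont continuous_const).measurableSet
  obtain ⟨z, hzA, hz⟩ := exists_velocity_eq hc.le hc'.le A
  refine (volume_le_of_polar_slices_sq hE z (L := 4 * τ * (4 * R) ^ 3 / c)
    fun u hu r r' hr hrr h h' => ?_).trans ?_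
  · have hr'R : r' ≤ 2 * R := by
      have h1 := norm_sub_le (z + r' • u) z
      rw [add_sub_cancel_left, norm_smul, hu, mul_one, Real.norm_eq_abs,
        abs_of_pos (hr.trans_le hrr)] at h1
      linarith [h'.1]
    set k := c / (4 * R) ^ 3 with hk
    have hd : ∀ x, HasDerivAt (fun x : ℝ => energy c (z + x • u) + energy c' (A - (z + x • u))
        - k / 2 * x ^ 2) (⟪velocity c (z + x • u), u⟫ + ⟪velocity c' (A - z + x • (-u)), -u⟫
          - k * x) x := by
      intro x
      have d1 := hasDerivAt_energy_add_smul hc.le z u x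
      have d2 := hasDerivAt_energy_add_smul hc'.le (A - z) (-u) x
      have e : (fun x : ℝ => energy c' (A - (z + x • u)))
          = fun x : ℝ => energy c' (A - z + x • (-u)) := by
        ext x; congr 1; module
      have d3 : HasDerivAt (fun x : ℝ => k / 2 * x ^ 2) (k * x) x := by
        refine ((hasDerivAt_pow 2 x).const_mul (k / 2)).congr_deriv ?_
        simp; ring
      rw [← e] at d2
      exact (d1.add d2).sub d3
    have hmono := monotoneOn_of_deriv_nonneg (convex_Icc r r')
      (fun x _ => (hd x).continuousAt.continuousWithinAt)
      (fun x _ => (hd x).differentiableAt.differentiableWithinAt) (fun x hx => by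
        rw [interior_Icc] at hx
        have hx0 : 0 < x := hr.trans hx.1
        have hxu : ‖x • u‖ = x := by
          rw [norm_smul, hu, mul_one, Real.norm_eq_abs, abs_of_pos hx0]
        rw [(hd x).deriv]
        have l1 : energy c (z + x • u) ≤ 4 * R := by
          refine (energy_le hc1 _).trans ?_
          have := norm_add_le z (x • u)
          linarith [hx.2]
        have l2 : energy c z ≤ 4 * R := (energy_le hc1 _).trans (by linarith)
        have m1 := inner_velocity_sub_ge hc.le (z + x • u) z l1 l2
        have p1 := energy_pos hc'.le (A - z + x • (-u))
        have p2 := energy_pos hc'.le (A - z)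
        have m2 := inner_velocity_sub_ge hc'.le (A - z + x • (-u)) (A - z)
          (le_add_of_nonneg_right p2.le) (le_add_of_nonneg_left p1.le)
        rw [add_sub_cancel_left, hxu, inner_smul_right, inner_sub_left, ← hk] at m1
        rw [add_sub_cancel_left, inner_smul_right, inner_sub_left, ← hz] at m2
        have m3 : 0 ≤ c' / (energy c' (A - z + x • (-u)) + energy c' (A - z)) ^ 3 *
          ‖x • (-u)‖ ^ 2 := by positivity
        have m4 := nonneg_of_mul_nonneg_right (m3.trans m2) hx0
        have m5 : k * x ≤ ⟪velocity c (z + x • u), u⟫ - ⟪velocity c z, u⟫ := by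
          refine le_of_mul_le_mul_left ?_ hx0
          calc x * (k * x) = k * x ^ 2 := by ring
            _ ≤ _ := m1
        rw [inner_neg_right (velocity c z)] at m4
        linarith)
    have h3 := hmono (Set.left_mem_Icc.2 hrr) (Set.right_mem_Icc.2 hrr) hrr
    dsimp only at h3
    have h4 : k / 2 * (r' ^ 2 - r ^ 2) ≤ 2 * τ := by
      linarith [(abs_le.1 h.2).2, (abs_le.1 h'.2).1]
    rw [le_div_iff₀ hc]
    have h5 : k * (4 * R) ^ 3 = c := by rw [hk]; field_simp
    calc (r' ^ 2 - r ^ 2) * c = 2 * (k / 2 * (r' ^ 2 - r ^ 2)) * (4 * R) ^ 3 := by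
          rw [← h5]; ring
      _ ≤ 2 * (2 * τ) * (4 * R) ^ 3 := by gcongr
      _ = _ := by ring
  · refine ENNReal.ofReal_le_ofReal ?_
    have h1 : R ^ 3 ≤ R ^ 4 := pow_le_pow_right₀ hR (by norm_num)
    calc 2 * Real.pi * (4 * τ * (4 * R) ^ 3 / c) = 512 * Real.pi * (τ / c) * R ^ 3 := by ring
      _ ≤ 512 * 3.15 * (τ / c) * R ^ 4 := by gcongr; exact Real.pi_lt_d2.le
      _ ≤ 1700 * (τ / c) * R ^ 4 := by gcongr; norm_num
      _ = _ := by ring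

/-! ### Area bounds for phases with resonances -/

namespace PhaseData

/-- The points of the ball of radius `K` at which the phase is at most `τ`. -/
structure IsResonant (P : PhaseData) (K τ : ℝ) (ξ η : Plane) : Prop where
  left : ‖ξ‖ ≤ K
  right : ‖η‖ ≤ K
  val : |P.val ξ η| ≤ τ

/-- Area bounds for the slices of the resonant set and of its part with small curvature; for the
latter, only one of the two families of slices gains a power of `κ`. -/
def HasArea (P : PhaseData) : Prop :=
  ∃ C : ℝ, 0 ≤ C ∧ ∀ K τ : ℝ, 1 ≤ K → 0 ≤ τ → τ ≤ 1 / 2 →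
    (∀ η, volume {ξ | P.IsResonant K τ ξ η} ≤ ENNReal.ofReal (C * τ * K ^ 4)) ∧
    (∀ ξ, volume {η | P.IsResonant K τ ξ η} ≤ ENNReal.ofReal (C * τ * K ^ 4)) ∧
    ∀ κ, τ ≤ κ → κ ≤ 1 →
      (∀ η, volume {ξ | P.IsBad K κ τ ξ η} ≤ ENNReal.ofReal (C * τ * K ^ 12 * √κ)) ∨
      (∀ ξ, volume {η | P.IsBad K κ τ ξ η} ≤ ENNReal.ofReal (C * τ * K ^ 12 * √κ))

variable {P : PhaseData} {d K κ τ : ℝ} {ξ η : Plane}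

lemma IsBad.isResonant (h : P.IsBad K κ τ ξ η) : P.IsResonant K τ ξ η :=
  ⟨h.left, h.right, h.val⟩

lemma isResonant_swap : P.swap.IsResonant K τ η ξ ↔ P.IsResonant K τ ξ η := by
  constructor
  · rintro ⟨h1, h2, h3⟩
    exact ⟨h2, h1, by rwa [swap_val] at h3⟩
  · rintro ⟨h1, h2, h3⟩
    exact ⟨h2, h1, by rwa [swap_val]⟩

lemma isBad_swap : P.swap.IsBad K κ τ η ξ ↔ P.IsBad K κ τ ξ η := by
  constructor
  · rintro ⟨h1, h2, h3, h4⟩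
    exact ⟨h2, h1, by rwa [swap_val] at h3, by rwa [swap_curvature] at h4⟩
  · rintro ⟨h1, h2, h3, h4⟩
    exact ⟨h2, h1, by rwa [swap_val], by rwa [swap_curvature]⟩

lemma HasArea.of_swap (h : P.swap.HasArea) : P.HasArea := by
  obtain ⟨C, hC, H⟩ := h
  refine ⟨C, hC, fun K τ hK h0 h1 => ?_⟩
  obtain ⟨H1, H2, H3⟩ := H K τ hK h0 h1
  simp only [isResonant_swap, isBad_swap] at H1 H2 H3
  exact ⟨H2, H1, fun κ h1 h2 => (H3 κ h1 h2).symm⟩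

lemma isClosed_isResonant_left (P : PhaseData) (K τ : ℝ) (η : Plane) :
    IsClosed {ξ | P.IsResonant K τ ξ η} := by
  have h1 : Continuous fun ξ => P.val ξ η := (contDiff_left (P.contDiff_val (n := 0)) η).continuous
  have e : {ξ | P.IsResonant K τ ξ η} = {ξ | ‖ξ‖ ≤ K} ∩ {ξ | ‖η‖ ≤ K} ∩ {ξ | |P.val ξ η| ≤ τ} := by
    ext ξ
    exact ⟨fun h => ⟨⟨h.left, h.right⟩, h.val⟩, fun h => ⟨h.1.1, h.1.2, h.2⟩⟩
  rw [e]
  exact ((isClosed_le continuous_norm continuous_const).inter isClosed_const).inter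
    (isClosed_le h1.abs continuous_const)

lemma isClosed_isBad_left (P : PhaseData) (K κ τ : ℝ) (η : Plane) :
    IsClosed {ξ | P.IsBad K κ τ ξ η} := by
  have h1 : Continuous fun ξ => P.curvature ξ η :=
    (contDiff_left (P.contDiff_curvature (n := 0)) η).continuous
  have e : {ξ | P.IsBad K κ τ ξ η} = {ξ | P.IsResonant K τ ξ η} ∩ {ξ | |P.curvature ξ η| ≤ κ} := by
    ext ξ
    exact ⟨fun h => ⟨h.isResonant, h.curvature⟩, fun h => ⟨h.1.left, h.1.right, h.1.val, h.2⟩⟩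
  rw [e]
  exact (P.isClosed_isResonant_left K τ η).inter (isClosed_le h1.abs continuous_const)

lemma IsLeft.abs_val (hP : P.IsLeft d) (ξ η : Plane) :
    |P.val ξ η| = |energy 1 ξ - (energy P.c₃ η + energy P.c₂ (ξ - η))| := by
  rw [← sub_sub, PhaseData.val, hP.e₂_eq, hP.e₃_eq, hP.c₁_eq]
  rcases eq_or_eq_neg_of_abs_eq P.sign₁ with s | s
  · rw [s]; congr 1; ring
  · rw [s, ← abs_neg]; congr 1; ring

lemma IsMiddle.abs_val (hP : P.IsMiddle d) (ξ η : Plane) :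
    |P.val ξ η| = |energy 1 (ξ - η) - (energy P.c₃ η + energy P.c₁ ξ)| := by
  rw [← sub_sub, PhaseData.val, hP.e₁_eq, hP.e₃_eq, hP.c₂_eq]
  rcases eq_or_eq_neg_of_abs_eq P.sign₂ with s | s
  · rw [s]; congr 1; ring
  · rw [s, ← abs_neg]; congr 1; ring

lemma IsMiddle.swap (hP : P.IsMiddle d) : P.swap.IsMiddle d where
  c₂_eq := hP.c₂_eq
  e₁_eq := hP.e₃_eq
  e₃_eq := hP.e₁_eq
  coeff := by
    rcases hP.coeff with h | h | h
    · exact Or.inl h.symm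
    · exact Or.inr (Or.inr h.symm)
    · exact Or.inr (Or.inl h.symm)

lemma IsLeft.volume_isResonant_left_le (hP : P.IsLeft d) (hK : 1 ≤ K) (hτ : τ ≤ 1 / 2)
    (η : Plane) : volume {ξ | P.IsResonant K τ ξ η} ≤ ENNReal.ofReal (1100 * τ * K ^ 4) := by
  by_cases hη : ‖η‖ ≤ K
  · refine (measure_mono fun ξ h => ?_).trans
      (volume_diff_le P.pos₂ P.le₂ (one_le_energy P.pos₃.le η) hτ hK hη)
    exact ⟨h.left, (hP.abs_val ξ η).symm.le.trans h.val⟩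
  · exact (measure_mono (t := ∅) fun ξ h => hη h.right).trans (by simp)

lemma IsLeft.volume_isResonant_right_le (hP : P.IsLeft d) (hK : 1 ≤ K)
    (ξ : Plane) : volume {η | P.IsResonant K τ ξ η} ≤ ENNReal.ofReal (1700 / P.c₃ * τ * K ^ 4) := by
  by_cases hξ : ‖ξ‖ ≤ K
  · refine (measure_mono fun η h => ?_).trans
      (volume_sum_le (a := energy 1 ξ) P.pos₃ P.le₃ P.pos₂ hK hξ)
    exact ⟨h.right, (hP.abs_val ξ η).symm.le.trans h.val⟩
  · exact (measure_mono (t := ∅) fun η h => hξ h.left).trans (by simp)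

lemma IsMiddle.volume_isResonant_left_le (hP : P.IsMiddle d) (hK : 1 ≤ K) (hτ : τ ≤ 1 / 2)
    (η : Plane) : volume {ξ | P.IsResonant K τ ξ η} ≤ ENNReal.ofReal (17600 * τ * K ^ 4) := by
  by_cases hη : ‖η‖ ≤ K
  · have h1 := volume_diff_le P.pos₁ P.le₁ (one_le_energy P.pos₃.le η) hτ
      (by linarith : 1 ≤ 2 * K) (B := -η) (by rw [norm_neg]; linarith)
    rw [← measure_preimage_add_right volume (-η)] at h1
    refine (measure_mono fun ξ h => ?_).trans (h1.trans_eq (by congr 1; ring))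
    rw [Set.mem_preimage, Set.mem_ofPred_eq, sub_neg_eq_add, neg_add_cancel_right,
      ← sub_eq_add_neg, ← hP.abs_val ξ η]
    exact ⟨(norm_sub_le _ _).trans (by linarith [h.left]), h.val⟩
  · exact (measure_mono (t := ∅) fun ξ h => hη h.right).trans (by simp)

/-- The resonant points `ξ` with small curvature lie in a thin sector, and on each ray within a
short interval. -/
lemma IsLeft.exists_volume_isBad_le (hd : 0 < d) (hd1 : d < 1) (hP : P.IsLeft d) :
    ∃ C : ℝ, 0 ≤ C ∧ ∀ K κ τ : ℝ, 1 ≤ K → 0 ≤ τ → τ ≤ 1 / 2 → τ ≤ κ → κ ≤ 1 → ∀ η,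
      volume {ξ | P.IsBad K κ τ ξ η} ≤ ENNReal.ofReal (C * τ * K ^ 12 * √κ) := by
  obtain ⟨C, hC, H⟩ := exists_cos_sub_le hd hd1 hP
  refine ⟨320 * Real.pi * √C, by positivity, fun K κ τ hK hτ0 hτ hτκ hκ1 η => ?_⟩
  by_cases hη : ‖η‖ ≤ K
  swap
  · exact (measure_mono (t := ∅) fun ξ h => hη h.right).trans (by simp)
  have hκ : 0 ≤ κ := hτ0.trans hτκ
  obtain ⟨n, hn, hηn⟩ : ∃ n : Plane, ‖n‖ = 1 ∧ η = ‖η‖ • n := by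
    rcases eq_or_ne η 0 with rfl | h
    · exact ⟨EuclideanSpace.single 0 1, by simp, by simp⟩
    · have h' : ‖η‖ ≠ 0 := norm_ne_zero_iff.2 h
      refine ⟨‖η‖⁻¹ • η, ?_, ?_⟩
      · rw [norm_smul, norm_inv, norm_norm, inv_mul_cancel₀ h']
      · rw [smul_smul, mul_inv_cancel₀ h', one_smul]
  refine (volume_le_of_polar_slices (P.isClosed_isBad_left K κ τ η).measurableSet hn
    (R := K) (L := 160 * K ^ 3 * τ)
    (Θ := {θ | ∃ r : ℝ, 0 < r ∧ P.IsBad K κ τ (r • direction n θ) η})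
    (fun x hx => hx.left) (fun u hu r r' hr hrr h h' => ?_) (fun θ _ r hr h => ⟨r, hr, h⟩)).trans ?_
  · have h1 := (hP.abs_val (r • u) η).symm.le.trans h.val
    have h2 := (hP.abs_val (r' • u) η).symm.le.trans h'.val
    exact radial_sub_le P.pos₂ P.le₂ (one_le_energy P.pos₃.le η) hτ hK hη hu hr hrr h'.left h1 h2
  · refine (mul_le_mul_right (volume_angles_le (L := C * (κ * K ^ 15)) ?_) _).trans ?_
    · rintro θ ⟨r, hr, h⟩ θ' ⟨r', hr', h'⟩
      rw [hηn] at h h'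
      exact H K κ τ n ‖η‖ r r' θ θ' hK hκ1 hτκ hn (norm_nonneg _) hr hr' h h'
    · rw [← ENNReal.ofReal_mul (by linarith), ← ENNReal.ofReal_mul (by positivity)]
      refine ENNReal.ofReal_le_ofReal ?_
      have h1 : √(C * (κ * K ^ 15)) ≤ √C * (√κ * K ^ 8) := by
        rw [Real.sqrt_mul hC, Real.sqrt_mul hκ]
        gcongr
        rw [Real.sqrt_le_left (by positivity), ← pow_mul]
        exact pow_le_pow_right₀ hK (by norm_num)
      calc K * (160 * K ^ 3 * τ) * (2 * Real.pi * √(C * (κ * K ^ 15)))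
          ≤ K * (160 * K ^ 3 * τ) * (2 * Real.pi * (√C * (√κ * K ^ 8))) := by gcongr
        _ = _ := by ring

lemma IsLeft.hasArea (hd : 0 < d) (hd1 : d < 1) (hP : P.IsLeft d) : P.HasArea := by
  obtain ⟨C, hC, H⟩ := hP.exists_volume_isBad_le hd hd1
  have h3 := P.pos₃
  refine ⟨C + 1100 + 1700 / P.c₃, by positivity, fun K τ hK h0 h1 => ⟨fun η => ?_, fun ξ => ?_,
    fun κ hτκ hκ1 => Or.inl fun η => (H K κ τ hK h0 h1 hτκ hκ1 η).trans ?_⟩⟩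
  · refine (hP.volume_isResonant_left_le hK h1 η).trans (ENNReal.ofReal_le_ofReal ?_)
    gcongr
    have : 0 ≤ 1700 / P.c₃ := by positivity
    linarith
  · refine (hP.volume_isResonant_right_le hK ξ).trans (ENNReal.ofReal_le_ofReal ?_)
    gcongr
    linarith
  · refine ENNReal.ofReal_le_ofReal ?_
    gcongr
    have : 0 ≤ 1700 / P.c₃ := by positivity
    linarith

lemma IsMiddle.hasArea (hd : 0 < d) (hd1 : d < 1) (hP : P.IsMiddle d) : P.HasArea := by
  obtain ⟨C, hC, H⟩ := exists_one_le_of_isMiddle hd hd1 hP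
  refine ⟨17600 * (1 + √C), by positivity, fun K τ hK h0 h1 => ?_⟩
  have hle : 17600 * τ * K ^ 4 ≤ 17600 * (1 + √C) * τ * K ^ 4 := by
    gcongr
    have := Real.sqrt_nonneg C
    linarith
  refine ⟨fun η => (hP.volume_isResonant_left_le hK h1 η).trans (ENNReal.ofReal_le_ofReal hle),
    fun ξ => ?_, fun κ hτκ hκ1 => Or.inl fun η => ?_⟩
  · have h2 := hP.swap.volume_isResonant_left_le hK h1 ξ
    simp only [isResonant_swap] at h2
    exact h2.trans (ENNReal.ofReal_le_ofReal hle)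
  -- a point with small curvature exists only if `κ K⁵` is not small; then `√κ` costs nothing
  · rcases Set.eq_empty_or_nonempty {ξ | P.IsBad K κ τ ξ η} with he | ⟨ξ₀, h⟩
    · rw [he]; simp
    have hκ : 0 ≤ κ := h0.trans hτκ
    have hone := H K κ τ ξ₀ η hK hκ1 hτκ h
    refine (measure_mono fun ξ hξ => hξ.isResonant).trans
      ((hP.volume_isResonant_left_le hK h1 η).trans (ENNReal.ofReal_le_ofReal ?_))
    have h2 : 1 ≤ √C * (√κ * K ^ 3) := by
      refine (Real.one_le_sqrt.2 hone).trans ?_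
      rw [Real.sqrt_mul hC, Real.sqrt_mul hκ]
      gcongr
      rw [Real.sqrt_le_left (by positivity), ← pow_mul]
      exact pow_le_pow_right₀ hK (by norm_num)
    calc 17600 * τ * K ^ 4 ≤ 17600 * τ * K ^ 4 * (√C * (√κ * K ^ 3)) :=
          le_mul_of_one_le_right (by positivity) h2
      _ = 17600 * √C * τ * K ^ 7 * √κ := by ring
      _ ≤ 17600 * (1 + √C) * τ * K ^ 12 * √κ := by
        gcongr
        · linarith
        · norm_num

end PhaseData

/-! ### Area bounds for all phases -/

lemma energy_mono {c c' : ℝ} (h : c ≤ c') (v : Plane) : energy c v ≤ energy c' v := by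
  rw [energy, energy]
  gcongr

/-- The triangle inequality for masses: an energy with the smallest coefficient cannot be the sum
of the two others. -/
lemma one_le_energy_add_sub {a b c K : ℝ} (ha : 0 < a) (hab : a ≤ b) (hac : a ≤ c) (hb1 : b ≤ 1)
    (hc1 : c ≤ 1) (hK : 1 ≤ K) {B C : Plane} (hB : ‖B‖ ≤ 2 * K) (hC : ‖C‖ ≤ 2 * K)
    (hA : ‖B + C‖ ≤ 2 * K) :
    1 ≤ 3 * K * (energy b B + energy c C - energy a (B + C)) := by
  have h1 := four_add_le_sq_energy_add ha.le B C
  have h2 := energy_sq ha.le (B + C)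
  have h3 := energy_mono hab B
  have h4 := energy_mono hac C
  have p1 := energy_pos ha.le B
  have p2 := energy_pos ha.le C
  have p3 := energy_pos ha.le (B + C)
  have l1 := energy_le_of_norm_le hb1 hK hB
  have l2 := energy_le_of_norm_le hc1 hK hC
  have l3 := energy_le_of_norm_le (hab.trans hb1) hK hA
  have h5 : (energy a B + energy a C) ^ 2 ≤ (energy b B + energy c C) ^ 2 := by gcongr
  have h6 : 3 ≤ (energy b B + energy c C - energy a (B + C)) *
      (energy b B + energy c C + energy a (B + C)) := by linarith
  have h7 : 0 < energy b B + energy c C + energy a (B + C) := by linarith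
  have h8 : 0 < energy b B + energy c C - energy a (B + C) := by
    by_contra h
    have := mul_nonpos_of_nonpos_of_nonneg (not_lt.1 h) h7.le
    linarith
  have h9 : 3 ≤ (energy b B + energy c C - energy a (B + C)) * (9 * K) := by
    refine h6.trans ?_
    gcongr
    linarith
  linarith

lemma volume_norm_le_le {K : ℝ} (hK : 0 ≤ K) :
    volume {v : Plane | ‖v‖ ≤ K} ≤ ENNReal.ofReal (4 * K ^ 2) := by
  have e : {v : Plane | ‖v‖ ≤ K} = Metric.closedBall 0 K := by ext; simp
  rw [e, EuclideanSpace.volume_closedBall_fin_two, ← ENNReal.ofReal_pow hK,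
    ← ENNReal.ofReal_mul (by positivity)]
  refine ENNReal.ofReal_le_ofReal ?_
  rw [mul_comm]
  gcongr
  exact Real.pi_le_four

namespace PhaseData

variable {P : PhaseData} {d : ℝ}

/-- Phases without resonances: the resonant set is empty unless `τ K` is not small, and then the
area of the disc is an admissible bound. -/
lemma hasArea_of_one_le (h : ∀ (K : ℝ) (ξ η : Plane), 1 ≤ K → ‖ξ‖ ≤ K → ‖η‖ ≤ K →
    1 ≤ 3 * K * |P.val ξ η|) : P.HasArea := by
  have hone : ∀ {K τ : ℝ} {ξ η : Plane}, 1 ≤ K → P.IsResonant K τ ξ η → 1 ≤ 3 * K * τ := by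
    intro K τ ξ η hK hr
    refine (h K ξ η hK hr.left hr.right).trans ?_
    gcongr
    exact hr.val
  have hvol : ∀ {S : Set Plane} {K B : ℝ}, 1 ≤ K → (∀ v ∈ S, ‖v‖ ≤ K ∧ 4 * K ^ 2 ≤ B) →
      volume S ≤ ENNReal.ofReal B := by
    intro S K B hK hS
    rcases S.eq_empty_or_nonempty with rfl | ⟨v, hv⟩
    · simp
    · exact (measure_mono fun v hv => (hS v hv).1).trans ((volume_norm_le_le (by linarith)).trans
        (ENNReal.ofReal_le_ofReal (hS v hv).2))
  have hres : ∀ {K τ : ℝ}, 1 ≤ K → 0 ≤ τ → 1 ≤ 3 * K * τ → 4 * K ^ 2 ≤ 24 * τ * K ^ 4 := by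
    intro K τ hK hτ h1
    calc 4 * K ^ 2 = 4 * K ^ 2 * 1 := by ring
      _ ≤ 4 * K ^ 2 * (3 * K * τ) := by gcongr
      _ = 12 * τ * K ^ 3 := by ring
      _ ≤ 24 * τ * K ^ 4 := by gcongr <;> norm_num
  refine ⟨24, by norm_num, fun K τ hK h0 h1 => ⟨fun η => ?_, fun ξ => ?_, fun κ hτκ hκ1 =>
    Or.inl fun η => ?_⟩⟩
  · exact hvol hK fun ξ hr => ⟨hr.left, hres hK h0 (hone hK hr)⟩
  · exact hvol hK fun η hr => ⟨hr.right, hres hK h0 (hone hK hr)⟩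
  · refine hvol hK fun ξ hr => ⟨hr.left, ?_⟩
    have h2 := hone hK hr.isResonant
    have h3 : 1 ≤ 2 * (K * √κ) := by
      have h4 : 1 ≤ 3 * K * κ := h2.trans (by gcongr)
      have h5 := Real.sq_sqrt (h0.trans hτκ)
      have h6 := Real.sqrt_nonneg κ
      by_contra h7
      nlinarith
    calc 4 * K ^ 2 = 4 * K ^ 2 * 1 * 1 := by ring
      _ ≤ 4 * K ^ 2 * (3 * K * τ) * (2 * (K * √κ)) := by gcongr
      _ = 24 * τ * K ^ 4 * √κ := by ring
      _ ≤ 24 * τ * K ^ 12 * √κ := by gcongr; norm_num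

/-- All three signs agree. -/
lemma hasArea_of_eq (h2 : P.e₂ = P.e₁) (h3 : P.e₃ = P.e₁) : P.HasArea := by
  refine hasArea_of_one_le fun K ξ η hK _ _ => ?_
  have p1 := one_le_energy P.pos₁.le ξ
  have p2 := one_le_energy P.pos₂.le (ξ - η)
  have p3 := one_le_energy P.pos₃.le η
  have e : |P.val ξ η| = energy P.c₁ ξ + energy P.c₂ (ξ - η) + energy P.c₃ η := by
    rw [val, h2, h3, ← mul_add, ← mul_add, abs_mul, P.sign₁, one_mul, abs_of_pos (by linarith)]
  rw [e]
  nlinarith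

/-- The sign of `ξ` differs from the two others. -/
lemma hasArea_left (hd : 0 < d) (hd1 : d < 1) (h₁ : P.c₁ = d ∨ P.c₁ = 1)
    (h₂ : P.c₂ = d ∨ P.c₂ = 1) (h₃ : P.c₃ = d ∨ P.c₃ = 1) (e2 : P.e₂ = -P.e₁)
    (e3 : P.e₃ = -P.e₁) : P.HasArea := by
  by_cases hle : P.c₁ ≤ P.c₂ ∧ P.c₁ ≤ P.c₃
  · refine hasArea_of_one_le fun K ξ η hK hξ hη => ?_
    have e : P.val ξ η
        = -P.e₁ * (energy P.c₂ (ξ - η) + energy P.c₃ η - energy P.c₁ (ξ - η + η)) := by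
      rw [val, e2, e3, sub_add_cancel]; ring
    rw [e, abs_mul, abs_neg, P.sign₁, one_mul]
    refine (one_le_energy_add_sub P.pos₁ hle.1 hle.2 P.le₂ P.le₃ hK
      ((norm_sub_le _ _).trans (by linarith) : ‖ξ - η‖ ≤ 2 * K) (by linarith : ‖η‖ ≤ 2 * K)
      (by rw [sub_add_cancel]; linarith)).trans ?_
    gcongr
    exact le_abs_self _
  · refine IsLeft.hasArea hd hd1 ⟨?_, e2, e3, ?_⟩
    · rcases h₁ with h | h
      · refine absurd ?_ hle
        rw [h]
        constructor
        · rcases h₂ with h | h <;> linarith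
        · rcases h₃ with h | h <;> linarith
      · exact h
    · rcases h₂ with h2 | h2 <;> rcases h₃ with h3 | h3
      · exact Or.inl ⟨h2, h3⟩
      · exact Or.inr (Or.inl ⟨h2, h3⟩)
      · exact Or.inr (Or.inr ⟨h2, h3⟩)
      · exact absurd ⟨h2 ▸ P.le₁, h3 ▸ P.le₁⟩ hle

/-- The sign of `ξ - η` differs from the two others. -/
lemma hasArea_middle (hd : 0 < d) (hd1 : d < 1) (h₁ : P.c₁ = d ∨ P.c₁ = 1)
    (h₂ : P.c₂ = d ∨ P.c₂ = 1) (h₃ : P.c₃ = d ∨ P.c₃ = 1) (e1 : P.e₁ = -P.e₂)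
    (e3 : P.e₃ = -P.e₂) : P.HasArea := by
  by_cases hle : P.c₂ ≤ P.c₁ ∧ P.c₂ ≤ P.c₃
  · refine hasArea_of_one_le fun K ξ η hK hξ hη => ?_
    have e : P.val ξ η
        = -P.e₂ * (energy P.c₁ ξ + energy P.c₃ (-η) - energy P.c₂ (ξ + -η)) := by
      rw [val, e1, e3, energy_neg, ← sub_eq_add_neg]; ring
    rw [e, abs_mul, abs_neg, P.sign₂, one_mul]
    refine (one_le_energy_add_sub P.pos₂ hle.1 hle.2 P.le₁ P.le₃ hK
      (by linarith : ‖ξ‖ ≤ 2 * K) (by rw [norm_neg]; linarith : ‖-η‖ ≤ 2 * K)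
      (by rw [← sub_eq_add_neg]; exact (norm_sub_le _ _).trans (by linarith))).trans ?_
    gcongr
    exact le_abs_self _
  · refine IsMiddle.hasArea hd hd1 ⟨?_, e1, e3, ?_⟩
    · rcases h₂ with h | h
      · refine absurd ?_ hle
        rw [h]
        constructor
        · rcases h₁ with h | h <;> linarith
        · rcases h₃ with h | h <;> linarith
      · exact h
    · rcases h₁ with h2 | h2 <;> rcases h₃ with h3 | h3
      · exact Or.inl ⟨h2, h3⟩
      · exact Or.inr (Or.inr ⟨h2, h3⟩)
      · exact Or.inr (Or.inl ⟨h2, h3⟩)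
      · exact absurd ⟨h2 ▸ P.le₂, h3 ▸ P.le₂⟩ hle

lemma hasArea (hd : 0 < d) (hd1 : d < 1) (h₁ : P.c₁ = d ∨ P.c₁ = 1)
    (h₂ : P.c₂ = d ∨ P.c₂ = 1) (h₃ : P.c₃ = d ∨ P.c₃ = 1) : P.HasArea := by
  rcases abs_eq_abs.1 (P.sign₂.trans P.sign₁.symm) with e2 | e2 <;>
    rcases abs_eq_abs.1 (P.sign₃.trans P.sign₁.symm) with e3 | e3
  · exact hasArea_of_eq e2 e3
  -- the sign of `η` differs from the two others
  · refine HasArea.of_swap (hasArea_left hd hd1 h₃ h₂ h₁ ?_ ?_)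
    · change P.e₂ = -P.e₃
      rw [e2, e3, neg_neg]
    · change P.e₁ = -P.e₃
      rw [e3, neg_neg]
  · exact hasArea_middle hd hd1 h₁ h₂ h₃ (by rw [e2, neg_neg]) (by rw [e2, e3, neg_neg])
  · exact hasArea_left hd hd1 h₁ h₂ h₃ e2 e3

end PhaseData

/-! ### The parts of small and of large curvature -/

/-- Schur's test in terms of the areas of the slices of the support. -/
lemma IsKernel.l2Bound_of_volume_support_le {k : Plane → Plane → ℂ} {M R : ℝ}
    (hk : IsKernel k M R) {X Y : ENNReal} (hX : ∀ η, volume {ξ | k ξ η ≠ 0} ≤ X)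
    (hY : ∀ ξ, volume {η | k ξ η ≠ 0} ≤ Y) :
    L2Bound k (ENNReal.ofReal (M ^ 2) * (X * Y)) := by
  have hM : 0 ≤ M := (norm_nonneg _).trans (hk.bound 0 0)
  have key : ∀ (g : Plane → ℂ) (Z : ENNReal), (∀ x, ‖g x‖ ≤ M) → volume {x | g x ≠ 0} ≤ Z →
      ∫⁻ x, ‖g x‖ₑ ≤ ENNReal.ofReal M * Z := by
    intro g Z hg hZ
    calc ∫⁻ x, ‖g x‖ₑ ≤ ∫⁻ x, {x | g x ≠ 0}.indicator (fun _ => ENNReal.ofReal M) x := by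
          refine lintegral_mono fun x => ?_
          by_cases hx : g x = 0
          · simp [hx]
          · rw [Set.indicator_of_mem (show x ∈ {x | g x ≠ 0} from hx), ← ofReal_norm]
            exact ENNReal.ofReal_le_ofReal (hg x)
      _ ≤ ENNReal.ofReal M * volume {x | g x ≠ 0} := lintegral_indicator_const_le _ _
      _ ≤ _ := by gcongr
  refine (hk.schur (fun ξ => key _ Y (hk.bound ξ) (hY ξ))
    fun η => key _ X (fun ξ => hk.bound ξ η) (hX η)).mono (le_of_eq ?_)
  rw [ENNReal.ofReal_pow hM]
  ring

/-- The trivial bound, by the area of the ball. -/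
lemma IsKernel.l2Bound_of_ball {k : Plane → Plane → ℂ} {M R : ℝ} (hk : IsKernel k M R)
    (hR : 0 ≤ R) : L2Bound k (ENNReal.ofReal ((4 * M * R ^ 2) ^ 2)) := by
  refine (hk.l2Bound_of_volume_support_le (X := ENNReal.ofReal (4 * R ^ 2))
    (Y := ENNReal.ofReal (4 * R ^ 2)) (fun η => (measure_mono fun ξ h => ?_).trans
      (volume_norm_le_le hR)) fun ξ => (measure_mono fun η h => ?_).trans
      (volume_norm_le_le hR)).mono (le_of_eq ?_)
  · exact (mem_ball_zero_iff.1 (hk.left_mem ξ η h)).le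
  · exact (mem_ball_zero_iff.1 (hk.right_mem ξ η h)).le
  · rw [← ENNReal.ofReal_mul (by positivity), ← ENNReal.ofReal_mul (by positivity)]
    congr 1; ring

namespace IsAmplitude

variable {P : PhaseData} {b : Plane → Plane → ℂ} {K κ M₀ M₁ : ℝ}

/-- Localization of an amplitude by means of the curvature. -/
lemma mul_curvature (hb : IsAmplitude P b K 0 M₀ M₁) {ψ : ℝ → ℝ} (hψ : ContDiff ℝ ∞ ψ)
    (hψ1 : ∀ x, |ψ x| ≤ 1) {D : ℝ} (hD : ∀ x, |deriv ψ x| ≤ D) {r : ℝ} (hr : 0 < r)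
    (hκ : ∀ x, ψ (x / r) ≠ 0 → κ ≤ |x|) :
    IsAmplitude P (fun ξ η => ((ψ (P.curvature ξ η / r) : ℝ) : ℂ) * b ξ η) K κ M₀
      (M₁ + 22 * D / r * M₀) where
  measurable := by
    have h1 : Continuous fun p : Plane × Plane => ((ψ (P.curvature p.1 p.2 / r) : ℝ) : ℂ) :=
      Complex.continuous_ofReal.comp (hψ.continuous.comp
        ((P.contDiff_curvature (n := 0)).continuous.div_const r))
    exact h1.measurable.mul hb.measurable
  contDiff η := by
    have h1 : ContDiff ℝ 1 fun ξ => ψ (P.curvature ξ η / r) :=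
      (hψ.of_le (by simp)).comp ((PhaseData.contDiff_left P.contDiff_curvature η).div_const r)
    exact (Complex.ofRealCLM.contDiff.comp h1).mul (hb.contDiff η)
  bound ξ η := by
    rw [norm_mul, Complex.norm_real, Real.norm_eq_abs]
    calc |ψ (P.curvature ξ η / r)| * ‖b ξ η‖ ≤ 1 * M₀ := by
          gcongr
          · exact hψ1 _
          · exact hb.bound ξ η
      _ = M₀ := one_mul _
  bound_fderiv ξ η := by
    have hD0 : 0 ≤ D := (abs_nonneg _).trans (hD 0)
    have hM0 : 0 ≤ M₀ := (norm_nonneg _).trans (hb.bound ξ η)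
    have d1 : DifferentiableAt ℝ (fun ξ => P.curvature ξ η) ξ :=
      ((PhaseData.contDiff_left (P.contDiff_curvature (n := 1)) η).differentiable
        (by simp)).differentiableAt
    have d2 : HasDerivAt ψ (deriv ψ (P.curvature ξ η / r)) (P.curvature ξ η / r) :=
      (hψ.differentiable (by simp)).differentiableAt.hasDerivAt
    have d3 := d2.comp_hasFDerivAt ξ (d1.hasFDerivAt.mul_const r⁻¹)
    have d4 := Complex.ofRealCLM.hasFDerivAt.comp ξ d3
    have d5 := ((hb.contDiff η).differentiable (by simp)).differentiableAt.hasFDerivAt (x := ξ)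
    have d6 : HasFDerivAt (fun ξ => ((ψ (P.curvature ξ η / r) : ℝ) : ℂ) * b ξ η) _ ξ := d4.mul d5
    have n1 : ‖((ψ (P.curvature ξ η / r) : ℝ) : ℂ)‖ ≤ 1 := by
      rw [Complex.norm_real]; exact hψ1 _
    have n2 : ‖Complex.ofRealCLM ∘SL (deriv ψ (P.curvature ξ η / r) •
        r⁻¹ • fderiv ℝ (fun ξ => P.curvature ξ η) ξ)‖ ≤ D * (r⁻¹ * 22) := by
      refine (ContinuousLinearMap.opNorm_comp_le _ _).trans ?_
      rw [Complex.ofRealCLM_norm, one_mul, norm_smul, norm_smul, norm_inv, Real.norm_eq_abs,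
        Real.norm_eq_abs, abs_of_pos hr]
      gcongr
      · exact hD _
      · exact P.norm_fderiv_curvature_le ξ η
    have n3 := hb.bound ξ η
    have n4 := hb.bound_fderiv ξ η
    rw [d6.fderiv]
    refine (norm_add_le _ _).trans ?_
    rw [norm_smul, norm_smul]
    calc _ ≤ 1 * M₁ + M₀ * (D * (r⁻¹ * 22)) :=
          add_le_add (mul_le_mul n1 n4 (norm_nonneg _) zero_le_one)
            (mul_le_mul n3 n2 (norm_nonneg _) hM0)
      _ = _ := by ring
  left_mem ξ η h := hb.left_mem ξ η (right_ne_zero_of_mul h)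
  right_mem ξ η h := hb.right_mem ξ η (right_ne_zero_of_mul h)
  curvature ξ η h := hκ _ fun h0 => left_ne_zero_of_mul h (by rw [h0, Complex.ofReal_zero])

end IsAmplitude

lemma _root_.IsSymbol.isAmplitude {A : ℕ → ℝ} {m k : ℕ} {a : Plane × Plane → ℂ}
    (ha : IsSymbol A m k a) (P : PhaseData) :
    IsAmplitude P (fun ξ η => a (ξ, η)) (2 ^ k) 0 (A 0) (A 1 * (2 : ℝ) ^ ((m : ℝ) / 2)) where
  measurable := ha.smooth.continuous.measurable
  contDiff η := PhaseData.contDiff_left (f := fun ξ η => a (ξ, η)) (ha.smooth.of_le (by simp)) η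
  bound ξ η := by simpa using ha.bound 0 (ξ, η)
  bound_fderiv ξ η := by
    have h1 := ha.bound 1 (ξ, η)
    rw [norm_iteratedFDeriv_one, Nat.cast_one, one_mul] at h1
    have hd : HasFDerivAt a (fderiv ℝ a (ξ, η)) (ξ, η) :=
      (ha.smooth.differentiable (by simp)).differentiableAt.hasFDerivAt
    have h2 : HasFDerivAt (fun ξ => a (ξ, η))
        ((fderiv ℝ a (ξ, η)).comp (ContinuousLinearMap.inl ℝ Plane Plane)) ξ :=
      hd.comp ξ (hasFDerivAt_prodMk_left ξ η)
    rw [h2.fderiv]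
    refine le_trans ?_ h1
    refine (ContinuousLinearMap.opNorm_comp_le _ _).trans
      (mul_le_of_le_one_right (norm_nonneg _) ?_)
    exact ContinuousLinearMap.norm_inl_le_one ℝ Plane Plane
  left_mem ξ η h := (ha.support_subset h).1
  right_mem ξ η h := (ha.support_subset h).2
  curvature ξ η _ := abs_nonneg _

section

variable {P : PhaseData} {φ : ℝ → ℝ} {b : Plane → Plane → ℂ} {s t u K M₀ M₁ κ : ℝ}

lemma isResonant_of_mem_levelSet {ξ η : Plane}
    (h : (ξ, η) ∈ levelSet P K κ (u ^ 60)⁻¹) : P.IsResonant K (2 * u ^ 60) ξ η := by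
  obtain ⟨h1, h2, -, h4⟩ := h
  refine ⟨mem_closedBall_zero_iff.1 h1, mem_closedBall_zero_iff.1 h2, h4.trans_eq ?_⟩
  rw [div_inv_eq_mul]

/-!
The parameters are powers of `u = 2^{-λ/60}`: the width of the phase cutoff is `u⁶⁰ = 2^{-λ}`, the
threshold for the curvature is `κ = u²`, and the distance that separates the near-diagonal and the
off-diagonal part of the kernel of `T* T` is `ρ = u¹⁵`.
-/

/-- The part of the operator where the curvature is small. -/
lemma exists_l2Bound_of_small_curvature (hφ : IsCutoff φ) (hP : P.HasArea) :
    ∃ C : ℝ, 0 ≤ C ∧ ∀ (b : Plane → Plane → ℂ) (s u K M₀ M₁ : ℝ), IsAmplitude P b K 0 M₀ M₁ →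
      1 ≤ K → 0 < u → u ≤ 1 / 4 → (∀ ξ η, b ξ η ≠ 0 → |P.curvature ξ η| ≤ 2 * u ^ 2) →
      L2Bound (oscKernel P φ s (u ^ 60)⁻¹ b) (ENNReal.ofReal (C * M₀ ^ 2 * K ^ 16 * u ^ 121)) := by
  obtain ⟨C, hC, H⟩ := hP
  refine ⟨8 * C ^ 2, by positivity, fun b s u K M₀ M₁ hb hK hu hu4 hbc => ?_⟩
  have ht : 0 < (u ^ 60)⁻¹ := by positivity
  have hu1 : u ≤ 1 := by linarith
  have hu60 : u ^ 60 ≤ u ^ 2 := pow_le_pow_of_le_one hu.le hu1 (by norm_num)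
  have hu2 : u ^ 2 ≤ 1 / 16 := by nlinarith
  have hk := isKernel_oscKernel (s := s) (t := (u ^ 60)⁻¹) hφ hb
  obtain ⟨H1, H2, H3⟩ := H K (2 * u ^ 60) hK (by positivity) (by linarith)
  have hres : ∀ ξ η, oscKernel P φ s (u ^ 60)⁻¹ b ξ η ≠ 0 → P.IsResonant K (2 * u ^ 60) ξ η :=
    fun ξ η h => isResonant_of_mem_levelSet (mem_levelSet_of_ne_zero hφ hb ht h)
  have hbad : ∀ ξ η, oscKernel P φ s (u ^ 60)⁻¹ b ξ η ≠ 0 →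
      P.IsBad K (2 * u ^ 2) (2 * u ^ 60) ξ η := fun ξ η h =>
    ⟨(hres ξ η h).left, (hres ξ η h).right, (hres ξ η h).val,
      hbc ξ η (right_ne_zero_of_mul (show _ * _ ≠ 0 from h))⟩
  have hsqrt : √(2 * u ^ 2) ≤ 2 * u := by
    rw [Real.sqrt_le_left (by positivity)]
    nlinarith
  have hprod : C * (2 * u ^ 60) * K ^ 4 * (C * (2 * u ^ 60) * K ^ 12 * √(2 * u ^ 2))
      ≤ 8 * C ^ 2 * K ^ 16 * u ^ 121 := by
    calc _ ≤ C * (2 * u ^ 60) * K ^ 4 * (C * (2 * u ^ 60) * K ^ 12 * (2 * u)) := by gcongr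
      _ = _ := by ring
  have hfin : ENNReal.ofReal (M₀ ^ 2) * (ENNReal.ofReal (C * (2 * u ^ 60) * K ^ 4) *
      ENNReal.ofReal (C * (2 * u ^ 60) * K ^ 12 * √(2 * u ^ 2)))
      ≤ ENNReal.ofReal (8 * C ^ 2 * M₀ ^ 2 * K ^ 16 * u ^ 121) := by
    rw [← ENNReal.ofReal_mul (by positivity), ← ENNReal.ofReal_mul (by positivity)]
    refine ENNReal.ofReal_le_ofReal ?_
    calc _ ≤ M₀ ^ 2 * (8 * C ^ 2 * K ^ 16 * u ^ 121) := by gcongr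
      _ = _ := by ring
  rcases H3 (2 * u ^ 2) (by linarith) (by linarith) with H3 | H3
  · refine (hk.l2Bound_of_volume_support_le
      (fun η => (measure_mono fun ξ h => hbad ξ η h).trans (H3 η))
      (fun ξ => (measure_mono fun η h => hres ξ η h).trans (H2 ξ))).mono ?_
    rw [mul_comm (ENNReal.ofReal (C * (2 * u ^ 60) * K ^ 12 * √(2 * u ^ 2)))]
    exact hfin
  · exact (hk.l2Bound_of_volume_support_le
      (fun η => (measure_mono fun ξ h => hres ξ η h).trans (H1 η))
      (fun ξ => (measure_mono fun η h => hbad ξ η h).trans (H3 ξ))).mono hfin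

/-- The part of the operator where the curvature is large. -/
lemma exists_l2Bound_of_large_curvature (N : ℕ) (hφ : IsCutoff φ) (hP : P.HasArea)
    {A₀ A₁ D : ℝ} (hA₀ : 0 ≤ A₀) (hA₁ : 0 ≤ A₁) (hD : 0 ≤ D) :
    ∃ C : ℝ, 0 ≤ C ∧ ∀ (b : Plane → Plane → ℂ) (s u K q : ℝ),
      IsAmplitude P b K (u ^ 2) A₀ (A₁ * q + D / u ^ 2 * A₀) →
      1 ≤ K → 0 ≤ q → 0 < u → u ≤ 1 / 4 → (u ^ 60)⁻¹ ≤ |s| → ((u ^ 60)⁻¹ / |s|) ^ N ≤ u ^ 15 →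
      1 / |s| ≤ 2 * u ^ 60 → q / |s| ≤ 2 * u ^ 30 →
      L2Bound (oscKernel P φ s (u ^ 60)⁻¹ b) (ENNReal.ofReal (C * K ^ 12 * u ^ 125)) := by
  obtain ⟨B, hB, HB⟩ := exists_l2Bound_oscKernel N hφ
  obtain ⟨C, hC, H⟩ := hP
  set W := A₀ ^ 2 * (2 * C) * 32 + (A₀ ^ 2 * (2 * B + 1) + 128 * A₀ * (A₁ + D * A₀) * B +
    8192 * A₀ ^ 2 * B) * (2 * C) ^ 2 with hW
  refine ⟨640 ^ 4 * W, by positivity, fun b s u K q hb hK hq0 hu hu4 hs hN hs1 hq => ?_⟩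
  have hu1 : u ≤ 1 := by linarith
  have hpow : ∀ {m n : ℕ}, m ≤ n → u ^ n ≤ u ^ m := fun h => pow_le_pow_of_le_one hu.le hu1 h
  have ht : 0 < (u ^ 60)⁻¹ := by positivity
  have hs0 : 0 < |s| := ht.trans_le hs
  have hu5 : u ^ 5 ≤ 1 / 1024 := (pow_le_pow_left₀ hu.le hu4 5).trans (by norm_num)
  obtain ⟨H1, H2, -⟩ := H K (2 * u ^ 60) hK (by positivity) (by
    have := hpow (show 5 ≤ 60 by norm_num); linarith)
  have hK4 : K ^ 4 ≤ K ^ 8 := pow_le_pow_right₀ hK (by norm_num)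
  have hsub₁ : ∀ η, {ξ | (ξ, η) ∈ levelSet P K (u ^ 2) (u ^ 60)⁻¹} ⊆
      {ξ | P.IsResonant K (2 * u ^ 60) ξ η} := fun η ξ h => isResonant_of_mem_levelSet h
  have hsub₂ : ∀ ξ, {η | (ξ, η) ∈ levelSet P K (u ^ 2) (u ^ 60)⁻¹} ⊆
      {η | P.IsResonant K (2 * u ^ 60) ξ η} := fun ξ η h => isResonant_of_mem_levelSet h
  refine (HB P b s (u ^ 60)⁻¹ K (u ^ 2) A₀ _ (u ^ 15) _ _ hb ht hs (by positivity)
    ((hpow (show 0 ≤ 2 by norm_num)).trans (by simpa using hK)) (by positivity) ?_ ?_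
    (fun η => (measure_mono (hsub₁ η)).trans (H1 η))
    (fun ξ => (measure_mono (hsub₂ ξ)).trans (H2 ξ))).mono ?_
  · have h1 : u ^ 15 ≤ u ^ 7 := hpow (by norm_num)
    have h3 : u ^ 2 * u ^ 5 ≤ u ^ 2 * (1 / 1024) := by gcongr
    have : 0 < u ^ 2 := by positivity
    linarith
  · rw [one_div, inv_inv]
    have h1 : u ^ 60 ≤ u ^ 22 := hpow (by norm_num)
    have h3 : u ^ 17 * u ^ 5 ≤ u ^ 17 * (1 / 1024) := by gcongr
    have h4 : u ^ 2 * u ^ 15 = u ^ 17 := by ring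
    have : 0 < u ^ 17 := by positivity
    rw [h4]
    linarith
  set E := A₀ ^ 2 * ((2 * B + 1) * ((u ^ 60)⁻¹ / |s|) ^ N) +
    (64 * (A₀ * (A₁ * q + D / u ^ 2 * A₀)) / (u ^ 2 * u ^ 15) +
      4096 * A₀ ^ 2 / (u ^ 2 * u ^ 15) ^ 2) * (B / |s|) with hE
  have hE0 : 0 ≤ E := by positivity
  have hE1 : E ≤ (A₀ ^ 2 * (2 * B + 1) + 128 * A₀ * (A₁ + D * A₀) * B + 8192 * A₀ ^ 2 * B)
      * u ^ 13 := by
    have t1 : A₀ ^ 2 * ((2 * B + 1) * ((u ^ 60)⁻¹ / |s|) ^ N) ≤ A₀ ^ 2 * (2 * B + 1) * u ^ 13 := by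
      calc _ ≤ A₀ ^ 2 * ((2 * B + 1) * u ^ 13) := by
            gcongr
            exact hN.trans (hpow (by norm_num))
        _ = _ := by ring
    have t2 : 64 * (A₀ * (A₁ * q + D / u ^ 2 * A₀)) / (u ^ 2 * u ^ 15) * (B / |s|)
        ≤ 128 * A₀ * (A₁ + D * A₀) * B * u ^ 13 := by
      calc 64 * (A₀ * (A₁ * q + D / u ^ 2 * A₀)) / (u ^ 2 * u ^ 15) * (B / |s|)
          = 64 * A₀ * B * (A₁ * (q / |s|) / u ^ 17 + D * A₀ * (1 / |s|) / u ^ 19) := by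
            field_simp
        _ ≤ 64 * A₀ * B * (A₁ * (2 * u ^ 30) / u ^ 17 + D * A₀ * (2 * u ^ 60) / u ^ 19) := by
            gcongr
        _ = 128 * A₀ * B * (A₁ * u ^ 13 + D * A₀ * u ^ 41) := by field_simp; ring
        _ ≤ 128 * A₀ * B * (A₁ * u ^ 13 + D * A₀ * u ^ 13) := by
            gcongr 128 * A₀ * B * (A₁ * u ^ 13 + D * A₀ * ?_)
            exact hpow (by norm_num)
        _ = _ := by ring
    have t3 : 4096 * A₀ ^ 2 / (u ^ 2 * u ^ 15) ^ 2 * (B / |s|) ≤ 8192 * A₀ ^ 2 * B * u ^ 13 := by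
      calc 4096 * A₀ ^ 2 / (u ^ 2 * u ^ 15) ^ 2 * (B / |s|)
          = 4096 * A₀ ^ 2 / (u ^ 2 * u ^ 15) ^ 2 * (B * (1 / |s|)) := by rw [mul_one_div]
        _ ≤ 4096 * A₀ ^ 2 / (u ^ 2 * u ^ 15) ^ 2 * (B * (2 * u ^ 60)) := by gcongr
        _ = 8192 * A₀ ^ 2 * B * u ^ 26 := by field_simp; ring
        _ ≤ _ := by
            gcongr 8192 * A₀ ^ 2 * B * ?_
            exact hpow (by norm_num)
    rw [hE, add_mul]
    linarith
  set X := C * (2 * u ^ 60) * K ^ 4 with hX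
  have hX0 : 0 ≤ X := by positivity
  have hZ : A₀ ^ 2 * (X * (2 * u ^ 15 * (16 / (u ^ 2 * (u ^ 60)⁻¹)))) + E * (X * X)
      ≤ W * K ^ 8 * u ^ 133 := by
    have t1 : A₀ ^ 2 * (X * (2 * u ^ 15 * (16 / (u ^ 2 * (u ^ 60)⁻¹))))
        ≤ A₀ ^ 2 * (2 * C) * 32 * K ^ 8 * u ^ 133 := by
      calc _ = A₀ ^ 2 * (2 * C) * 32 * K ^ 4 * u ^ 133 := by rw [hX]; field_simp; ring
        _ ≤ _ := by gcongr
    have t2 : E * (X * X) ≤ (A₀ ^ 2 * (2 * B + 1) + 128 * A₀ * (A₁ + D * A₀) * B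
        + 8192 * A₀ ^ 2 * B) * (2 * C) ^ 2 * K ^ 8 * u ^ 133 := by
      calc _ ≤ _ := mul_le_mul_of_nonneg_right hE1 (by positivity)
        _ = _ := by rw [hX]; ring
    calc _ ≤ _ := add_le_add t1 t2
      _ = _ := by rw [hW]; ring
  have hEX : ENNReal.ofReal E * (ENNReal.ofReal X * ENNReal.ofReal X)
      = ENNReal.ofReal (E * (X * X)) := by
    rw [← ENNReal.ofReal_mul hX0, ← ENNReal.ofReal_mul' (by positivity)]
  rw [hEX, ← ENNReal.ofReal_mul (by positivity), ← ENNReal.ofReal_mul hX0,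
    ← ENNReal.ofReal_mul (by positivity),
    ← ENNReal.ofReal_add (by positivity) (mul_nonneg hE0 (by positivity)),
    ← ENNReal.ofReal_mul (by positivity)]
  refine ENNReal.ofReal_le_ofReal ?_
  calc _ ≤ (640 * K / u ^ 2) ^ 4 * (W * K ^ 8 * u ^ 133) := by gcongr
    _ = _ := by field_simp

end

/-! ### The phases of the problem -/

/-- The coefficient of an index. -/
def coeff (d : ℝ) : PhaseIndex → ℝ
  | .e => d
  | .b => 1
  | .negE => d
  | .negB => 1

/-- The sign of an index. -/
def sign : PhaseIndex → ℝ
  | .e => 1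
  | .b => 1
  | .negE => -1
  | .negB => -1

lemma coeff_eq (d : ℝ) (σ : PhaseIndex) : coeff d σ = d ∨ coeff d σ = 1 := by
  cases σ <;> simp [coeff]

lemma abs_sign (σ : PhaseIndex) : |sign σ| = 1 := by
  cases σ <;> simp [sign]

lemma dispersion_eq (d : ℝ) (σ : PhaseIndex) (ξ : Plane) :
    dispersion d σ ξ = sign σ * energy (coeff d σ) ξ := by
  cases σ <;> simp [dispersion, sign, coeff, energy]

lemma coeff_pos {d : ℝ} (hd : 0 < d) (σ : PhaseIndex) : 0 < coeff d σ := by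
  rcases coeff_eq d σ with h | h <;> rw [h]
  · exact hd
  · exact one_pos

lemma coeff_le_one {d : ℝ} (hd1 : d < 1) (σ : PhaseIndex) : coeff d σ ≤ 1 := by
  rcases coeff_eq d σ with h | h <;> rw [h]
  exact hd1.le

/-- The phase `Φ_{σμν}` in terms of its coefficients and signs. -/
def phaseData {d : ℝ} (hd : 0 < d) (hd1 : d < 1) (σ μ ν : PhaseIndex) : PhaseData where
  c₁ := coeff d σ
  c₂ := coeff d μ
  c₃ := coeff d ν
  e₁ := sign σ
  e₂ := -sign μ
  e₃ := -sign ν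
  pos₁ := coeff_pos hd σ
  pos₂ := coeff_pos hd μ
  pos₃ := coeff_pos hd ν
  le₁ := coeff_le_one hd1 σ
  le₂ := coeff_le_one hd1 μ
  le₃ := coeff_le_one hd1 ν
  sign₁ := abs_sign σ
  sign₂ := by rw [abs_neg, abs_sign]
  sign₃ := by rw [abs_neg, abs_sign]

lemma phaseData_val {d : ℝ} (hd : 0 < d) (hd1 : d < 1) (σ μ ν : PhaseIndex) (ξ η : Plane) :
    (phaseData hd hd1 σ μ ν).val ξ η = phase d σ μ ν ξ η := by
  simp only [PhaseData.val, phaseData, phase, dispersion_eq]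
  ring

lemma fioKernel_eq {d : ℝ} (hd : 0 < d) (hd1 : d < 1) (σ μ ν : PhaseIndex) (φ : ℝ → ℝ) (s l : ℝ)
    (a : Plane × Plane → ℂ) : fioKernel d σ μ ν φ s l a =
      oscKernel (phaseData hd hd1 σ μ ν) φ s ((2 : ℝ) ^ l) fun ξ η => a (ξ, η) := by
  ext ξ η
  rw [fioKernel, oscKernel, oscCutoff, phaseData_val]
  ring

/-- The relations between the parameters, in terms of `u = 2^{-λ/60}`. -/
lemma parameter_bounds {m : ℕ} {s l u : ℝ} (hl : 20000 ≤ l) (hlm : l ≤ m * (1 - 1 / 10 ^ 4))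
    (hs : (2 : ℝ) ^ m - 1 ≤ |s|) (hu : u = 2 ^ (-(l / 60))) :
    (u ^ 60)⁻¹ = 2 ^ l ∧ u ≤ 1 / 4 ∧ (u ^ 60)⁻¹ ≤ |s| ∧ ((u ^ 60)⁻¹ / |s|) ^ 5000 ≤ u ^ 15 ∧
      1 / |s| ≤ 2 * u ^ 60 ∧ (2 : ℝ) ^ ((m : ℝ) / 2) / |s| ≤ 2 * u ^ 30 ∧
      u ^ 121 ≤ ((2 : ℝ) ^ (-(1.004 * l))) ^ 2 := by
  have hpow : ∀ n : ℕ, u ^ n = 2 ^ (-(l / 60) * n) := fun n => by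
    rw [hu, Real.rpow_mul_natCast zero_le_two]
  have hmono : ∀ {x y : ℝ}, x ≤ y → (2 : ℝ) ^ x ≤ 2 ^ y := fun h =>
    Real.rpow_le_rpow_of_exponent_le one_le_two h
  have h60 : (u ^ 60)⁻¹ = 2 ^ l := by
    rw [hpow, ← Real.rpow_neg zero_le_two]; congr 1; push_cast; ring
  have hinv : 1 / |s| ≤ 2 ^ (1 - (m : ℝ)) := by
    have h1 : (2 : ℝ) ^ ((m : ℝ) - 1) ≤ |s| := by
      refine le_trans ?_ hs
      rw [Real.rpow_sub_one two_ne_zero, Real.rpow_natCast]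
      have h2 : (2 : ℝ) ^ (1 : ℝ) ≤ 2 ^ (m : ℝ) := hmono (by linarith)
      rw [Real.rpow_one, Real.rpow_natCast] at h2
      linarith
    rw [one_div, ← neg_sub, Real.rpow_neg zero_le_two]
    exact inv_anti₀ (by positivity) h1
  have hdiv : ∀ x y : ℝ, x + (1 - m) ≤ y → (2 : ℝ) ^ x / |s| ≤ 2 ^ y := fun x y h => by
    calc (2 : ℝ) ^ x / |s| = 2 ^ x * (1 / |s|) := by rw [mul_one_div]
      _ ≤ 2 ^ x * 2 ^ (1 - (m : ℝ)) := by gcongr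
      _ = 2 ^ (x + (1 - m)) := (Real.rpow_add two_pos _ _).symm
      _ ≤ 2 ^ y := hmono h
  -- the loss `10⁻⁴` in `λ ≤ m(1 - 10⁻⁴)` is a gain `2^{-10⁻⁴ λ}` here, of which one half absorbs
  -- the constant factor `2`; the power `5000` turns the other half into `u¹⁵`
  have hts : (u ^ 60)⁻¹ / |s| ≤ 2 ^ (-(l / 20000)) := by
    rw [h60]; exact hdiv _ _ (by linarith)
  have hs0 : 0 < |s| := by
    have : (2 : ℝ) ^ (0 : ℝ) < 2 ^ (m : ℝ) :=
      Real.rpow_lt_rpow_of_exponent_lt one_lt_two (by linarith)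
    rw [Real.rpow_zero, Real.rpow_natCast] at this
    linarith
  have htwo : ∀ x : ℝ, 2 * (2 : ℝ) ^ x = 2 ^ (x + 1) := fun x => by
    rw [Real.rpow_add_one two_ne_zero, mul_comm]
  refine ⟨h60, ?_, ?_, ?_, ?_, ?_, ?_⟩
  · rw [hu]
    refine (hmono (show -(l / 60) ≤ -2 by linarith)).trans (le_of_eq ?_)
    rw [Real.rpow_neg zero_le_two, Real.rpow_two]; norm_num
  · rw [← div_le_one hs0]
    refine hts.trans ((hmono (show -(l / 20000) ≤ 0 by linarith)).trans_eq (Real.rpow_zero 2))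
  · refine (pow_le_pow_left₀ (by rw [h60]; positivity) hts 5000).trans (le_of_eq ?_)
    rw [hpow, ← Real.rpow_mul_natCast zero_le_two]
    congr 1; push_cast; ring
  · rw [hpow, htwo]
    refine hinv.trans (hmono ?_)
    push_cast; linarith
  · rw [hpow, htwo]
    refine hdiv _ _ ?_
    push_cast; linarith
  · rw [hpow, ← Real.rpow_mul_natCast zero_le_two]
    refine hmono ?_
    push_cast; linarith

/-- The `L²` bound for a phase with area bounds. The amplitude is split by the cutoff `φ`, applied
to the curvature divided by `κ = u²`. Small `λ` are covered by the trivial bound. -/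
lemma exists_l2Bound_oscKernel_of_hasArea {P : PhaseData} (hP : P.HasArea) {φ : ℝ → ℝ}
    (hφ : IsCutoff φ) {A : ℕ → ℝ} (hA : ∀ n, 0 ≤ A n) :
    ∃ C : ℝ, 0 ≤ C ∧ ∀ (m k : ℕ) (s l : ℝ) (a : Plane × Plane → ℂ), (2 : ℝ) ^ m - 1 ≤ |s| →
      l ≤ m * (1 - 1 / 10 ^ 4) → IsSymbol A m k a →
      L2Bound (oscKernel P φ s ((2 : ℝ) ^ l) fun ξ η => a (ξ, η))
        (ENNReal.ofReal ((C * (2 : ℝ) ^ (12 * k) * (2 : ℝ) ^ (-(1.004 * l))) ^ 2)) := by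
  obtain ⟨D, hD⟩ : ∃ D, ∀ x, |deriv φ x| ≤ D := by
    have hc : HasCompactSupport φ :=
      HasCompactSupport.of_support_subset_isCompact isCompact_Icc hφ.support_subset
    exact (hφ.smooth.continuous_deriv (by simp)).bounded_above_of_compact_support hc.deriv
  have hD0 : 0 ≤ D := (abs_nonneg _).trans (hD 0)
  obtain ⟨B₁, hB₁, H₁⟩ := exists_l2Bound_of_small_curvature hφ hP
  obtain ⟨B₂, hB₂, H₂⟩ := exists_l2Bound_of_large_curvature 5000 hφ hP (hA 0) (hA 1)
    (show 0 ≤ 22 * D by positivity)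
  obtain ⟨T, hT0, hT⟩ : ∃ T : ℝ, 0 ≤ T ∧ ∀ l : ℝ, l < 20000 → 1 ≤ T * 2 ^ (-(1.004 * l)) := by
    refine ⟨2 ^ (1.004 * (20000 : ℝ)), by positivity, fun l hl => ?_⟩
    rw [← Real.rpow_add two_pos]
    exact Real.one_le_rpow one_le_two (by linarith)
  refine ⟨1 + (2 * (B₁ * A 0 ^ 2) + 2 * B₂) + 4 * A 0 * T,
    by have := hA 0; positivity, fun m k s l a hs hlm ha => ?_⟩
  have hA0 := hA 0
  have hb := ha.isAmplitude P
  set b : Plane → Plane → ℂ := fun ξ η => a (ξ, η)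
  rw [mul_comm 12 k, pow_mul]
  have hK : (1 : ℝ) ≤ 2 ^ k := one_le_pow₀ one_le_two
  set K : ℝ := 2 ^ k
  set v : ℝ := 2 ^ (-(1.004 * l)) with hv
  have hK2 : K ^ 2 ≤ K ^ 12 := pow_le_pow_right₀ hK (by norm_num)
  rcases lt_or_ge l 20000 with hl | hl
  · refine ((isKernel_oscKernel (s := s) (t := 2 ^ l) hφ hb).l2Bound_of_ball
      (by positivity)).mono (ENNReal.ofReal_le_ofReal ?_)
    refine pow_le_pow_left₀ (by positivity) ?_ 2
    have h1 : 0 ≤ 1 + (2 * (B₁ * A 0 ^ 2) + 2 * B₂) := by positivity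
    calc 4 * A 0 * K ^ 2 ≤ 4 * A 0 * K ^ 12 := by gcongr
      _ ≤ 4 * A 0 * K ^ 12 * (T * v) := le_mul_of_one_le_right (by positivity) (hT l hl)
      _ = 4 * A 0 * T * K ^ 12 * v := by ring
      _ ≤ _ := by gcongr; linarith
  obtain ⟨u, hu⟩ : ∃ u : ℝ, u = 2 ^ (-(l / 60)) := ⟨_, rfl⟩
  have hu0 : 0 < u := by rw [hu]; positivity
  obtain ⟨h60, hu4, hts, hN, hinv, hq, h121⟩ := parameter_bounds hl hlm hs hu
  rw [← hv] at h121
  rw [← h60]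
  have hu2 : 0 < u ^ 2 := by positivity
  have hb₁ := hb.mul_curvature (κ := 0) hφ.smooth hφ.abs_le_one hD hu2 fun x _ => abs_nonneg x
  have hb₂ := hb.mul_curvature (κ := u ^ 2) (ψ := fun x => 1 - φ x) (contDiff_const.sub hφ.smooth)
    (fun x => by
      have := hφ.mem_Icc x
      rw [abs_le]; constructor <;> linarith [this.1, this.2])
    (D := D) (fun x => by rw [deriv_const_sub, abs_neg]; exact hD x) hu2 fun x hx => by
      by_contra hlt
      refine hx ?_
      have h1 : |x / u ^ 2| ≤ 5 / 4 := by
        rw [abs_div, abs_of_pos hu2, div_le_iff₀ hu2]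
        linarith
      rw [hφ.eq_one _ (abs_le.1 h1), sub_self]
  have g₁ := H₁ _ s u K _ _ hb₁ hK hu0 hu4 fun ξ η h => by
    have h1 : |P.curvature ξ η / u ^ 2| ≤ 8 / 5 :=
      abs_le.2 (hφ.support_subset fun h0 => left_ne_zero_of_mul h (by rw [h0, Complex.ofReal_zero]))
    rw [abs_div, abs_of_pos hu2, div_le_iff₀ hu2] at h1
    linarith
  have g₂ := H₂ _ s u K _ hb₂ hK (by positivity) hu0 hu4 hts hN hinv hq
  have hsum := L2Bound.add (isKernel_oscKernel (s := s) (t := (u ^ 60)⁻¹) hφ hb₁)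
    (isKernel_oscKernel (s := s) (t := (u ^ 60)⁻¹) hφ hb₂) g₁ g₂
  have e : (fun ξ η => oscKernel P φ s (u ^ 60)⁻¹
        (fun ξ η => ((φ (P.curvature ξ η / u ^ 2) : ℝ) : ℂ) * b ξ η) ξ η +
      oscKernel P φ s (u ^ 60)⁻¹
        (fun ξ η => ((1 - φ (P.curvature ξ η / u ^ 2) : ℝ) : ℂ) * b ξ η) ξ η)
      = oscKernel P φ s (u ^ 60)⁻¹ b := by
    ext ξ η
    simp only [oscKernel]
    push_cast
    ring
  rw [e] at hsum
  refine hsum.mono ?_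
  rw [← ENNReal.ofReal_add (by positivity) (by positivity), ← ENNReal.ofReal_ofNat,
    ← ENNReal.ofReal_mul (by positivity)]
  refine ENNReal.ofReal_le_ofReal ?_
  have hC1 : 1 ≤ 1 + (2 * (B₁ * A 0 ^ 2) + 2 * B₂) + 4 * A 0 * T := by
    have : 0 ≤ (2 * (B₁ * A 0 ^ 2) + 2 * B₂) + 4 * A 0 * T := by positivity
    linarith
  have hC2 : 2 * (B₁ * A 0 ^ 2) + 2 * B₂ ≤ 1 + (2 * (B₁ * A 0 ^ 2) + 2 * B₂) + 4 * A 0 * T := by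
    have : 0 ≤ 4 * A 0 * T := by positivity
    linarith
  set C := 1 + (2 * (B₁ * A 0 ^ 2) + 2 * B₂) + 4 * A 0 * T
  have h125 : u ^ 125 ≤ u ^ 121 := pow_le_pow_of_le_one hu0.le (by linarith) (by norm_num)
  calc 2 * (B₁ * A 0 ^ 2 * K ^ 16 * u ^ 121 + B₂ * K ^ 12 * u ^ 125)
      ≤ 2 * (B₁ * A 0 ^ 2 * K ^ 24 * v ^ 2 + B₂ * K ^ 24 * v ^ 2) := by
        gcongr
        · norm_num
        · norm_num
        · exact h125.trans h121
    _ = (2 * (B₁ * A 0 ^ 2) + 2 * B₂) * (K ^ 24 * v ^ 2) := by ring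
    _ ≤ C * (K ^ 24 * v ^ 2) := by gcongr
    _ ≤ C ^ 2 * (K ^ 24 * v ^ 2) := by gcongr; exact le_self_pow₀ hC1 two_ne_zero
    _ = (C * K ^ 12 * v) ^ 2 := by ring

lemma exists_forall_phaseIndex_le (F : PhaseIndex → ℝ) : ∃ C, ∀ σ, F σ ≤ C := by
  refine ⟨max (max (F .e) (F .b)) (max (F .negE) (F .negB)), fun σ => ?_⟩
  cases σ <;> simp

end KleinGordon

end

theorem mainTheorem6 (d : ℝ) (hd : d ∈ Set.Ioo (0 : ℝ) 1) (φ : ℝ → ℝ) (hφ : IsCutoff φ)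
    (A : ℕ → ℝ) :
    ∃ C : ℝ, 0 < C ∧
      ∀ (σ μ ν : PhaseIndex) (m k : ℕ) (s l : ℝ) (a : Plane × Plane → ℂ),
        (2 : ℝ) ^ m - 1 ≤ |s| → |s| ≤ (2 : ℝ) ^ (m + 1) →
        5 * (m : ℝ) / 6 ≤ l → l ≤ (m : ℝ) * (1 - 1 / 10 ^ 4) →
        IsSymbol A m k a →
        ∀ f : Plane → ℂ, MemLp f 2 volume →
          (∀ ξ : Plane, Integrable (fun η => fioKernel d σ μ ν φ s l a ξ η * f η) volume) ∧
          MemLp (fio d σ μ ν φ s l a f) 2 volume ∧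
          eLpNorm (fio d σ μ ν φ s l a f) 2 volume ≤
            ENNReal.ofReal (C * (2 : ℝ) ^ (12 * k) * (2 : ℝ) ^ (-(1.004 * l))) *
              eLpNorm f 2 volume := by
  obtain ⟨hd0, hd1⟩ := hd
  have hP : ∀ σ μ ν, (KleinGordon.phaseData hd0 hd1 σ μ ν).HasArea := fun σ μ ν =>
    KleinGordon.PhaseData.hasArea hd0 hd1 (KleinGordon.coeff_eq d σ) (KleinGordon.coeff_eq d μ)
      (KleinGordon.coeff_eq d ν)
  choose F hF₀ hF using fun σ μ ν => KleinGordon.exists_l2Bound_oscKernel_of_hasArea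
    (hP σ μ ν) hφ (A := fun n => |A n|) fun n => abs_nonneg _
  choose F₁ hF₁ using fun σ μ => KleinGordon.exists_forall_phaseIndex_le (F σ μ)
  choose F₂ hF₂ using fun σ => KleinGordon.exists_forall_phaseIndex_le (F₁ σ)
  obtain ⟨C, hC⟩ := KleinGordon.exists_forall_phaseIndex_le F₂
  refine ⟨|C| + 1, by positivity, fun σ μ ν m k s l a hs _ _ hlm ha f hf => ?_⟩
  have ha' : IsSymbol (fun n => |A n|) m k a :=
    ⟨ha.smooth, ha.support_subset, fun n x => (ha.bound n x).trans (by
      gcongr; exact le_abs_self _)⟩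
  have hk := KleinGordon.isKernel_oscKernel (s := s) (t := (2 : ℝ) ^ l) hφ
    (ha'.isAmplitude (KleinGordon.phaseData hd0 hd1 σ μ ν))
  have hL := hF σ μ ν m k s l a hs hlm ha'
  rw [← KleinGordon.fioKernel_eq] at hk hL
  have hle : F σ μ ν ≤ |C| + 1 := by
    linarith [hF₁ σ μ ν, hF₂ σ μ, hC σ, le_abs_self C]
  refine ⟨hk.integrable_mul hf, ?_⟩
  have h0 := hF₀ σ μ ν
  exact hk.eLpNorm_integralOp_le (by positivity)
    (hL.mono (ENNReal.ofReal_le_ofReal (by gcongr))) hf
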